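/- Let $d\ge 2$. Use $\hat f(\xi)=\int f(x)e^{-2\pi i x\cdot\xi}\,dx$, and for $M\in GL_d(\mathbb R)$ and $\psi\in\mathcal S(\mathbb R^d)$ write $\psi_M(x)=|\det M|^{-1}\psi(M^{-1}x)$ and $\tilde\psi(x)=\overline{\psi(-x)}$. For $f\in\mathcal S'$ and $\psi\in\mathcal S$, $f*\psi$ is the smooth function $x\mapsto\langle f,\psi(x-\cdot)\rangle$. **Classical spaces.** Let $\Phi,\varphi\in\mathcal S(\mathbb R^d)$ satisfy $\operatorname{supp}\hat\Phi\subseteq\{|\xi|\le 2\}$, $\operatorname{supp}\hat\varphi\subseteq\{\tfrac12\le|\xi|\le2\}$, and, for some $c>0$, $|\hat\Phi(\xi)|\ge c$ if $|\xi|\le\frac53$ and $|\hat\varphi(\xi)|\ge c$ if $\frac35\le|\xi|\le\frac53$. For $\alpha\in\mathbb R$, $0<p<\infty$, $0<q\le\infty$, $\mathbf F^{\alpha,q}_p$ is the set of $f\in\mathcal S'(\mathbb R^d)$ with $$\|f\|_{\mathbf F^{\alpha,q}_p}=\|\Phi*f\|_{L^p}+\Big\|\Big(\sum_{\nu\ge0}\big(2^{\nu\alpha}\,|2^{d\nu}\varphi(2^\nu\cdot)*f|\big)^q\Big)^{1/q}\Big\|_{L^p}<\infty$$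 (supremum over $\nu$ if $q=\infty$). **Shear anisotropic spaces.** For $1\le i\le d$ let $A_{(i)}$ be the diagonal matrix with entry $4$ in place $i$ and $2$ elsewhere, and for $\ell\in\mathbb Z^{d-1}$ let $B_{(i)}^{[\ell]}$ be the identity matrix with the $d-1$ off-diagonal entries of row $i$ replaced by $\ell_1,\dots,\ell_{d-1}$ (in order). Let $\hat\psi_1,\hat\psi_2\in C^\infty(\mathbb R)$ be complex valued with $\operatorname{supp}\hat\psi_1\subseteq[-\frac12,-\frac1{16}]\cup[\frac1{16},\frac12]$, $\operatorname{supp}\hat\psi_2\subseteq[-1,1]$, $\sum_{j\ge0}|\hat\psi_1(2^{-2j}\omega)|^2=1$ for $|\omega|\ge\frac18$, and $|\hat\psi_2(\omega-1)|^2+|\hat\psi_2(\omega)|^2+|\hat\psi_2(\omega+1)|^2=1$ for $|\omega|\le1$. Let $\psi^{(i)}\in\mathcal S(\mathbb R^d)$ be given by $\hat\psi^{(i)}(\xi)=\hat\psi_1(\xi_i)\prod_{k\ne i}\hat\psi_2(\xi_k/\xi_i)$ (understood as $0$ where $\xi_i=0$), and let $\Psi\in\mathcal S(\mathbb R^d)$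 have $\operatorname{supp}\hat\Psi\subseteq[-\frac14,\frac14]^d$ and $|\hat\Psi|=1$ on $[-\frac18,\frac18]^d$. With $|Q_j|=2^{-(d+1)j}$, $\mathbf F^{\alpha,q}_p(AB)$ is the set of $f\in\mathcal S'(\mathbb R^d)$ with $$\|f\|_{\mathbf F^{\alpha,q}_p(AB)}=\|f*\Psi\|_{L^p}+\Big\|\Big(\sum_{i=1}^d\sum_{j\ge0}\ \sum_{\ell\in\mathbb Z^{d-1},\,\max_k|\ell_k|\le2^j}\big[|Q_j|^{-\alpha}\,|\tilde\psi^{(i)}_{A_{(i)}^{-j}B_{(i)}^{[-\ell]}}*f|\big]^q\Big)^{1/q}\Big\|_{L^p}<\infty$$ (supremum if $q=\infty$). **Theorem.** Let $\alpha_1,\alpha_2\in\mathbb R$, $0<q\le\infty$ and $0<p<\infty$ be such that $$2\alpha_1+d+(d-1)\Big(1-\frac1q\Big)_+\le(d+1)\alpha_2+1,\qquad \Big(1-\frac1q\Big)_+=\max\Big\{0,1-\frac1q\Big\}$$ (with $1/q=0$ if $q=\infty$). Then $\mathbf F^{\alpha_2,q}_p(AB)\hookrightarrow\mathbf F^{\alpha_1,q}_p$: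 that is, $\mathbf F^{\alpha_2,q}_p(AB)\subseteq\mathbf F^{\alpha_1,q}_p$, and there is a constant $C<\infty$, depending only on $d,p,q,\alpha_1,\alpha_2$ and the generators $\Phi,\varphi,\Psi,\psi_1,\psi_2$, with $\|f\|_{\mathbf F^{\alpha_1,q}_p}\le C\,\|f\|_{\mathbf F^{\alpha_2,q}_p(AB)}$ for all $f\in\mathbf F^{\alpha_2,q}_p(AB)$. -/

import Mathlib

open MeasureTheory FourierTransform
open scoped SchwartzMap ENNReal NNReal ContDiff

noncomputable section

namespace ShearletTL

/-- Euclidean space `ℝ^d`, with the Euclidean norm and Lebesgue measure. -/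
abbrev Eucl (d : ℕ) : Type := EuclideanSpace ℝ (Fin d)

/-! ### Dilations, involution and convolution -/

/-- The linear automorphism `x ↦ M x` of `ℝ^d` given by an invertible matrix `M`. -/
def matEquiv {d : ℕ} (M : GL (Fin d) ℝ) : Eucl d ≃L[ℝ] Eucl d :=
  LinearEquiv.toContinuousLinearEquiv
    (LinearEquiv.ofLinearMap
      (Matrix.toEuclideanLin (M : Matrix (Fin d) (Fin d) ℝ))
      (Matrix.toEuclideanLin ((M⁻¹ : GL (Fin d) ℝ) : Matrix (Fin d) (Fin d) ℝ))
      (by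
        ext1 x
        apply (WithLp.equiv 2 (Fin d → ℝ)).injective
        simp [Matrix.mulVec_mulVec, ← Units.val_mul,
          -Matrix.coe_units_inv])
      (by
        ext1 x
        apply (WithLp.equiv 2 (Fin d → ℝ)).injective
        simp [Matrix.mulVec_mulVec, ← Units.val_mul,
          -Matrix.coe_units_inv]))

theorem matEquiv_apply {d : ℕ} (M : GL (Fin d) ℝ) (x : Eucl d) (k : Fin d) :
    matEquiv M x k = (M : Matrix (Fin d) (Fin d) ℝ).mulVec x.ofLp k := rfl

/-- The dilation `ψ_M(x) = |det M|⁻¹ ψ(M⁻¹ x)`. -/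
def dilate {d : ℕ} (M : GL (Fin d) ℝ) (ψ : 𝓢(Eucl d, ℂ)) : 𝓢(Eucl d, ℂ) :=
  |(M : Matrix (Fin d) (Fin d) ℝ).det|⁻¹ •
    SchwartzMap.compCLMOfContinuousLinearEquiv ℂ (matEquiv M⁻¹) ψ

theorem dilate_apply {d : ℕ} (M : GL (Fin d) ℝ) (ψ : 𝓢(Eucl d, ℂ)) (x : Eucl d) :
    dilate M ψ x
      = |(M : Matrix (Fin d) (Fin d) ℝ).det|⁻¹ • ψ (matEquiv M⁻¹ x) := rfl

/-- The reflection `x ↦ ψ(-x)`. -/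
def reflect {d : ℕ} (ψ : 𝓢(Eucl d, ℂ)) : 𝓢(Eucl d, ℂ) :=
  SchwartzMap.compCLMOfContinuousLinearEquiv ℂ (ContinuousLinearEquiv.neg ℝ) ψ

/-- The involution `ψ̃(x) = conj ψ(-x)`. -/
def invol {d : ℕ} (ψ : 𝓢(Eucl d, ℂ)) : 𝓢(Eucl d, ℂ) :=
  SchwartzMap.postcompCLM (𝕜 := ℝ) (Complex.conjCLE : ℂ →L[ℝ] ℂ) (reflect ψ)

theorem invol_apply {d : ℕ} (ψ : 𝓢(Eucl d, ℂ)) (x : Eucl d) :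
    invol ψ x = (starRingEnd ℂ) (ψ (-x)) := rfl

/-- The convolution of a tempered distribution `f` with a Schwartz function `ψ`, which is the
function `x ↦ ⟨f, ψ(x - ·)⟩`. -/
def conv {d : ℕ} (f : 𝓢'(Eucl d, ℂ)) (ψ : 𝓢(Eucl d, ℂ)) (x : Eucl d) : ℂ :=
  f (SchwartzMap.compSubConstCLM ℂ x (reflect ψ))

theorem conv_kernel_apply {d : ℕ} (ψ : 𝓢(Eucl d, ℂ)) (x y : Eucl d) :
    SchwartzMap.compSubConstCLM ℂ x (reflect ψ) y = ψ (x - y) := by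
  change ψ (-(y - x)) = ψ (x - y)
  rw [neg_sub]

/-- The `ℓ^q` quasi-norm of a family of extended nonnegative reals, `0 < q ≤ ∞`. -/
def lqNorm {ι : Type*} (q : ℝ≥0∞) (a : ι → ℝ≥0∞) : ℝ≥0∞ :=
  if q = ⊤ then ⨆ t, a t else (∑' t, a t ^ q.toReal) ^ (1 / q.toReal)

/-! ### The classical (dyadic, isotropic) spaces -/

/-- An admissible pair `(Φ, φ)` for the classical inhomogeneous spaces. -/
structure DyadicPair (d : ℕ) where
  lowPass : 𝓢(Eucl d, ℂ)
  bandPass : 𝓢(Eucl d, ℂ)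
  lowPass_supp : tsupport (𝓕 lowPass : 𝓢(Eucl d, ℂ)) ⊆ {ξ | ‖ξ‖ ≤ 2}
  bandPass_supp : tsupport (𝓕 bandPass : 𝓢(Eucl d, ℂ)) ⊆ {ξ | 1 / 2 ≤ ‖ξ‖ ∧ ‖ξ‖ ≤ 2}
  lowPass_lower : ∃ c : ℝ, 0 < c ∧ ∀ ξ : Eucl d, ‖ξ‖ ≤ 5 / 3 →
    c ≤ ‖(𝓕 lowPass : 𝓢(Eucl d, ℂ)) ξ‖
  bandPass_lower : ∃ c : ℝ, 0 < c ∧ ∀ ξ : Eucl d, 3 / 5 ≤ ‖ξ‖ → ‖ξ‖ ≤ 5 / 3 →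
    c ≤ ‖(𝓕 bandPass : 𝓢(Eucl d, ℂ)) ξ‖

/-- The scalar matrix `2^ν I`. -/
def dyadicGL (d ν : ℕ) : GL (Fin d) ℝ :=
  Matrix.GeneralLinearGroup.scalar (Fin d) (Units.mk0 ((2 : ℝ) ^ ν) (by positivity))

/-- The dyadic dilation `x ↦ 2^{dν} φ(2^ν x)`. -/
def dyadicDilate {d : ℕ} (ν : ℕ) (φ : 𝓢(Eucl d, ℂ)) : 𝓢(Eucl d, ℂ) :=
  dilate (dyadicGL d ν)⁻¹ φ

/-- The quasi-norm of the classical inhomogeneous Triebel-Lizorkin space `F^{α,q}_p`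
(with value `∞` off the space). -/
def dyadicNorm {d : ℕ} (D : DyadicPair d) (α : ℝ) (p q : ℝ≥0∞) (f : 𝓢'(Eucl d, ℂ)) : ℝ≥0∞ :=
  eLpNorm (conv f D.lowPass) p volume +
    eLpNorm (fun x => lqNorm q fun ν : ℕ =>
      ENNReal.ofReal ((2 : ℝ) ^ ((ν : ℝ) * α)) * ‖conv f (dyadicDilate ν D.bandPass) x‖ₑ)
      p volume

/-- The classical inhomogeneous Triebel-Lizorkin space `F^{α,q}_p`. -/
def dyadicSpace {d : ℕ} (D : DyadicPair d) (α : ℝ) (p q : ℝ≥0∞) : Set 𝓢'(Eucl d, ℂ) :=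
  {f | dyadicNorm D α p q f < ⊤}

/-! ### Shearlets on the cones and the shear anisotropic spaces -/

/-- The diagonal anisotropic dilation matrix `A_(i)`: `4` in place `i`, `2` elsewhere. -/
def anisoGL {d : ℕ} (i : Fin d) : GL (Fin d) ℝ :=
  Matrix.GeneralLinearGroup.mkOfDetNeZero
    (Matrix.diagonal fun k => if k = i then (4 : ℝ) else 2)
    (by
      rw [Matrix.det_diagonal]
      exact Finset.prod_ne_zero_iff.mpr fun k _ => by split_ifs <;> norm_num)

/-- The shear matrix `B_(i)^{[ℓ]}`: the identity matrix, except that the entries off the diagonal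
in row `i` are the `d - 1` integers `ℓ`. -/
def shearMatrix {d : ℕ} (i : Fin d) (ℓ : {k : Fin d // k ≠ i} → ℤ) :
    Matrix (Fin d) (Fin d) ℝ :=
  Matrix.of fun r c =>
    if r = c then 1 else if h : r = i ∧ c ≠ i then (ℓ ⟨c, h.2⟩ : ℝ) else 0

theorem shearMatrix_mul {d : ℕ} (i : Fin d) (ℓ m : {k : Fin d // k ≠ i} → ℤ) :
    shearMatrix i ℓ * shearMatrix i m = shearMatrix i (ℓ + m) := by
  have key : ∀ n : {k : Fin d // k ≠ i} → ℤ, shearMatrix i n = 1 + Matrix.of (fun r c =>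
      if h : r = i ∧ c ≠ i then (n ⟨c, h.2⟩ : ℝ) else 0) := by
    intro n
    ext r c
    simp only [shearMatrix, Matrix.of_apply, Matrix.add_apply, Matrix.one_apply]
    by_cases hrc : r = c
    · subst hrc
      simp
    · simp [hrc]
  rw [key, key, key, add_mul, mul_add, mul_add, one_mul, one_mul, mul_one]
  have hN : (Matrix.of (fun r c => if h : r = i ∧ c ≠ i then (ℓ ⟨c, h.2⟩ : ℝ) else 0) :
      Matrix (Fin d) (Fin d) ℝ) *
      Matrix.of (fun r c => if h : r = i ∧ c ≠ i then (m ⟨c, h.2⟩ : ℝ) else 0) = 0 := by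
    ext r c
    rw [Matrix.mul_apply, Matrix.zero_apply]
    refine Finset.sum_eq_zero fun k _ => ?_
    by_cases hk : k = i <;> simp [hk]
  rw [hN]
  ext r c
  simp only [Matrix.of_apply, Matrix.add_apply, Matrix.zero_apply, Pi.add_apply]
  by_cases h : r = i ∧ c ≠ i
  · simp only [h, ne_eq, not_false_eq_true, and_self, dite_true]
    push_cast
    ring
  · simp only [h, dite_false]
    ring

theorem shearMatrix_zero {d : ℕ} (i : Fin d) : shearMatrix i 0 = 1 := by
  ext r c
  simp [shearMatrix, Matrix.one_apply]

/-- The shear matrix as an invertible matrix, with inverse `B_(i)^{[-ℓ]}`. -/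
def shearGL {d : ℕ} (i : Fin d) (ℓ : {k : Fin d // k ≠ i} → ℤ) : GL (Fin d) ℝ where
  val := shearMatrix i ℓ
  inv := shearMatrix i (-ℓ)
  val_inv := by rw [shearMatrix_mul, add_neg_cancel, shearMatrix_zero]
  inv_val := by rw [shearMatrix_mul, neg_add_cancel, shearMatrix_zero]

/-- The shear parameters at scale `j` in the cone along the `i`-th axis: integer vectors `ℓ` with
`|ℓ_k| ≤ 2^j` for all `k`. -/
abbrev ShearParam {d : ℕ} (i : Fin d) (j : ℕ) : Type :=
  {ℓ : {k : Fin d // k ≠ i} → ℤ // ∀ k, |ℓ k| ≤ 2 ^ j}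

/-- The index set of all triples `(i, j, ℓ)`: direction, scale, shear. -/
abbrev ShearIndex (d : ℕ) : Type := Σ i : Fin d, Σ j : ℕ, ShearParam i j

/-- The generators of the shearlet system on the cones. With
`D^(i) = {|ξ_i| ≥ 1/8, |ξ_k| ≤ |ξ_i| for all k}`, the conditions imply for almost every `ξ` the
Parseval identity
`|Ψ̂(ξ)|² 1_{[-1/8,1/8]^d}(ξ) + ∑_{i,j,ℓ} |ψ̂^(i)(ξ A_(i)^{-j} B_(i)^{[-ℓ]})|² 1_{D^(i)}(ξ) = 1`.
At `ξ_i = 0` the product in `cone_fourier` vanishes because `ψ̂₁(0) = 0`. -/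
structure ShearletSystem (d : ℕ) where
  psi1Hat : ℝ → ℂ
  psi2Hat : ℝ → ℂ
  psi1Hat_smooth : ContDiff ℝ ∞ psi1Hat
  psi2Hat_smooth : ContDiff ℝ ∞ psi2Hat
  psi1Hat_supp : tsupport psi1Hat ⊆ Set.Icc (-(1 / 2)) (-(1 / 16)) ∪ Set.Icc (1 / 16) (1 / 2)
  psi2Hat_supp : tsupport psi2Hat ⊆ Set.Icc (-1) 1
  psi1Hat_sum : ∀ w : ℝ, 1 / 8 ≤ |w| →
    HasSum (fun j : ℕ => ‖psi1Hat ((2 : ℝ) ^ (-2 * (j : ℤ)) * w)‖ ^ 2) 1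
  psi2Hat_sum : ∀ w : ℝ, |w| ≤ 1 →
    ‖psi2Hat (w - 1)‖ ^ 2 + ‖psi2Hat w‖ ^ 2 + ‖psi2Hat (w + 1)‖ ^ 2 = 1
  /-- The shearlet generators `ψ^(i)`, one for each cone. -/
  cone : Fin d → 𝓢(Eucl d, ℂ)
  cone_fourier : ∀ (i : Fin d) (ξ : Eucl d), (𝓕 (cone i) : 𝓢(Eucl d, ℂ)) ξ =
    psi1Hat (ξ i) * ∏ k ∈ Finset.univ.erase i, psi2Hat (ξ k / ξ i)
  /-- The generator `Ψ` of the low frequencies. -/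
  low : 𝓢(Eucl d, ℂ)
  low_supp : tsupport (𝓕 low : 𝓢(Eucl d, ℂ)) ⊆ {ξ | ∀ k, |ξ k| ≤ 1 / 4}
  low_unimodular : ∀ ξ : Eucl d, (∀ k, |ξ k| ≤ 1 / 8) → ‖(𝓕 low : 𝓢(Eucl d, ℂ)) ξ‖ = 1

/-- The volume `|Q_j| = |det A|^{-j} = 2^{-(d+1)j}` of the shear anisotropic cells at scale `j`. -/
def cellVolume (d j : ℕ) : ℝ := ((2 : ℝ) ^ ((d + 1) * j))⁻¹

/-- The dilated shearlet `ψ^(i)_{A_(i)^{-j} B_(i)^{[-ℓ]}}`, that is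
`x ↦ |det A_(i)|^j ψ^(i)(B_(i)^{[ℓ]} A_(i)^j x)`. -/
def ShearletSystem.atom {d : ℕ} (S : ShearletSystem d) (t : ShearIndex d) : 𝓢(Eucl d, ℂ) :=
  dilate ((anisoGL t.1 ^ t.2.1)⁻¹ * (shearGL t.1 t.2.2.1)⁻¹) (S.cone t.1)

/-- The quasi-norm of the shear anisotropic inhomogeneous Triebel-Lizorkin space `F^{α,q}_p(AB)`
(with value `∞` off the space). -/
def shearNorm {d : ℕ} (S : ShearletSystem d) (α : ℝ) (p q : ℝ≥0∞) (f : 𝓢'(Eucl d, ℂ)) : ℝ≥0∞ :=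
  eLpNorm (conv f S.low) p volume +
    eLpNorm (fun x => lqNorm q fun t : ShearIndex d =>
      ENNReal.ofReal (cellVolume d t.2.1 ^ (-α)) * ‖conv f (invol (S.atom t)) x‖ₑ)
      p volume

/-- The shear anisotropic inhomogeneous Triebel-Lizorkin space `F^{α,q}_p(AB)`. -/
def shearSpace {d : ℕ} (S : ShearletSystem d) (α : ℝ) (p q : ℝ≥0∞) : Set 𝓢'(Eucl d, ℂ) :=
  {f | shearNorm S α p q f < ⊤}

end ShearletTL

end

/-! The hypothesis reads `2α₁ + (d-1)(1 + (1-1/q)₊) ≤ (d+1)α₂`. A Littlewood–Paley piece at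
frequency `2^ν` meets only shearlets of scales with `2j = ν + O(1)`, and each cone has `N ≈
2^(j(d-1))` shears at scale `j`. Comparing the weights `2^(να₁)` and `2^(j(d+1)α₂)`, one may lose
`N^(1+(1-1/q)₊)` in passing from the `ℓ^q` norm over the shears to their plain sum. The proof loses
strictly less. Hence the pieces decay geometrically in `ν` relative to the shear norm, and the `ℓ^q`
sum over `ν` costs only a constant; no vector-valued maximal inequality is needed.

Reconstruction (`exists_dyadic_reconstruction`). On the frequency side the piece is multiplied by a
smooth partition of unity into cones and, in each cone, by the resolution of the identity given by
the shearlets. In the coordinates of each shearlet the multipliers come from a list independent of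
the scale, so all kernels have bounded weighted `L¹` norms, and the piece is bounded pointwise by a
sum of Peetre maximal functions, one per shearlet, each in its own coordinates.

Peetre inequality (`exists_peetre_rpow_le`). The `r`-th power of each maximal function is at most a
weighted mean of `|f * ψ|^r`, uniformly in the distribution and so, by a change of variables,
uniformly in the matrix.

Single scale (`exists_single_scale_le`). For `p ≥ 1`, Hölder over the shears and Young for each mean
lose `N^(p-1+max(0,1-p/q))` in the `p`-th power. For `p < 1`, subadditivity of the `p`-th power
would be too lossy for small `p`. Instead `(∑ a)^p ≤ (sup a)^(p(1-p)) (∑ a^p)^p` is used. The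
supremum is controlled by the maximal operator over slabs of all slopes of the scale, which is
bounded on `L²` up to a factor `2^(jε)` (`exists_slab_maximal_le`). That operator is linearized on
lines parallel to the short axis of the slabs and treated by the `TT*` method.

The low-pass part and the finitely many remaining pieces are reconstructed from finitely many
shearlets and `Ψ` (`exists_finite_reconstruction`). -/

noncomputable section

namespace ShearletTL

/-! ### Tempered distributions under the integral of a convolution. -/

section Interchange

open scoped BoundedContinuousFunction
open LineDeriv

variable {E : Type*} [NormedAddCommGroup E] [InnerProductSpace ℝ E]

/-- Bounded continuous functions with values in the `n`-linear forms. -/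
abbrev FormBCF (E : Type*) [NormedAddCommGroup E] [InnerProductSpace ℝ E] (n : ℕ) : Type _ :=
  @BoundedContinuousFunction E (E [×n]→L[ℝ] ℂ) _
    (NormedAddCommGroup.toSeminormedAddCommGroup.toPseudoMetricSpace)

/-- The bounded continuous function `x ↦ ‖x‖^k D^n η(x)` attached to a Schwartz function. -/
def weightedDeriv (k n : ℕ) : 𝓢(E, ℂ) →ₗ[ℂ] FormBCF E n where
  toFun η := BoundedContinuousFunction.ofNormedAddCommGroup
    (fun x => (‖x‖ ^ k : ℝ) • iteratedFDeriv ℝ n η x)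
    ((continuous_norm.pow k).smul ((η.smooth n).continuous_iteratedFDeriv le_rfl))
    (SchwartzMap.seminorm ℂ k n η) (fun x => by
      rw [norm_smul, norm_pow, norm_norm]
      exact SchwartzMap.le_seminorm ℂ k n η x)
  map_add' η₁ η₂ := by
    ext1 x
    have := iteratedFDeriv_add_apply (x := x) (η₁.smooth n).contDiffAt (η₂.smooth n).contDiffAt
    have h : (⇑(η₁ + η₂) : E → ℂ) = ⇑η₁ + ⇑η₂ := by ext; simp
    simp only [BoundedContinuousFunction.coe_ofNormedAddCommGroup,
      BoundedContinuousFunction.add_apply]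
    rw [h, this, smul_add]
  map_smul' c η := by
    ext1 x
    have := iteratedFDeriv_const_smul_apply (x := x) (a := c) (η.smooth n).contDiffAt
    have h : (⇑(c • η) : E → ℂ) = c • ⇑η := by ext; simp
    simp only [BoundedContinuousFunction.coe_ofNormedAddCommGroup,
      BoundedContinuousFunction.smul_apply, RingHom.id_apply]
    rw [h, this, smul_comm]

theorem weightedDeriv_apply (k n : ℕ) (η : 𝓢(E, ℂ)) (x : E) :
    weightedDeriv k n η x = (‖x‖ ^ k : ℝ) • iteratedFDeriv ℝ n η x := rfl

theorem norm_weightedDeriv (k n : ℕ) (η : 𝓢(E, ℂ)) :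
    ‖weightedDeriv k n η‖ = SchwartzMap.seminorm ℂ k n η := by
  refine le_antisymm ?_ ?_
  · refine (BoundedContinuousFunction.norm_le (apply_nonneg _ _)).2 fun x => ?_
    rw [weightedDeriv_apply, norm_smul, norm_pow, norm_norm]
    exact SchwartzMap.le_seminorm ℂ k n η x
  · refine SchwartzMap.seminorm_le_bound ℂ k n η (norm_nonneg _) fun x => ?_
    have := (weightedDeriv k n η).norm_coe_le_norm x
    rwa [weightedDeriv_apply, norm_smul, norm_pow, norm_norm] at this

/-- Finite products of spaces of bounded continuous functions with values in forms. -/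
def DerivSpace (E : Type*) [NormedAddCommGroup E] [InnerProductSpace ℝ E] (s : Finset (ℕ × ℕ)) :
    Type _ := ∀ a : s, FormBCF E a.1.2

instance (s : Finset (ℕ × ℕ)) : NormedAddCommGroup (DerivSpace E s) :=
  inferInstanceAs (NormedAddCommGroup (∀ a : s, FormBCF E a.1.2))

instance (s : Finset (ℕ × ℕ)) : NormedSpace ℂ (DerivSpace E s) :=
  inferInstanceAs (NormedSpace ℂ (∀ a : s, FormBCF E a.1.2))

instance (s : Finset (ℕ × ℕ)) : NormedSpace ℝ (DerivSpace E s) :=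
  inferInstanceAs (NormedSpace ℝ (∀ a : s, FormBCF E a.1.2))

instance (s : Finset (ℕ × ℕ)) : CompleteSpace (DerivSpace E s) :=
  inferInstanceAs (CompleteSpace (∀ a : s, FormBCF E a.1.2))

/-- The joint embedding of the Schwartz space given by finitely many weighted derivatives. -/
def weightedDerivs (s : Finset (ℕ × ℕ)) :
    𝓢(E, ℂ) →ₗ[ℂ] DerivSpace E s :=
  (LinearMap.pi fun a => weightedDeriv a.1.1 a.1.2 : 𝓢(E, ℂ) →ₗ[ℂ] (∀ a : s, FormBCF E a.1.2))

theorem norm_weightedDerivs (s : Finset (ℕ × ℕ)) (η : 𝓢(E, ℂ)) :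
    ‖weightedDerivs s η‖ = s.sup (schwartzSeminormFamily ℂ E ℂ) η := by
  refine le_antisymm ?_ ?_
  · refine (pi_norm_le_iff_of_nonneg (G := fun a : s => FormBCF E a.1.2)
      (apply_nonneg _ _)).2 fun a => ?_
    change ‖weightedDeriv a.1.1 a.1.2 η‖ ≤ _
    rw [norm_weightedDeriv]
    exact Seminorm.le_def.1 (Finset.le_sup (f := schwartzSeminormFamily ℂ E ℂ) a.2) η
  · refine Seminorm.finset_sup_apply_le (norm_nonneg _) fun a ha => ?_
    have := norm_le_pi_norm (G := fun a : s => FormBCF E a.1.2) (weightedDerivs s η) ⟨a, ha⟩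
    change ‖weightedDeriv a.1 a.2 η‖ ≤ _ at this
    rwa [norm_weightedDeriv] at this

theorem continuous_weightedDerivs (s : Finset (ℕ × ℕ)) :
    Continuous (weightedDerivs (E := E) s) := by
  refine WithSeminorms.continuous_normedSpace_rng _ (schwartz_withSeminorms ℂ E ℂ) _
    ⟨s, 1, Seminorm.le_def.2 fun η => ?_⟩
  rw [one_smul]
  exact (norm_weightedDerivs s η).le

theorem weightedDerivs_injective {s : Finset (ℕ × ℕ)} (h0 : (0, 0) ∈ s) :
    Function.Injective (weightedDerivs (E := E) s) := by
  intro η₁ η₂ h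
  ext x
  have h0 : weightedDeriv 0 0 η₁ = weightedDeriv 0 0 η₂ := congrFun h ⟨(0, 0), h0⟩
  have h1 := DFunLike.congr_fun h0 x
  simp only [weightedDeriv_apply, pow_zero, one_smul] at h1
  have h2 := DFunLike.congr_fun h1 0
  simpa using h2

/-- A linear functional that is bounded in terms of an injective linear map into a normed space
extends to a continuous functional on that space. -/
theorem exists_factor_of_bound {X W : Type*} [AddCommGroup X] [Module ℂ X] [NormedAddCommGroup W]
    [NormedSpace ℂ W] (J : X →ₗ[ℂ] W) (hJ : Function.Injective J) (Λ : X →ₗ[ℂ] ℂ) (C : ℝ)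
    (h : ∀ η, ‖Λ η‖ ≤ C * ‖J η‖) : ∃ G : W →L[ℂ] ℂ, ∀ η, Λ η = G (J η) := by
  let e := LinearEquiv.ofInjective J hJ
  let g : StrongDual ℂ (LinearMap.range J) :=
    LinearMap.mkContinuous (Λ ∘ₗ e.symm.toLinearMap) C (fun v => by
      have := h (e.symm v)
      have hv : J (e.symm v) = v := congrArg Subtype.val (e.apply_symm_apply v)
      rw [hv] at this
      simpa using this)
  obtain ⟨G, hG, -⟩ := exists_extension_norm_eq _ g
  refine ⟨G, fun η => ?_⟩
  have h1 := hG (e η)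
  have h2 : g (e η) = Λ η := by
    change Λ (e.symm (e η)) = _
    rw [e.symm_apply_apply]
  rw [← h2, ← h1]
  rfl

/-- A continuous functional on the Schwartz space factors through finitely many weighted
derivatives. -/
theorem exists_factor_weightedDerivs (Λ : 𝓢(E, ℂ) →L[ℂ] ℂ) :
    ∃ (s : Finset (ℕ × ℕ)) (G : DerivSpace E s →L[ℂ] ℂ),
      ∀ η, Λ η = G (weightedDerivs s η) := by
  obtain ⟨s₀, C, -, hC⟩ := Seminorm.bound_of_continuous (schwartz_withSeminorms ℂ E ℂ)
    ((normSeminorm ℂ ℂ).comp Λ.toLinearMap) (continuous_norm.comp Λ.continuous)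
  -- The order `(0, 0)` is added only to make the embedding injective.
  refine ⟨insert (0, 0) s₀, exists_factor_of_bound _
    (weightedDerivs_injective (Finset.mem_insert_self _ _)) Λ.toLinearMap C fun η => ?_⟩
  rw [norm_weightedDerivs]
  refine (Seminorm.le_def.1 hC η).trans ?_
  change (C : ℝ) * _ ≤ _
  gcongr
  exact Seminorm.le_def.1 (Finset.sup_mono (Finset.subset_insert _ _)) η

theorem iteratedFDeriv_compSubConst (n : ℕ) (η : 𝓢(E, ℂ)) (h x : E) :
    iteratedFDeriv ℝ n (η.compSubConstCLM ℂ h) x = iteratedFDeriv ℝ n η (x - h) := by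
  have : (⇑(η.compSubConstCLM ℂ h) : E → ℂ) = fun z => η (z - h) := by ext; simp
  rw [this, iteratedFDeriv_comp_sub]

/-- The bound rests on `‖x‖ ≤ (1 + ‖x - h‖)(1 + ‖h‖)`. Polynomial growth in `h` suffices for
integration against a Schwartz kernel. -/
theorem seminorm_compSubConst_le (k n : ℕ) (η : 𝓢(E, ℂ)) :
    ∃ C : ℝ, 0 ≤ C ∧ ∀ h : E, SchwartzMap.seminorm ℂ k n (η.compSubConstCLM ℂ h)
      ≤ C * (1 + ‖h‖) ^ k := by
  refine ⟨2 ^ k * (Finset.Iic (k, n)).sup (fun m => SchwartzMap.seminorm ℂ m.1 m.2) η,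
    by positivity, fun h => ?_⟩
  refine SchwartzMap.seminorm_le_bound ℂ k n _ (by positivity) fun x => ?_
  rw [iteratedFDeriv_compSubConst]
  have h1 := SchwartzMap.one_add_le_sup_seminorm_apply (𝕜 := ℂ) (m := (k, n)) le_rfl le_rfl η (x - h)
  have h2 : ‖x‖ ≤ (1 + ‖x - h‖) * (1 + ‖h‖) := by
    have : ‖x‖ ≤ ‖x - h‖ + ‖h‖ := by simpa using norm_add_le (x - h) h
    nlinarith [norm_nonneg (x - h), norm_nonneg h]
  calc ‖x‖ ^ k * ‖iteratedFDeriv ℝ n η (x - h)‖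
      ≤ ((1 + ‖x - h‖) * (1 + ‖h‖)) ^ k * ‖iteratedFDeriv ℝ n η (x - h)‖ := by gcongr
    _ = ((1 + ‖x - h‖) ^ k * ‖iteratedFDeriv ℝ n η (x - h)‖) * (1 + ‖h‖) ^ k := by
        rw [mul_pow]; ring
    _ ≤ _ := by gcongr

/-- Mean value inequality on the segment from `x` to `x - h`, along which the weight stays
comparable because `‖h‖ ≤ 1`. -/
theorem seminorm_compSubConst_sub_le (k n : ℕ) (η : 𝓢(E, ℂ)) :
    ∃ C : ℝ, 0 ≤ C ∧ ∀ h : E, ‖h‖ ≤ 1 →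
      SchwartzMap.seminorm ℂ k n (η.compSubConstCLM ℂ h - η) ≤ C * ‖h‖ := by
  set B := 2 ^ k * (Finset.Iic (k, n + 1)).sup (fun m => SchwartzMap.seminorm ℂ m.1 m.2) η with hB
  have hB0 : 0 ≤ B := by positivity
  refine ⟨2 ^ k * B, by positivity, fun h hh => ?_⟩
  refine SchwartzMap.seminorm_le_bound ℂ k n _ (by positivity) fun x => ?_
  have hsub : iteratedFDeriv ℝ n (⇑(η.compSubConstCLM ℂ h - η)) x
      = iteratedFDeriv ℝ n η (x - h) - iteratedFDeriv ℝ n η x := by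
    have h0 : (⇑(η.compSubConstCLM ℂ h - η) : E → ℂ) = ⇑(η.compSubConstCLM ℂ h) - ⇑η := by
      ext; simp
    rw [h0, iteratedFDeriv_sub_apply ((SchwartzMap.smooth _ n).contDiffAt) (η.smooth n).contDiffAt,
      iteratedFDeriv_compSubConst]
  rw [hsub]
  have hmv : ‖iteratedFDeriv ℝ n η (x - h) - iteratedFDeriv ℝ n η x‖
      ≤ (2 ^ k * B / (1 + ‖x‖) ^ k) * ‖(x - h) - x‖ := by
    refine Convex.norm_image_sub_le_of_norm_fderiv_le (𝕜 := ℝ) (s := segment ℝ x (x - h))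
      (fun z _ => ((η.smooth ⊤).differentiable_iteratedFDeriv
        (mod_cast ENat.natCast_lt_top n)) z) (fun z hz => ?_)
      (convex_segment _ _) (left_mem_segment _ _ _) (right_mem_segment _ _ _)
    have hz' : ‖z - x‖ ≤ 1 := by
      have := norm_sub_le_of_mem_segment hz
      simp only [sub_sub_cancel_left, norm_neg] at this
      linarith
    rw [norm_fderiv_iteratedFDeriv, le_div_iff₀ (by positivity)]
    have h1 := SchwartzMap.one_add_le_sup_seminorm_apply (𝕜 := ℂ) (m := (k, n + 1)) le_rfl le_rfl η z
    have h2 : 1 + ‖x‖ ≤ 2 * (1 + ‖z‖) := by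
      have : ‖x‖ ≤ ‖z‖ + ‖z - x‖ := by
        have := norm_sub_le z (z - x); simpa using this
      linarith [norm_nonneg z]
    calc ‖iteratedFDeriv ℝ (n + 1) η z‖ * (1 + ‖x‖) ^ k
        ≤ ‖iteratedFDeriv ℝ (n + 1) η z‖ * (2 * (1 + ‖z‖)) ^ k := by gcongr
      _ = 2 ^ k * ((1 + ‖z‖) ^ k * ‖iteratedFDeriv ℝ (n + 1) η z‖) := by rw [mul_pow]; ring
      _ ≤ 2 ^ k * B := by gcongr
  have h3 : ‖(x - h) - x‖ = ‖h‖ := by simp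
  rw [h3] at hmv
  calc ‖x‖ ^ k * ‖iteratedFDeriv ℝ n η (x - h) - iteratedFDeriv ℝ n η x‖
      ≤ (1 + ‖x‖) ^ k * ((2 ^ k * B / (1 + ‖x‖) ^ k) * ‖h‖) := by
        gcongr; linarith
    _ = 2 ^ k * B * ‖h‖ := by field_simp

/-- Translation is continuous into the Schwartz space. -/
theorem continuous_compSubConst (η : 𝓢(E, ℂ)) :
    Continuous fun h : E => η.compSubConstCLM ℂ h := by
  rw [continuous_iff_continuousAt]
  intro h₀
  have h0 : Filter.Tendsto (fun h : E => η.compSubConstCLM ℂ h) (nhds 0) (nhds η) := by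
    rw [(schwartz_withSeminorms ℂ E ℂ).tendsto_nhds _ η]
    rintro ⟨k, n⟩ ε hε
    obtain ⟨C, hC0, hC⟩ := seminorm_compSubConst_sub_le k n η
    have : Filter.Tendsto (fun h : E => C * ‖h‖) (nhds 0) (nhds 0) := by
      have : Continuous fun h : E => C * ‖h‖ := by fun_prop
      simpa using this.tendsto 0
    filter_upwards [this.eventually (gt_mem_nhds hε), Metric.ball_mem_nhds (0 : E) one_pos]
      with h h1 h2
    refine (hC h ?_).trans_lt h1
    simpa using (mem_ball_zero_iff.1 h2).le
  have h1 : (fun h : E => η.compSubConstCLM ℂ h)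
      = fun h => (η.compSubConstCLM ℂ (h - h₀)).compSubConstCLM ℂ h₀ := by
    ext h x; simp only [SchwartzMap.compSubConstCLM_apply]; congr 1; abel
  rw [ContinuousAt, h1]
  have h2 : Filter.Tendsto (fun h : E => h - h₀) (nhds h₀) (nhds 0) := by
    have : Continuous fun h : E => h - h₀ := by fun_prop
    simpa using this.tendsto h₀
  exact ((SchwartzMap.compSubConstCLM ℂ h₀ : 𝓢(E, ℂ) →L[ℂ] 𝓢(E, ℂ)).continuous.tendsto η).comp
    (h0.comp h2)

/-- A continuous functional of the translates of a Schwartz function grows polynomially. -/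
theorem exists_norm_apply_compSubConst_le {W : Type*} [NormedAddCommGroup W] [NormedSpace ℂ W]
    (Λ : 𝓢(E, ℂ) →L[ℂ] W) (η : 𝓢(E, ℂ)) :
    ∃ (C : ℝ) (K : ℕ), 0 ≤ C ∧ ∀ h, ‖Λ (η.compSubConstCLM ℂ h)‖ ≤ C * (1 + ‖h‖) ^ K := by
  obtain ⟨s, C, -, hC⟩ := Seminorm.bound_of_continuous (schwartz_withSeminorms ℂ E ℂ)
    ((normSeminorm ℂ W).comp Λ.toLinearMap) (continuous_norm.comp Λ.continuous)
  choose B hB0 hB using fun a : ℕ × ℕ => seminorm_compSubConst_le a.1 a.2 η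
  have hsum : 0 ≤ ∑ a ∈ s, B a := Finset.sum_nonneg fun a _ => hB0 a
  refine ⟨C * ∑ a ∈ s, B a, s.sup Prod.fst, by positivity, fun h => ?_⟩
  refine (Seminorm.le_def.1 hC _).trans ?_
  change (C : ℝ) * _ ≤ _
  rw [mul_assoc]
  gcongr
  refine Seminorm.finset_sup_apply_le (by positivity) fun a ha => ?_
  refine (hB a h).trans ?_
  have h1 : B a ≤ ∑ a ∈ s, B a := Finset.single_le_sum (fun a _ => hB0 a) ha
  have h2 : (1 + ‖h‖) ^ a.1 ≤ (1 + ‖h‖) ^ s.sup Prod.fst :=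
    pow_le_pow_right₀ (by linarith [norm_nonneg h]) (Finset.le_sup (f := Prod.fst) ha)
  have := hB0 a
  gcongr

variable [FiniteDimensional ℝ E] [MeasurableSpace E] [BorelSpace E]

/-- The convolution of two Schwartz functions, as a Schwartz function. -/
def sconv (κ ψ : 𝓢(E, ℂ)) : 𝓢(E, ℂ) := SchwartzMap.convolution (ContinuousLinearMap.mul ℂ ℂ) κ ψ

theorem fourier_sconv (κ ψ : 𝓢(E, ℂ)) (ξ : E) :
    (𝓕 (sconv κ ψ) : 𝓢(E, ℂ)) ξ = (𝓕 κ : 𝓢(E, ℂ)) ξ * (𝓕 ψ : 𝓢(E, ℂ)) ξ := by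
  rw [sconv, SchwartzMap.fourier_convolution]; rfl

theorem sconv_apply (κ ψ : 𝓢(E, ℂ)) (x : E) : sconv κ ψ x = ∫ y, κ y * ψ (x - y) := by
  rw [sconv, SchwartzMap.convolution_apply]; rfl

theorem schwartz_ext_fourier {f g : 𝓢(E, ℂ)}
    (h : ∀ ξ, (𝓕 f : 𝓢(E, ℂ)) ξ = (𝓕 g : 𝓢(E, ℂ)) ξ) : f = g := by
  have : (𝓕 f : 𝓢(E, ℂ)) = 𝓕 g := SchwartzMap.ext h
  simpa using congrArg (fun u : 𝓢(E, ℂ) => (𝓕⁻ u : 𝓢(E, ℂ))) this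

/-- Both sides have the same Fourier transform. Derivatives thus fall on the translated factor,
which identifies every component of the vector-valued integral in `apply_sconv`. -/
theorem lineDerivOp_sconv (κ ψ : 𝓢(E, ℂ)) (m : E) :
    ∂_{m} (sconv κ ψ) = sconv κ (∂_{m} ψ) := by
  refine schwartz_ext_fourier fun ξ => ?_
  have hm : (inner ℝ · m : E → ℝ).HasTemperateGrowth := ((innerSL ℝ).flip m).hasTemperateGrowth
  rw [fourier_sconv, SchwartzMap.fourier_lineDerivOp_eq, SchwartzMap.fourier_lineDerivOp_eq]
  simp only [smul_apply, SchwartzMap.smulLeftCLM_apply_apply hm, fourier_sconv,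
    smul_eq_mul, Complex.real_smul]
  ring

theorem iteratedLineDerivOp_sconv (κ ψ : 𝓢(E, ℂ)) {n : ℕ} (m : Fin n → E) :
    ∂^{m} (sconv κ ψ) = sconv κ (∂^{m} ψ) := by
  induction n with
  | zero => simp
  | succ n ih => rw [iteratedLineDerivOp_succ_left, iteratedLineDerivOp_succ_left, ih,
      lineDerivOp_sconv]

theorem integrable_one_add_norm_pow_mul (κ : 𝓢(E, ℂ)) (K : ℕ) :
    Integrable fun y => (1 + ‖y‖) ^ K * ‖κ y‖ := by
  have : (fun y => (1 + ‖y‖) ^ K * ‖κ y‖)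
      = fun y => ∑ i ∈ Finset.range (K + 1), (K.choose i : ℝ) * (‖y‖ ^ i * ‖κ y‖) := by
    ext y
    rw [add_comm, add_pow, Finset.sum_mul]
    refine Finset.sum_congr rfl fun i _ => by simp; ring
  rw [this]
  exact integrable_finsetSum _ fun i _ => (κ.integrable_pow_mul volume i).const_mul _

theorem integrable_smul_compSubConst {W : Type*} [NormedAddCommGroup W] [NormedSpace ℂ W]
    (J : 𝓢(E, ℂ) →L[ℂ] W) (κ ψ : 𝓢(E, ℂ)) :
    Integrable fun y => κ y • J (ψ.compSubConstCLM ℂ y) := by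
  obtain ⟨C, K, hC0, hC⟩ := exists_norm_apply_compSubConst_le J ψ
  have hcont : Continuous fun y => κ y • J (ψ.compSubConstCLM ℂ y) :=
    κ.continuous.smul (J.continuous.comp (continuous_compSubConst ψ))
  refine ((integrable_one_add_norm_pow_mul κ K).const_mul C).mono' hcont.aestronglyMeasurable
    (Filter.Eventually.of_forall fun y => ?_)
  rw [norm_smul]
  calc _ ≤ ‖κ y‖ * (C * (1 + ‖y‖) ^ K) := by gcongr; exact hC y
    _ = _ := by ring

/-- A continuous functional may be taken under the integral defining a convolution. -/
theorem apply_sconv (Λ : 𝓢(E, ℂ) →L[ℂ] ℂ) (κ ψ : 𝓢(E, ℂ)) :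
    Λ (sconv κ ψ) = ∫ y, κ y * Λ (ψ.compSubConstCLM ℂ y) := by
  -- The Schwartz space is not normed, so the integral of the translates is taken as a Bochner
  -- integral in the Banach space through which `Λ` factors. Evaluation at points and vectors shows
  -- that it equals the image of the convolution.
  obtain ⟨s, G, hG⟩ := exists_factor_weightedDerivs Λ
  let J : 𝓢(E, ℂ) →L[ℂ] DerivSpace E s :=
    ⟨weightedDerivs (E := E) s, continuous_weightedDerivs s⟩
  have hint := integrable_smul_compSubConst J κ ψ
  have hI : ∫ y, κ y • J (ψ.compSubConstCLM ℂ y) = J (sconv κ ψ) := by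
    funext a
    ext1 x
    ext1 m
    let ev : DerivSpace E s →L[ℝ] ℂ :=
      (ContinuousMultilinearMap.apply ℝ (fun _ : Fin a.1.2 => E) ℂ m) ∘L
        (BoundedContinuousFunction.evalCLM ℝ x) ∘L (show DerivSpace E s →L[ℝ] FormBCF E a.1.2 from
          ContinuousLinearMap.proj (R := ℝ) (φ := fun a : s => FormBCF E a.1.2) a)
    have hev : ∀ η, ev (J η) = (‖x‖ ^ a.1.1 : ℝ) • (∂^{m} η : 𝓢(E, ℂ)) x := by
      intro η
      rw [SchwartzMap.iteratedLineDerivOp_eq_iteratedFDeriv]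
      rfl
    change ev (∫ y, κ y • J (ψ.compSubConstCLM ℂ y)) = ev (J (sconv κ ψ))
    rw [← ev.integral_comp_comm hint, hev, iteratedLineDerivOp_sconv, sconv_apply]
    rw [← integral_smul]
    refine integral_congr_ae (Filter.Eventually.of_forall fun y => ?_)
    have hs : ev (κ y • J (ψ.compSubConstCLM ℂ y)) = κ y * ev (J (ψ.compSubConstCLM ℂ y)) := rfl
    simp only [hs, hev]
    rw [SchwartzMap.iteratedLineDerivOp_eq_iteratedFDeriv, iteratedFDeriv_compSubConst,
      ← SchwartzMap.iteratedLineDerivOp_eq_iteratedFDeriv, mul_smul_comm]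
  have hG' : ∀ η, Λ η = G (J η) := hG
  rw [hG', ← hI, ← G.integral_comp_comm hint]
  simp only [map_smul, smul_eq_mul, hG']

end Interchange

/-- The functional `ψ ↦ ⟨f, ψ(-·)⟩`, which gives `f * ψ` at the origin. -/
def convZero {d : ℕ} (f : 𝓢'(Eucl d, ℂ)) : 𝓢(Eucl d, ℂ) →L[ℂ] ℂ :=
  (⟨(f : 𝓢(Eucl d, ℂ) →ₗ[ℂ] ℂ), f.cont⟩ : 𝓢(Eucl d, ℂ) →L[ℂ] ℂ) ∘L
    SchwartzMap.compCLMOfContinuousLinearEquiv ℂ (ContinuousLinearEquiv.neg ℝ)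

theorem conv_eq_convZero {d : ℕ} (f : 𝓢'(Eucl d, ℂ)) (ψ : 𝓢(Eucl d, ℂ)) (x : Eucl d) :
    conv f ψ x = convZero f (ψ.compSubConstCLM ℂ (-x)) := by
  change f _ = f _
  congr 1
  ext y
  rw [conv_kernel_apply]
  change _ = ψ (-y - -x)
  congr 1
  abel

theorem continuous_conv {d : ℕ} (f : 𝓢'(Eucl d, ℂ)) (ψ : 𝓢(Eucl d, ℂ)) :
    Continuous (conv f ψ) := by
  have : conv f ψ = fun x => convZero f (ψ.compSubConstCLM ℂ (-x)) := by
    ext x; exact conv_eq_convZero f ψ x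
  rw [this]
  exact (convZero f).continuous.comp ((continuous_compSubConst ψ).comp continuous_neg)

theorem exists_norm_conv_le {d : ℕ} (f : 𝓢'(Eucl d, ℂ)) (ψ : 𝓢(Eucl d, ℂ)) :
    ∃ (C : ℝ) (K : ℕ), 0 ≤ C ∧ ∀ x, ‖conv f ψ x‖ ≤ C * (1 + ‖x‖) ^ K := by
  obtain ⟨C, K, hC0, hC⟩ := exists_norm_apply_compSubConst_le (convZero f) ψ
  refine ⟨C, K, hC0, fun x => ?_⟩
  rw [conv_eq_convZero]
  simpa using hC (-x)

theorem conv_sconv {d : ℕ} (f : 𝓢'(Eucl d, ℂ)) (κ ψ : 𝓢(Eucl d, ℂ)) (x : Eucl d) :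
    conv f (sconv κ ψ) x = ∫ y, κ y * conv f ψ (x - y) := by
  rw [conv_eq_convZero]
  have := apply_sconv ((convZero f) ∘L SchwartzMap.compSubConstCLM ℂ (-x)) κ ψ
  rw [ContinuousLinearMap.comp_apply] at this
  rw [this]
  congr 1
  ext y
  rw [conv_eq_convZero, ContinuousLinearMap.comp_apply, SchwartzMap.compSubConstCLM_comp]
  congr 4
  abel

theorem enorm_conv_sconv_le {d : ℕ} (f : 𝓢'(Eucl d, ℂ)) (κ ψ : 𝓢(Eucl d, ℂ)) (x : Eucl d) :
    ‖conv f (sconv κ ψ) x‖ₑ ≤ ∫⁻ y, ‖κ y‖ₑ * ‖conv f ψ (x - y)‖ₑ := by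
  rw [conv_sconv]
  refine (enorm_integral_le_lintegral_enorm _).trans_eq ?_
  simp only [enorm_mul]

theorem conv_finset_sum {d : ℕ} {ι : Type*} (f : 𝓢'(Eucl d, ℂ)) (s : Finset ι)
    (ψ : ι → 𝓢(Eucl d, ℂ)) (x : Eucl d) :
    conv f (∑ i ∈ s, ψ i) x = ∑ i ∈ s, conv f (ψ i) x := by
  simp only [conv_eq_convZero, map_sum]

theorem measurable_enorm_conv {d : ℕ} (f : 𝓢'(Eucl d, ℂ)) (ψ : 𝓢(Eucl d, ℂ)) :
    Measurable fun x => ‖conv f ψ x‖ₑ :=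
  (continuous_conv f ψ).enorm.measurable

/-- The distribution `f` in the coordinates given by `M`. -/
def pullback {d : ℕ} (M : GL (Fin d) ℝ) (f : 𝓢'(Eucl d, ℂ)) : 𝓢'(Eucl d, ℂ) :=
  PointwiseConvergenceCLM.precomp ℂ
    (|(M : Matrix (Fin d) (Fin d) ℝ).det|⁻¹ •
      (SchwartzMap.compCLMOfContinuousLinearEquiv ℂ (matEquiv M⁻¹) :
        𝓢(Eucl d, ℂ) →L[ℂ] 𝓢(Eucl d, ℂ))) f

theorem pullback_apply {d : ℕ} (M : GL (Fin d) ℝ) (f : 𝓢'(Eucl d, ℂ)) (η : 𝓢(Eucl d, ℂ)) :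
    pullback M f η = f (dilate M η) := rfl

/-- The anisotropy is moved from the test function to the distribution. Estimates for a fixed
generator become uniform over all dilations as soon as their constants do not depend on the
distribution. -/
theorem conv_dilate {d : ℕ} (M : GL (Fin d) ℝ) (f : 𝓢'(Eucl d, ℂ)) (ψ : 𝓢(Eucl d, ℂ))
    (x : Eucl d) : conv f (dilate M ψ) x = conv (pullback M f) ψ (matEquiv M⁻¹ x) := by
  change f _ = f (dilate M _)
  congr 1
  ext y
  rw [conv_kernel_apply, dilate_apply, dilate_apply, conv_kernel_apply, map_sub]

/-! ### Peetre maximal functions and the Plancherel–Polya–Peetre inequality. -/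

section Peetre

/-- The weight `1 + ‖x‖`. -/
def jap {E : Type*} [NormedAddCommGroup E] (x : E) : ℝ≥0∞ := ENNReal.ofReal (1 + ‖x‖)

variable {E : Type*} [NormedAddCommGroup E]

theorem one_le_jap (x : E) : 1 ≤ jap x := by
  rw [jap, ENNReal.one_le_ofReal]; linarith [norm_nonneg x]

theorem jap_ne_zero (x : E) : jap x ≠ 0 := (zero_lt_one.trans_le (one_le_jap x)).ne'

theorem jap_ne_top (x : E) : jap x ≠ ⊤ := ENNReal.ofReal_ne_top

theorem jap_add_le (x y : E) : jap (x + y) ≤ jap x * jap y := by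
  rw [jap, jap, jap, ← ENNReal.ofReal_mul (by positivity)]
  refine ENNReal.ofReal_le_ofReal ?_
  nlinarith [norm_nonneg x, norm_nonneg y, norm_add_le x y]

theorem jap_neg (x : E) : jap (-x) = jap x := by simp [jap]

theorem jap_rpow_neg_mul (x : E) (L : ℝ) : jap x ^ (-L) * jap x ^ L = 1 := by
  rw [← ENNReal.rpow_add _ _ (jap_ne_zero x) (jap_ne_top x)]; simp

theorem jap_rpow_ne_top (x : E) (L : ℝ) : jap x ^ L ≠ ⊤ :=
  ENNReal.rpow_ne_top_of_ne_zero (jap_ne_zero x) (jap_ne_top x)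

theorem jap_add_rpow_le (x y : E) {L : ℝ} (hL : 0 ≤ L) :
    jap (x + y) ^ L ≤ jap x ^ L * jap y ^ L := by
  rw [← ENNReal.mul_rpow_of_nonneg _ _ hL]
  exact ENNReal.rpow_le_rpow (jap_add_le x y) hL

theorem jap_rpow_neg_mul_le (x y : E) {L : ℝ} (hL : 0 ≤ L) :
    jap x ^ (-L) * jap y ^ (-L) ≤ jap (x + y) ^ (-L) := by
  rw [ENNReal.rpow_neg, ENNReal.rpow_neg, ENNReal.rpow_neg, ← ENNReal.mul_inv]
  · exact ENNReal.inv_le_inv.2 (jap_add_rpow_le x y hL)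
  · exact Or.inr (jap_rpow_ne_top y L)
  · exact Or.inl (jap_rpow_ne_top x L)

theorem jap_sub_rpow_neg_le (x y : E) {L : ℝ} (hL : 0 ≤ L) :
    jap (x - y) ^ (-L) ≤ jap y ^ L * jap x ^ (-L) := by
  have h := jap_rpow_neg_mul_le (x - y) y hL
  rw [sub_add_cancel] at h
  calc jap (x - y) ^ (-L) = jap (x - y) ^ (-L) * (jap y ^ (-L) * jap y ^ L) := by
        rw [jap_rpow_neg_mul, mul_one]
    _ = (jap (x - y) ^ (-L) * jap y ^ (-L)) * jap y ^ L := by ring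
    _ ≤ jap x ^ (-L) * jap y ^ L := by gcongr
    _ = _ := mul_comm _ _

theorem measurable_jap [MeasurableSpace E] [BorelSpace E] : Measurable (jap : E → ℝ≥0∞) := by
  unfold jap; fun_prop

variable {d : ℕ}

/-- The Peetre maximal function. -/
def peetre (L : ℝ) (g : Eucl d → ℂ) (x : Eucl d) : ℝ≥0∞ := ⨆ y, ‖g (x - y)‖ₑ * jap y ^ (-L)

theorem enorm_le_peetre (L : ℝ) (g : Eucl d → ℂ) (x y : Eucl d) :
    ‖g (x - y)‖ₑ ≤ peetre L g x * jap y ^ L := by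
  calc ‖g (x - y)‖ₑ = ‖g (x - y)‖ₑ * jap y ^ (-L) * jap y ^ L := by
        rw [mul_assoc, jap_rpow_neg_mul, mul_one]
    _ ≤ _ := by
        gcongr
        exact le_iSup (fun y => ‖g (x - y)‖ₑ * jap y ^ (-L)) y

theorem enorm_le_peetre_self (L : ℝ) (g : Eucl d → ℂ) (x : Eucl d) :
    ‖g x‖ₑ ≤ peetre L g x := by
  have := enorm_le_peetre L g x 0
  simpa [jap] using this

/-- The weighted `L¹` norm of a kernel. -/
def kernelNorm (L : ℝ) (κ : 𝓢(Eucl d, ℂ)) : ℝ≥0∞ := ∫⁻ y, ‖κ y‖ₑ * jap y ^ L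

theorem kernelNorm_ne_top (L : ℝ) (κ : 𝓢(Eucl d, ℂ)) : kernelNorm L κ ≠ ⊤ := by
  obtain ⟨K, hK⟩ := exists_nat_ge L
  have h := integrable_one_add_norm_pow_mul κ K
  refine ne_top_of_le_ne_top h.lintegral_lt_top.ne (lintegral_mono fun y => ?_)
  rw [ENNReal.ofReal_mul (by positivity), ofReal_norm, mul_comm, ENNReal.ofReal_pow (by positivity)]
  gcongr
  rw [← ENNReal.rpow_natCast]
  exact ENNReal.rpow_le_rpow_of_exponent_le (one_le_jap y) hK

/-- The weight is submultiplicative, so its growth in the convolution variable is absorbed by the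
kernel. Of the reconstruction kernels only this weighted `L¹` norm will matter. -/
theorem peetre_conv_sconv_le {L : ℝ} (hL : 0 ≤ L) (f : 𝓢'(Eucl d, ℂ)) (κ ψ : 𝓢(Eucl d, ℂ))
    (x : Eucl d) :
    peetre L (conv f (sconv κ ψ)) x ≤ kernelNorm L κ * peetre L (conv f ψ) x := by
  refine iSup_le fun y => ?_
  calc ‖conv f (sconv κ ψ) (x - y)‖ₑ * jap y ^ (-L)
      ≤ (∫⁻ z, ‖κ z‖ₑ * ‖conv f ψ (x - y - z)‖ₑ) * jap y ^ (-L) := by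
        gcongr; exact enorm_conv_sconv_le f κ ψ (x - y)
    _ ≤ (∫⁻ z, (‖κ z‖ₑ * jap z ^ L) * (peetre L (conv f ψ) x * jap y ^ L)) * jap y ^ (-L) := by
        refine mul_le_mul_left (lintegral_mono fun z => ?_) _
        have h1 := enorm_le_peetre L (conv f ψ) x (y + z)
        rw [← sub_sub] at h1
        calc ‖κ z‖ₑ * ‖conv f ψ (x - y - z)‖ₑ
            ≤ ‖κ z‖ₑ * (peetre L (conv f ψ) x * (jap y ^ L * jap z ^ L)) := by
              gcongr
              exact h1.trans (by gcongr; exact jap_add_rpow_le y z hL)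
          _ = _ := by ring
    _ = kernelNorm L κ * (peetre L (conv f ψ) x * jap y ^ L) * jap y ^ (-L) := by
        have hm : Measurable fun z => ‖κ z‖ₑ * jap z ^ L :=
          κ.continuous.enorm.measurable.mul (measurable_jap.pow_const L)
        rw [lintegral_mul_const _ hm]
        rfl
    _ = kernelNorm L κ * peetre L (conv f ψ) x * (jap y ^ (-L) * jap y ^ L) := by ring
    _ = _ := by rw [jap_rpow_neg_mul, mul_one]

theorem exists_enorm_schwartz_le (θ : 𝓢(Eucl d, ℂ)) (L : ℝ) :
    ∃ C : ℝ≥0, ∀ u, ‖θ u‖ₑ ≤ C * jap u ^ (-L) := by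
  obtain ⟨K, hK⟩ := exists_nat_ge L
  refine ⟨(2 ^ K * (Finset.Iic (K, 0)).sup (fun m => SchwartzMap.seminorm ℂ m.1 m.2) θ).toNNReal,
    fun u => ?_⟩
  have h := SchwartzMap.one_add_le_sup_seminorm_apply (𝕜 := ℂ) (m := (K, 0)) le_rfl le_rfl θ u
  rw [norm_iteratedFDeriv_zero] at h
  have h2 : jap u ^ L * ‖θ u‖ₑ ≤ ENNReal.ofReal
      (2 ^ K * (Finset.Iic (K, 0)).sup (fun m => SchwartzMap.seminorm ℂ m.1 m.2) θ) := by
    refine le_trans ?_ (ENNReal.ofReal_le_ofReal h)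
    rw [ENNReal.ofReal_mul (by positivity), ofReal_norm, ENNReal.ofReal_pow (by positivity)]
    gcongr
    rw [← ENNReal.rpow_natCast]
    exact ENNReal.rpow_le_rpow_of_exponent_le (one_le_jap u) hK
  calc ‖θ u‖ₑ = (jap u ^ L * ‖θ u‖ₑ) * jap u ^ (-L) := by
        rw [mul_right_comm, mul_comm (jap u ^ L), jap_rpow_neg_mul, one_mul]
    _ ≤ _ := by gcongr; exact h2

/-- The weighted `r`-th power mean dominating the Peetre maximal function. -/
def peetreMean (L r : ℝ) (g : Eucl d → ℂ) (x : Eucl d) : ℝ≥0∞ :=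
  ∫⁻ z, ‖g z‖ₑ ^ r * jap (x - z) ^ (-(L * r))

/-- In the reproducing formula `g = θ * g` the power `|g|^r` is kept and `|g|^(1-r)` is bounded by
the maximal function. The weights combine to the exponent `-L + L(1-r) = -Lr`. -/
theorem peetre_le_rpow_mul_mean {L r : ℝ} (hL : 0 ≤ L) (hr : 0 < r) (hr1 : r ≤ 1)
    (f : 𝓢'(Eucl d, ℂ)) {θ ψ : 𝓢(Eucl d, ℂ)} (hθ : sconv θ ψ = ψ) {C : ℝ≥0}
    (hC : ∀ u, ‖θ u‖ₑ ≤ C * jap u ^ (-L)) (x : Eucl d) :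
    peetre L (conv f ψ) x ≤ C * peetre L (conv f ψ) x ^ (1 - r) * peetreMean L r (conv f ψ) x := by
  set g := conv f ψ with hg
  set P := peetre L g x with hP
  have hsub : ∀ y, peetreMean L r g x
      = ∫⁻ w, ‖g (x - y - w)‖ₑ ^ r * jap (y + w) ^ (-(L * r)) := by
    intro y
    have := lintegral_sub_left_eq_self (μ := (volume : Measure (Eucl d)))
      (fun z => ‖g z‖ₑ ^ r * jap (x - z) ^ (-(L * r))) (x - y)
    rw [peetreMean, ← this]
    congr 1; ext w
    congr 3; abel
  refine iSup_le fun y => ?_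
  have h0 : ‖g (x - y)‖ₑ ≤ ∫⁻ w, ‖θ w‖ₑ * ‖g (x - y - w)‖ₑ := by
    have := enorm_conv_sconv_le f θ ψ (x - y)
    rwa [hθ] at this
  calc ‖g (x - y)‖ₑ * jap y ^ (-L)
      ≤ (∫⁻ w, ‖θ w‖ₑ * ‖g (x - y - w)‖ₑ) * jap y ^ (-L) := by gcongr
    _ = ∫⁻ w, ‖θ w‖ₑ * ‖g (x - y - w)‖ₑ * jap y ^ (-L) := by
        rw [lintegral_mul_const']
        exact jap_rpow_ne_top y _
    _ ≤ ∫⁻ w, (C * P ^ (1 - r)) * (‖g (x - y - w)‖ₑ ^ r * jap (y + w) ^ (-(L * r))) := by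
        refine lintegral_mono fun w => ?_
        have h1 : ‖g (x - y - w)‖ₑ ≤ P * jap (y + w) ^ L := by
          rw [sub_sub]; exact enorm_le_peetre L g x (y + w)
        have h2 : ‖g (x - y - w)‖ₑ = ‖g (x - y - w)‖ₑ ^ r * ‖g (x - y - w)‖ₑ ^ (1 - r) := by
          rw [← ENNReal.rpow_add_of_nonneg _ _ hr.le (by linarith)]; simp
        have h3 : jap w ^ (-L) * jap y ^ (-L) ≤ jap (y + w) ^ (-L) := by
          rw [mul_comm]; exact jap_rpow_neg_mul_le y w hL
        calc ‖θ w‖ₑ * ‖g (x - y - w)‖ₑ * jap y ^ (-L)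
            ≤ (C * jap w ^ (-L)) * (‖g (x - y - w)‖ₑ ^ r * (P * jap (y + w) ^ L) ^ (1 - r))
                * jap y ^ (-L) := by
              have h4 : 0 ≤ 1 - r := by linarith
              have h5 : ‖g (x - y - w)‖ₑ ≤ ‖g (x - y - w)‖ₑ ^ r * (P * jap (y + w) ^ L) ^ (1 - r) :=
                h2.le.trans (by gcongr)
              gcongr
              exact hC w
          _ = C * P ^ (1 - r) * (‖g (x - y - w)‖ₑ ^ r * ((jap w ^ (-L) * jap y ^ (-L)) *
                jap (y + w) ^ (L * (1 - r)))) := by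
              rw [ENNReal.mul_rpow_of_nonneg _ _ (by linarith : 0 ≤ 1 - r), ← ENNReal.rpow_mul]
              ring
          _ ≤ C * P ^ (1 - r) * (‖g (x - y - w)‖ₑ ^ r * (jap (y + w) ^ (-L) *
                jap (y + w) ^ (L * (1 - r)))) := by gcongr
          _ = _ := by
              rw [← ENNReal.rpow_add _ _ (jap_ne_zero _) (jap_ne_top _)]
              congr 4; ring
    _ = C * P ^ (1 - r) * peetreMean L r g x := by
        rw [hsub y, lintegral_const_mul]
        refine Measurable.mul ?_ ?_
        · exact ((measurable_enorm_conv f ψ).comp (measurable_const.sub measurable_id)).pow_const r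
        · exact (measurable_jap.comp (measurable_const.add measurable_id)).pow_const _

/-- Division by `P^(1-r)`; for `P = ∞` this would be illegitimate, which is why finiteness must be
established separately at each use. -/
theorem rpow_le_of_le_rpow_mul {P B : ℝ≥0∞} {r : ℝ} (hr : 0 < r) (hP : P ≠ ⊤)
    (h : P ≤ P ^ (1 - r) * B) : P ^ r ≤ B := by
  rcases eq_or_ne P 0 with h0 | h0
  · rw [h0, ENNReal.zero_rpow_of_pos hr]; exact zero_le
  have h1 : P ^ (1 - r) ≠ 0 := by simp [ENNReal.rpow_eq_zero_iff, h0, hP]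
  have h2 : P ^ (1 - r) ≠ ⊤ := ENNReal.rpow_ne_top_of_ne_zero h0 hP
  have h3 : P = P ^ (1 - r) * P ^ r := by
    rw [← ENNReal.rpow_add _ _ h0 hP]; simp
  rw [h3] at h
  have h4 : P ^ (1 - r) * P ^ r ≤ P ^ (1 - r) * B := by
    conv_rhs => rw [h3]
    rw [← h3] at h ⊢
    exact h
  exact (ENNReal.mul_le_mul_iff_right h1 h2).1 h4

theorem peetreMean_sub_le {L r : ℝ} (hL : 0 ≤ L) (hr : 0 < r) (g : Eucl d → ℂ) (x y : Eucl d) :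
    peetreMean L r g (x - y) ≤ jap y ^ (L * r) * peetreMean L r g x := by
  rw [peetreMean, peetreMean, ← lintegral_const_mul' _ _ (jap_rpow_ne_top y _)]
  refine lintegral_mono fun z => ?_
  have h := jap_sub_rpow_neg_le (x - z) y (mul_nonneg hL hr.le)
  rw [show x - z - y = x - y - z by abel] at h
  calc _ ≤ ‖g z‖ₑ ^ r * (jap y ^ (L * r) * jap (x - z) ^ (-(L * r))) := by gcongr
    _ = _ := by ring

/-- The Plancherel–Polya–Peetre inequality for band-limited convolutions, with a constant that does
not depend on the distribution. -/
theorem exists_peetre_rpow_le {L r : ℝ} (hL : 0 ≤ L) (hr : 0 < r) (hr1 : r ≤ 1)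
    {θ ψ : 𝓢(Eucl d, ℂ)} (hθ : sconv θ ψ = ψ) :
    ∃ C : ℝ≥0, ∀ (f : 𝓢'(Eucl d, ℂ)) (x : Eucl d),
      peetre L (conv f ψ) x ^ r ≤ C * peetreMean L r (conv f ψ) x := by
  obtain ⟨C, hC⟩ := exists_enorm_schwartz_le θ L
  refine ⟨C + 1, fun f x => ?_⟩
  set g := conv f ψ with hg
  rcases eq_or_ne (peetreMean L r g x) ⊤ with htop | htop
  · rw [htop, ENNReal.mul_top (by simp)]; exact le_top
  -- Finiteness is bootstrapped. Since `f` has some polynomial order `K`, the maximal function of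
  -- exponent `L' = max L K` is finite, and dividing there gives `|g|^r ≤ C'` times the mean of
  -- exponent `L'`, hence of exponent `L`. If that mean is finite, so is the maximal function of
  -- exponent `L`. The constants depending on `f` are used only for this.
  suffices hfin : peetre L g x ≠ ⊤ by
    refine rpow_le_of_le_rpow_mul hr hfin ?_
    refine (peetre_le_rpow_mul_mean hL hr hr1 f hθ hC x).trans ?_
    calc _ = peetre L g x ^ (1 - r) * (C * peetreMean L r g x) := by ring
      _ ≤ _ := by gcongr; simp
  obtain ⟨A, K, hA0, hA⟩ := exists_norm_conv_le f ψ
  set L' := max L K with hL'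
  have hL'0 : 0 ≤ L' := hL.trans (le_max_left _ _)
  obtain ⟨C', hC'⟩ := exists_enorm_schwartz_le θ L'
  have hfin' : ∀ x, peetre L' g x ≠ ⊤ := by
    intro x
    refine ne_top_of_le_ne_top (b := ENNReal.ofReal A * jap x ^ (K : ℝ))
      (ENNReal.mul_ne_top ENNReal.ofReal_ne_top (jap_rpow_ne_top x _)) (iSup_le fun y => ?_)
    have h1 : ‖g (x - y)‖ₑ ≤ ENNReal.ofReal A * jap (x - y) ^ (K : ℝ) := by
      rw [← ofReal_norm, ENNReal.rpow_natCast, jap, ← ENNReal.ofReal_pow (by positivity),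
        ← ENNReal.ofReal_mul hA0]
      exact ENNReal.ofReal_le_ofReal (hA _)
    have h2 : jap (x - y) ^ (K : ℝ) ≤ jap x ^ (K : ℝ) * jap y ^ (K : ℝ) := by
      have := jap_add_rpow_le x (-y) (Nat.cast_nonneg (α := ℝ) K)
      rwa [jap_neg, ← sub_eq_add_neg] at this
    calc ‖g (x - y)‖ₑ * jap y ^ (-L')
        ≤ (ENNReal.ofReal A * (jap x ^ (K : ℝ) * jap y ^ (K : ℝ))) * jap y ^ (-(K : ℝ)) := by
          gcongr
          · exact h1.trans (by gcongr)
          · exact one_le_jap y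
          · exact le_max_right _ _
      _ = ENNReal.ofReal A * jap x ^ (K : ℝ) * (jap y ^ (-(K : ℝ)) * jap y ^ (K : ℝ)) := by ring
      _ = _ := by rw [jap_rpow_neg_mul, mul_one]
  have hpt : ∀ x, ‖g x‖ₑ ^ r ≤ C' * peetreMean L r g x := by
    intro x
    calc ‖g x‖ₑ ^ r ≤ peetre L' g x ^ r := by gcongr; exact enorm_le_peetre_self L' g x
      _ ≤ C' * peetreMean L' r g x := by
          refine rpow_le_of_le_rpow_mul hr (hfin' x) ?_
          refine (peetre_le_rpow_mul_mean hL'0 hr hr1 f hθ hC' x).trans_eq ?_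
          ring
      _ ≤ C' * peetreMean L r g x := by
          gcongr
          refine lintegral_mono fun z => ?_
          gcongr
          · exact one_le_jap _
          · exact le_max_left _ _
  have hb : peetre L g x ≤ (C' * peetreMean L r g x) ^ (1 / r) := by
    refine iSup_le fun y => ?_
    rw [one_div, ENNReal.le_rpow_inv_iff hr, ENNReal.mul_rpow_of_nonneg _ _ hr.le, ← ENNReal.rpow_mul]
    calc ‖g (x - y)‖ₑ ^ r * jap y ^ (-L * r)
        ≤ C' * (jap y ^ (L * r) * peetreMean L r g x) * jap y ^ (-(L * r)) := by
          rw [neg_mul]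
          gcongr
          exact (hpt _).trans (by gcongr; exact peetreMean_sub_le hL hr g x y)
      _ = C' * peetreMean L r g x * (jap y ^ (-(L * r)) * jap y ^ (L * r)) := by ring
      _ = _ := by rw [jap_rpow_neg_mul, mul_one]
  refine ne_top_of_le_ne_top ?_ hb
  exact ENNReal.rpow_ne_top_of_nonneg (by positivity) (ENNReal.mul_ne_top ENNReal.coe_ne_top htop)

end Peetre

/-! ### Geometry of slabs: averages and overlaps. -/

section Maximal

theorem jap_mono {E F : Type*} [NormedAddCommGroup E] [NormedAddCommGroup F] {x : E} {y : F}
    (h : ‖x‖ ≤ ‖y‖) : jap x ≤ jap y := ENNReal.ofReal_le_ofReal (by linarith)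

theorem lintegral_jap_ne_top {E : Type*} [NormedAddCommGroup E] [NormedSpace ℝ E]
    [FiniteDimensional ℝ E] [MeasureSpace E] [BorelSpace E]
    [(volume : Measure E).IsAddHaarMeasure] {R : ℝ} (hR : (Module.finrank ℝ E : ℝ) < R) :
    ∫⁻ x : E, jap x ^ (-R) ≠ ⊤ := by
  have h := finite_integral_one_add_norm (μ := (volume : Measure E)) hR
  refine ne_top_of_le_ne_top h.ne (lintegral_mono fun x => ?_)
  rw [jap, ENNReal.ofReal_rpow_of_pos (by positivity)]

theorem lintegral_comp_sub_left_jap {E : Type*} [NormedAddCommGroup E] [NormedSpace ℝ E]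
    [FiniteDimensional ℝ E] [MeasureSpace E] [BorelSpace E]
    [(volume : Measure E).IsAddHaarMeasure] (R : ℝ) (c : E) :
    ∫⁻ x : E, jap (c - x) ^ (-R) = ∫⁻ x : E, jap x ^ (-R) :=
  lintegral_sub_left_eq_self (fun x : E => jap x ^ (-R)) c

/-- The summand `1` is handled by the trivial bound of the integrand, the summand `μ` by the
substitution `x = tμ`. -/
theorem exists_mul_lintegral_jap_le : ∃ C : ℝ≥0, ∀ c μ : ℝ, 0 ≤ μ →
    ENNReal.ofReal (1 + μ) * ∫⁻ t in Set.Icc (0 : ℝ) 1, jap (c + t * μ) ^ (-(2 : ℝ)) ≤ C := by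
  have hfin : ∫⁻ x : ℝ, jap x ^ (-(2 : ℝ)) ≠ ⊤ := lintegral_jap_ne_top (by simp)
  refine ⟨1 + (∫⁻ x : ℝ, jap x ^ (-(2 : ℝ))).toNNReal, fun c μ hμ => ?_⟩
  rw [ENNReal.ofReal_add zero_le_one hμ, add_mul, ENNReal.ofReal_one, one_mul, ENNReal.coe_add,
    ENNReal.coe_toNNReal hfin]
  refine add_le_add ?_ ?_
  · calc ∫⁻ t in Set.Icc (0 : ℝ) 1, jap (c + t * μ) ^ (-(2 : ℝ))
        ≤ ∫⁻ t in Set.Icc (0 : ℝ) 1, 1 := by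
          refine lintegral_mono fun t => ?_
          exact ENNReal.rpow_le_one_of_one_le_of_neg (one_le_jap _) (by norm_num)
      _ = _ := by simp
  · rcases hμ.eq_or_lt with h0 | h0
    · simp [← h0]
    · have hm : Measurable fun x : ℝ => jap (c + x) ^ (-(2 : ℝ)) :=
        (measurable_jap.comp (measurable_const.add measurable_id)).pow_const _
      have h1 : ∫⁻ t : ℝ, jap (c + t * μ) ^ (-(2 : ℝ))
          = ENNReal.ofReal μ⁻¹ * ∫⁻ x : ℝ, jap (c + x) ^ (-(2 : ℝ)) := by
        have := lintegral_map hm (measurable_mul_const μ) (μ := volume)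
        rw [← this, Real.map_volume_mul_right h0.ne', lintegral_smul_measure,
          abs_of_pos (inv_pos.2 h0), smul_eq_mul]
      calc ENNReal.ofReal μ * ∫⁻ t in Set.Icc (0 : ℝ) 1, jap (c + t * μ) ^ (-(2 : ℝ))
          ≤ ENNReal.ofReal μ * ∫⁻ t : ℝ, jap (c + t * μ) ^ (-(2 : ℝ)) := by
            gcongr; exact Measure.restrict_le_self
        _ = ∫⁻ x : ℝ, jap (c + x) ^ (-(2 : ℝ)) := by
            rw [h1, ← mul_assoc, ← ENNReal.ofReal_mul h0.le, mul_inv_cancel₀ h0.ne',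
              ENNReal.ofReal_one, one_mul]
        _ = ∫⁻ x : ℝ, jap x ^ (-(2 : ℝ)) :=
            lintegral_add_left_eq_self (fun x : ℝ => jap x ^ (-(2 : ℝ))) c
        _ ≤ _ := le_rfl

variable {ι : Type*} [Fintype ι]

/-- The `ℓ¹` size of a slope. -/
def slopeSize (m : ι → ℝ) : ℝ := ∑ k, |m k|

theorem slopeSize_nonneg (m : ι → ℝ) : 0 ≤ slopeSize m := Finset.sum_nonneg fun _ _ => abs_nonneg _

/-- Averages over slabs of slope `m` are `O(1 / (1 + |m|))`. -/
theorem exists_slab_le {R : ℝ} (hR : (Fintype.card ι : ℝ) < R) :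
    ∃ C : ℝ≥0, ∀ (c : ℝ) (m : ι → ℝ), ENNReal.ofReal (1 + slopeSize m) *
      ∫⁻ u : ι → ℝ, jap (c + m ⬝ᵥ u) ^ (-(2 : ℝ)) * jap u ^ (-R) ≤ C := by
  obtain ⟨C₀, hC₀⟩ := exists_mul_lintegral_jap_le
  have hR0 : 0 ≤ R := (Nat.cast_nonneg _).trans hR.le
  have hB : ∫⁻ u : ι → ℝ, jap u ^ (-R) ≠ ⊤ := lintegral_jap_ne_top (by simpa using hR)
  set B := ∫⁻ u : ι → ℝ, jap u ^ (-R) with hBdef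
  have hfin : (2 : ℝ≥0∞) ^ R * (C₀ * B) ≠ ⊤ :=
    ENNReal.mul_ne_top (ENNReal.rpow_ne_top_of_nonneg hR0 (by simp))
      (ENNReal.mul_ne_top ENNReal.coe_ne_top hB)
  refine ⟨((2 : ℝ≥0∞) ^ R * (C₀ * B)).toNNReal, fun c m => ?_⟩
  rw [ENNReal.coe_toNNReal hfin]
  set μ := slopeSize m with hμ
  have hμ0 : 0 ≤ μ := slopeSize_nonneg m
  -- Along `e` the form `m ⬝ᵥ u` grows at the full rate `μ`. Averaging over the shifts `u + t e`, `0
  -- ≤ t ≤ 1`, changes the weight in `u` by at most `2^R` and leaves a one-dimensional integral in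
  -- `t` of size `1 / (1 + μ)`.
  set e : ι → ℝ := fun k => SignType.sign (m k) with he
  have hme : m ⬝ᵥ e = μ := by
    simp only [dotProduct, he, hμ, slopeSize]
    exact Finset.sum_congr rfl fun k _ => self_mul_sign (m k)
  have hen : ‖e‖ ≤ 1 := by
    refine (pi_norm_le_iff_of_nonneg zero_le_one).2 fun k => ?_
    rcases lt_trichotomy (m k) 0 with h | h | h <;> simp [he, h]
  have hmeas : Measurable fun p : ℝ × (ι → ℝ) =>
      jap (c + m ⬝ᵥ p.2 + p.1 * μ) ^ (-(2 : ℝ)) * jap p.2 ^ (-R) := by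
    refine Measurable.mul ?_ ((measurable_jap.comp measurable_snd).pow_const _)
    refine (measurable_jap.comp ?_).pow_const _
    have : Continuous fun p : ℝ × (ι → ℝ) => c + m ⬝ᵥ p.2 + p.1 * μ := by
      simp only [dotProduct]; fun_prop
    exact this.measurable
  set I := ∫⁻ u : ι → ℝ, jap (c + m ⬝ᵥ u) ^ (-(2 : ℝ)) * jap u ^ (-R) with hI
  have hshift : ∀ t ∈ Set.Icc (0 : ℝ) 1, I ≤ (2 : ℝ≥0∞) ^ R *
      ∫⁻ u : ι → ℝ, jap (c + m ⬝ᵥ u + t * μ) ^ (-(2 : ℝ)) * jap u ^ (-R) := by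
    intro t ht
    have h2R : (2 : ℝ≥0∞) ^ R ≠ ⊤ := ENNReal.rpow_ne_top_of_nonneg hR0 (by simp)
    rw [hI, ← lintegral_add_right_eq_self _ (t • e), ← lintegral_const_mul' _ _ h2R]
    refine lintegral_mono fun u => ?_
    have h1 : m ⬝ᵥ (u + t • e) = m ⬝ᵥ u + t * μ := by
      rw [dotProduct_add, dotProduct_smul, hme, smul_eq_mul]
    have h2 : jap (u + t • e) ^ (-R) ≤ 2 ^ R * jap u ^ (-R) := by
      have h := jap_sub_rpow_neg_le u (-(t • e)) hR0
      rw [sub_neg_eq_add, jap_neg] at h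
      refine h.trans ?_
      gcongr
      rw [jap, show (2 : ℝ≥0∞) = ENNReal.ofReal 2 by simp]
      refine ENNReal.ofReal_le_ofReal ?_
      have : ‖t • e‖ ≤ 1 := by
        rw [norm_smul, Real.norm_of_nonneg ht.1]
        nlinarith [ht.1, ht.2, norm_nonneg e]
      linarith
    rw [h1, ← add_assoc]
    calc _ ≤ jap (c + m ⬝ᵥ u + t * μ) ^ (-(2 : ℝ)) * (2 ^ R * jap u ^ (-R)) := by gcongr
      _ = _ := by ring
  have hIle : I ≤ (2 : ℝ≥0∞) ^ R * ∫⁻ t in Set.Icc (0 : ℝ) 1,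
      ∫⁻ u : ι → ℝ, jap (c + m ⬝ᵥ u + t * μ) ^ (-(2 : ℝ)) * jap u ^ (-R) := by
    have h2R : (2 : ℝ≥0∞) ^ R ≠ ⊤ := ENNReal.rpow_ne_top_of_nonneg hR0 (by simp)
    rw [← lintegral_const_mul' _ _ h2R]
    calc I = ∫⁻ t in Set.Icc (0 : ℝ) 1, I := by simp
      _ ≤ _ := setLIntegral_mono' measurableSet_Icc hshift
  rw [lintegral_lintegral_swap hmeas.aemeasurable] at hIle
  calc ENNReal.ofReal (1 + μ) * I
      ≤ ENNReal.ofReal (1 + μ) * ((2 : ℝ≥0∞) ^ R * ∫⁻ u : ι → ℝ, ∫⁻ t in Set.Icc (0 : ℝ) 1,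
          jap (c + m ⬝ᵥ u + t * μ) ^ (-(2 : ℝ)) * jap u ^ (-R)) := by gcongr
    _ = (2 : ℝ≥0∞) ^ R * ∫⁻ u : ι → ℝ, (ENNReal.ofReal (1 + μ) * ∫⁻ t in Set.Icc (0 : ℝ) 1,
          jap (c + m ⬝ᵥ u + t * μ) ^ (-(2 : ℝ))) * jap u ^ (-R) := by
        rw [mul_left_comm, ← lintegral_const_mul' _ _ ENNReal.ofReal_ne_top]
        congr 2; ext u
        rw [lintegral_mul_const' _ _ (jap_rpow_ne_top u _), mul_assoc]
    _ ≤ (2 : ℝ≥0∞) ^ R * ∫⁻ u : ι → ℝ, C₀ * jap u ^ (-R) := by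
        gcongr with u
        exact hC₀ (c + m ⬝ᵥ u) μ hμ0
    _ = _ := by rw [lintegral_const_mul' _ _ ENNReal.coe_ne_top]

theorem abs_dotProduct_le (m u : ι → ℝ) : |m ⬝ᵥ u| ≤ slopeSize m * ‖u‖ := by
  rw [dotProduct, slopeSize, Finset.sum_mul]
  refine (Finset.abs_sum_le_sum_abs _ _).trans (Finset.sum_le_sum fun k _ => ?_)
  rw [abs_mul]
  gcongr
  exact norm_le_pi_norm u k

theorem jap_le_mul_slope (δ : ℝ) (m u : ι → ℝ) :
    jap δ ≤ jap (δ + m ⬝ᵥ u) * (ENNReal.ofReal (1 + slopeSize m) * jap u) := by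
  have h1 : jap δ ≤ jap (δ + m ⬝ᵥ u) * jap (m ⬝ᵥ u) := by
    have := jap_add_le (δ + m ⬝ᵥ u) (-(m ⬝ᵥ u))
    rwa [jap_neg, add_neg_cancel_right] at this
  refine h1.trans ?_
  gcongr
  rw [jap, jap, ← ENNReal.ofReal_mul (by linarith [slopeSize_nonneg m])]
  refine ENNReal.ofReal_le_ofReal ?_
  have := abs_dotProduct_le m u
  rw [Real.norm_eq_abs]
  nlinarith [slopeSize_nonneg m, norm_nonneg u]

/-- The overlap of two slabs of slopes `l`, `l'` through points at distance `δ` on a line. -/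
theorem exists_overlap_le (ι : Type*) [Fintype ι] : ∃ C : ℝ≥0, ∀ (ε : ℝ), 0 ≤ ε → ε ≤ 1 →
    ∀ (δ : ℝ) (m : ι → ℝ),
    ∫⁻ u : ι → ℝ, jap (δ + m ⬝ᵥ u) ^ (-(4 : ℝ)) * jap u ^ (-((Fintype.card ι : ℝ) + 3))
      ≤ C * ENNReal.ofReal (1 + slopeSize m) ^ ε * jap δ ^ (-(1 + ε)) := by
  obtain ⟨C, hC⟩ := exists_slab_le (ι := ι) (R := Fintype.card ι + 1) (by linarith)
  refine ⟨C, fun ε hε hε1 δ m => ?_⟩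
  set M := ENNReal.ofReal (1 + slopeSize m) with hM
  have hM0 : M ≠ 0 := by
    rw [hM]; simp only [ne_eq, ENNReal.ofReal_eq_zero, not_le]; linarith [slopeSize_nonneg m]
  have hMt : M ≠ ⊤ := ENNReal.ofReal_ne_top
  -- The slabs are `δ` apart over `u = 0`, so being close at `u` forces `jap u` to be at least about
  -- `jap δ / M`. Raising `jap_le_mul_slope` to the power `1 + ε ≤ 2` spends at most two powers of
  -- each decaying factor. What remains is a slab integral of size `1 / M`, which reduces `M^(1+ε)`
  -- to `M^ε`.
  have hpt : ∀ u : ι → ℝ,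
      jap (δ + m ⬝ᵥ u) ^ (-(4 : ℝ)) * jap u ^ (-((Fintype.card ι : ℝ) + 3))
      ≤ (M ^ (1 + ε) * jap δ ^ (-(1 + ε))) *
        (jap (δ + m ⬝ᵥ u) ^ (-(2 : ℝ)) * jap u ^ (-((Fintype.card ι : ℝ) + 1))) := by
    intro u
    set X := jap (δ + m ⬝ᵥ u) with hX
    have hX1 : 1 ≤ X := one_le_jap _
    have h1 : jap δ ^ (1 + ε) ≤ X ^ (1 + ε) * (M ^ (1 + ε) * jap u ^ (1 + ε)) := by
      rw [← ENNReal.mul_rpow_of_nonneg _ _ (by linarith),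
        ← ENNReal.mul_rpow_of_nonneg _ _ (by linarith)]
      exact ENNReal.rpow_le_rpow (jap_le_mul_slope δ m u) (by linarith)
    have h2 : X ^ (-(4 : ℝ)) * X ^ (1 + ε) ≤ X ^ (-(2 : ℝ)) := by
      rw [hX, ← ENNReal.rpow_add _ _ (jap_ne_zero _) (jap_ne_top _)]
      exact ENNReal.rpow_le_rpow_of_exponent_le (one_le_jap _) (by linarith)
    have h3 : jap u ^ (-((Fintype.card ι : ℝ) + 3)) * jap u ^ (1 + ε)
        ≤ jap u ^ (-((Fintype.card ι : ℝ) + 1)) := by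
      rw [← ENNReal.rpow_add _ _ (jap_ne_zero _) (jap_ne_top _)]
      exact ENNReal.rpow_le_rpow_of_exponent_le (one_le_jap _) (by linarith)
    calc X ^ (-(4 : ℝ)) * jap u ^ (-((Fintype.card ι : ℝ) + 3))
        = X ^ (-(4 : ℝ)) * jap u ^ (-((Fintype.card ι : ℝ) + 3)) *
            (jap δ ^ (-(1 + ε)) * jap δ ^ (1 + ε)) := by rw [jap_rpow_neg_mul, mul_one]
      _ ≤ X ^ (-(4 : ℝ)) * jap u ^ (-((Fintype.card ι : ℝ) + 3)) *
            (jap δ ^ (-(1 + ε)) * (X ^ (1 + ε) * (M ^ (1 + ε) * jap u ^ (1 + ε)))) := by gcongr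
      _ = (M ^ (1 + ε) * jap δ ^ (-(1 + ε))) * ((X ^ (-(4 : ℝ)) * X ^ (1 + ε)) *
            (jap u ^ (-((Fintype.card ι : ℝ) + 3)) * jap u ^ (1 + ε))) := by ring
      _ ≤ _ := by gcongr
  have hc : M ^ (1 + ε) * jap δ ^ (-(1 + ε)) ≠ ⊤ :=
    ENNReal.mul_ne_top (ENNReal.rpow_ne_top_of_nonneg (by linarith) hMt) (jap_rpow_ne_top _ _)
  calc _ ≤ ∫⁻ u : ι → ℝ, (M ^ (1 + ε) * jap δ ^ (-(1 + ε))) *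
        (jap (δ + m ⬝ᵥ u) ^ (-(2 : ℝ)) * jap u ^ (-((Fintype.card ι : ℝ) + 1))) :=
        lintegral_mono hpt
    _ = M ^ ε * jap δ ^ (-(1 + ε)) * (M * ∫⁻ u : ι → ℝ,
        (jap (δ + m ⬝ᵥ u) ^ (-(2 : ℝ)) * jap u ^ (-((Fintype.card ι : ℝ) + 1)))) := by
        rw [lintegral_const_mul' _ _ hc, ENNReal.rpow_add _ _ hM0 hMt, ENNReal.rpow_one]
        ring
    _ ≤ M ^ ε * jap δ ^ (-(1 + ε)) * C := by gcongr; exact hC δ m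
    _ = _ := by ring

/-- The kernel adapted to a slab of slope `m`. -/
def slabKernel (m : ι → ℝ) (x : ℝ × (ι → ℝ)) : ℝ≥0∞ :=
  jap (x.1 + m ⬝ᵥ x.2) ^ (-(8 : ℝ)) * jap x.2 ^ (-((Fintype.card ι : ℝ) + 3))

theorem measurable_slabKernel_comp {α : Type*} [MeasurableSpace α] {m : α → ι → ℝ}
    {x : α → ℝ × (ι → ℝ)} (hm : Measurable m) (hx : Measurable x) :
    Measurable fun a => slabKernel (m a) (x a) := by
  unfold slabKernel
  refine Measurable.mul ((measurable_jap.comp ?_).pow_const _)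
    ((measurable_jap.comp hx.snd).pow_const _)
  have : Continuous fun q : (ι → ℝ) × ℝ × (ι → ℝ) => q.2.1 + q.1 ⬝ᵥ q.2.2 := by
    simp only [dotProduct]; fun_prop
  exact this.measurable.comp (hm.prodMk hx)

/-- The slab kernel with half of its decay in the transversal variables removed. -/
def slabHalf (m : ι → ℝ) (x : ℝ × (ι → ℝ)) : ℝ≥0∞ :=
  jap (x.1 + m ⬝ᵥ x.2) ^ (-(8 : ℝ)) * jap x.2 ^ (-((Fintype.card ι : ℝ) + 3) / 2)

theorem measurable_slabHalf_comp {α : Type*} [MeasurableSpace α] {m : α → ι → ℝ}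
    {x : α → ℝ × (ι → ℝ)} (hm : Measurable m) (hx : Measurable x) :
    Measurable fun a => slabHalf (m a) (x a) := by
  unfold slabHalf
  refine Measurable.mul ((measurable_jap.comp ?_).pow_const _)
    ((measurable_jap.comp hx.snd).pow_const _)
  have : Continuous fun q : (ι → ℝ) × ℝ × (ι → ℝ) => q.2.1 + q.1 ⬝ᵥ q.2.2 := by
    simp only [dotProduct]; fun_prop
  exact this.measurable.comp (hm.prodMk hx)

theorem slabKernel_eq (m : ι → ℝ) (x : ℝ × (ι → ℝ)) :
    slabKernel m x = jap x.2 ^ (-((Fintype.card ι : ℝ) + 3) / 2) * slabHalf m x := by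
  rw [slabHalf, mul_left_comm, ← ENNReal.rpow_add _ _ (jap_ne_zero _) (jap_ne_top _), add_halves]
  rfl

/-- Integration along the axis collapses the two slabs to a function of their vertical distance over
each `y'`, and the two half weights recombine to a full one. The overlap bound then applies with
relative slope `m - m'`. A positive `ε` makes the result integrable in `s - s'`. -/
theorem exists_slabHalf_pair_le (ι : Type*) [Fintype ι] : ∃ C : ℝ≥0, ∀ (ε : ℝ), 0 ≤ ε → ε ≤ 1 →
    ∀ (s s' : ℝ) (v : ι → ℝ) (m m' : ι → ℝ),
    ∫⁻ y : ℝ × (ι → ℝ), slabHalf m ((s, v) - y) * slabHalf m' ((s', v) - y)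
      ≤ C * ENNReal.ofReal (1 + slopeSize (m - m')) ^ ε * jap (s - s') ^ (-(1 + ε)) := by
  obtain ⟨C, hC⟩ := exists_overlap_le ι
  have hfin : ∫⁻ x : ℝ, jap x ^ (-(4 : ℝ)) ≠ ⊤ := lintegral_jap_ne_top (by simp)
  set B := ∫⁻ x : ℝ, jap x ^ (-(4 : ℝ)) with hB
  refine ⟨B.toNNReal * C, fun ε hε hε1 s s' v m m' => ?_⟩
  rw [ENNReal.coe_mul, ENNReal.coe_toNNReal hfin]
  have hmeas : Measurable fun y : ℝ × (ι → ℝ) =>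
      slabHalf m ((s, v) - y) * slabHalf m' ((s', v) - y) :=
    (measurable_slabHalf_comp measurable_const (measurable_const.sub measurable_id)).mul
      (measurable_slabHalf_comp measurable_const (measurable_const.sub measurable_id))
  rw [Measure.volume_eq_prod, lintegral_prod_symm' _ hmeas]
  have hinner : ∀ y' : ι → ℝ,
      ∫⁻ y₁ : ℝ, slabHalf m ((s, v) - (y₁, y')) * slabHalf m' ((s', v) - (y₁, y'))
      ≤ B * (jap ((s - s') + (m - m') ⬝ᵥ (v - y')) ^ (-(4 : ℝ)) *
          jap (v - y') ^ (-((Fintype.card ι : ℝ) + 3))) := by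
    intro y'
    set D := jap ((s - s') + (m - m') ⬝ᵥ (v - y')) ^ (-(4 : ℝ)) *
          jap (v - y') ^ (-((Fintype.card ι : ℝ) + 3)) with hD
    have hDt : D ≠ ⊤ := ENNReal.mul_ne_top (jap_rpow_ne_top _ _) (jap_rpow_ne_top _ _)
    set c := s + m ⬝ᵥ (v - y') with hc
    set c' := s' + m' ⬝ᵥ (v - y') with hc'
    have hcc : (s - s') + (m - m') ⬝ᵥ (v - y') = c - c' := by
      rw [sub_dotProduct, hc, hc']; ring
    calc _ ≤ ∫⁻ y₁ : ℝ, jap (c - y₁) ^ (-(4 : ℝ)) * D := by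
          refine lintegral_mono fun y₁ => ?_
          simp only [slabHalf, Prod.mk_sub_mk]
          rw [show s - y₁ + m ⬝ᵥ (v - y') = c - y₁ by rw [hc]; ring,
            show s' - y₁ + m' ⬝ᵥ (v - y') = c' - y₁ by rw [hc']; ring]
          have e8 : ∀ z : ℝ, jap z ^ (-(8 : ℝ)) = jap z ^ (-(4 : ℝ)) * jap z ^ (-(4 : ℝ)) := by
            intro z
            rw [← ENNReal.rpow_add _ _ (jap_ne_zero _) (jap_ne_top _)]; norm_num
          have h1 : jap (c' - y₁) ^ (-(4 : ℝ)) ≤ 1 :=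
            ENNReal.rpow_le_one_of_one_le_of_neg (one_le_jap _) (by norm_num)
          have h2 : jap (c - y₁) ^ (-(4 : ℝ)) * jap (c' - y₁) ^ (-(4 : ℝ))
              ≤ jap (c - c') ^ (-(4 : ℝ)) := by
            have := jap_rpow_neg_mul_le (c - y₁) (-(c' - y₁)) (L := 4) (by norm_num)
            rw [jap_neg] at this
            convert this using 3
            ring
          have h3 : jap (v - y') ^ (-((Fintype.card ι : ℝ) + 3) / 2) *
              jap (v - y') ^ (-((Fintype.card ι : ℝ) + 3) / 2)
              = jap (v - y') ^ (-((Fintype.card ι : ℝ) + 3)) := by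
            rw [← ENNReal.rpow_add _ _ (jap_ne_zero _) (jap_ne_top _), add_halves]
          rw [e8, e8]
          calc _ = jap (c - y₁) ^ (-(4 : ℝ)) * jap (c' - y₁) ^ (-(4 : ℝ)) *
                ((jap (c - y₁) ^ (-(4 : ℝ)) * jap (c' - y₁) ^ (-(4 : ℝ))) *
                (jap (v - y') ^ (-((Fintype.card ι : ℝ) + 3) / 2) *
                  jap (v - y') ^ (-((Fintype.card ι : ℝ) + 3) / 2))) := by ring
            _ ≤ jap (c - y₁) ^ (-(4 : ℝ)) * 1 * (jap (c - c') ^ (-(4 : ℝ)) *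
                jap (v - y') ^ (-((Fintype.card ι : ℝ) + 3))) := by
                rw [h3]; gcongr
            _ = _ := by rw [mul_one, hD, hcc]
      _ = B * D := by
          rw [lintegral_mul_const' _ _ hDt, lintegral_comp_sub_left_jap]
  calc _ ≤ ∫⁻ y' : ι → ℝ, B * (jap ((s - s') + (m - m') ⬝ᵥ (v - y')) ^ (-(4 : ℝ)) *
          jap (v - y') ^ (-((Fintype.card ι : ℝ) + 3))) := lintegral_mono hinner
    _ = B * ∫⁻ u : ι → ℝ, jap ((s - s') + (m - m') ⬝ᵥ u) ^ (-(4 : ℝ)) *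
          jap u ^ (-((Fintype.card ι : ℝ) + 3)) := by
        rw [lintegral_const_mul' _ _ hfin]
        congr 1
        exact lintegral_sub_left_eq_self (fun u : ι → ℝ =>
          jap ((s - s') + (m - m') ⬝ᵥ u) ^ (-(4 : ℝ)) * jap u ^ (-((Fintype.card ι : ℝ) + 3))) v
    _ ≤ B * (C * ENNReal.ofReal (1 + slopeSize (m - m')) ^ ε * jap (s - s') ^ (-(1 + ε))) := by
        gcongr; exact hC ε hε hε1 _ _
    _ = _ := by ring

end Maximal

/-! ### The slab maximal operator on `L²` by linearization and `TT*`. -/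

section MaximalTheorem

variable {ι : Type*} [Fintype ι]

theorem lintegral_mul_le_sqrt {α : Type*} [MeasurableSpace α] {μ : Measure α} {f g : α → ℝ≥0∞}
    (hf : AEMeasurable f μ) (hg : AEMeasurable g μ) :
    ∫⁻ a, f a * g a ∂μ ≤ (∫⁻ a, f a ^ (2 : ℝ) ∂μ) ^ (1 / 2 : ℝ) *
      (∫⁻ a, g a ^ (2 : ℝ) ∂μ) ^ (1 / 2 : ℝ) :=
  ENNReal.lintegral_mul_le_Lp_mul_Lq μ Real.HolderConjugate.two_two hf hg

/-- The dual of the linearized slab maximal operator on the line through `v`. -/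
def slabDual (l : ℝ → ι → ℝ) (v : ι → ℝ) (h : ℝ → ℝ≥0∞) (y : ℝ × (ι → ℝ)) : ℝ≥0∞ :=
  ∫⁻ s, h s * slabHalf (l s) ((s, v) - y)

theorem measurable_slabDual_integrand {l : ℝ → ι → ℝ} (hl : Measurable l) (v : ι → ℝ)
    {h : ℝ → ℝ≥0∞} (hh : Measurable h) :
    Measurable fun p : (ℝ × (ι → ℝ)) × ℝ => h p.2 * slabHalf (l p.2) ((p.2, v) - p.1) :=
  (hh.comp measurable_snd).mul (measurable_slabHalf_comp (hl.comp measurable_snd)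
    ((measurable_snd.prodMk measurable_const).sub measurable_fst))

theorem measurable_slabDual {l : ℝ → ι → ℝ} (hl : Measurable l) (v : ι → ℝ)
    {h : ℝ → ℝ≥0∞} (hh : Measurable h) : Measurable (slabDual l v h) :=
  (measurable_slabDual_integrand hl v hh).lintegral_prod_right'

/-- Schur's test for the square of a dual operator with positive kernel. -/
theorem lintegral_dual_sq_le {Y : Type*} [MeasurableSpace Y] {μ : Measure Y} [SFinite μ]
    {k : ℝ → Y → ℝ≥0∞} (hkm : Measurable fun p : ℝ × Y => k p.1 p.2)
    {W : ℝ → ℝ → ℝ≥0∞} (hW : Measurable fun p : ℝ × ℝ => W p.1 p.2) {A : ℝ≥0∞}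
    (hpair : ∀ s s', ∫⁻ y, k s y * k s' y ∂μ ≤ W s s') (h1 : ∀ s, ∫⁻ s', W s s' ≤ A)
    (h2 : ∀ s', ∫⁻ s, W s s' ≤ A) {h : ℝ → ℝ≥0∞} (hh : Measurable h) :
    ∫⁻ y, (∫⁻ s, h s * k s y) ^ (2 : ℝ) ∂μ ≤ 2 * A * ∫⁻ s, h s ^ (2 : ℝ) := by
  have hks : ∀ y, Measurable fun s => h s * k s y := fun y =>
    hh.mul (hkm.comp (measurable_id.prodMk measurable_const))
  have hsq : ∀ y, (∫⁻ s, h s * k s y) ^ (2 : ℝ) =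
      ∫⁻ s, ∫⁻ s', h s * h s' * (k s y * k s' y) := by
    intro y
    rw [ENNReal.rpow_two, sq, ← lintegral_mul_const _ (hks y)]
    refine lintegral_congr fun s => ?_
    rw [← lintegral_const_mul _ (hks y)]
    refine lintegral_congr fun s' => ?_
    ring
  have hm3 : Measurable fun p : (Y × ℝ) × ℝ =>
      h p.1.2 * h p.2 * (k p.1.2 p.1.1 * k p.2 p.1.1) := by
    have hp1 : Measurable fun p : (Y × ℝ) × ℝ => (p.1.2, p.1.1) :=
      (measurable_snd.comp measurable_fst).prodMk (measurable_fst.comp measurable_fst)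
    have hp2 : Measurable fun p : (Y × ℝ) × ℝ => (p.2, p.1.1) :=
      measurable_snd.prodMk (measurable_fst.comp measurable_fst)
    exact ((hh.comp (measurable_snd.comp measurable_fst)).mul (hh.comp measurable_snd)).mul
      ((hkm.comp hp1).mul (hkm.comp hp2))
  have hm2 : ∀ s, Measurable fun p : Y × ℝ => h s * h p.2 * (k s p.1 * k p.2 p.1) := fun s =>
    hm3.comp ((measurable_fst.prodMk measurable_const).prodMk measurable_snd)
  have hpt : ∀ s s', ∫⁻ y, h s * h s' * (k s y * k s' y) ∂μ ≤
      h s ^ (2 : ℝ) * W s s' + h s' ^ (2 : ℝ) * W s s' := by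
    intro s s'
    have hkm2 : Measurable fun y => k s y * k s' y :=
      (hkm.comp (measurable_const.prodMk measurable_id)).mul
        (hkm.comp (measurable_const.prodMk measurable_id))
    rw [lintegral_const_mul _ hkm2, ← add_mul]
    have hab : h s * h s' ≤ h s ^ (2 : ℝ) + h s' ^ (2 : ℝ) := by
      rw [ENNReal.rpow_two, ENNReal.rpow_two]
      rcases le_total (h s) (h s') with h0 | h0
      · calc h s * h s' ≤ h s' * h s' := by gcongr
          _ = h s' ^ 2 := (sq _).symm
          _ ≤ _ := le_add_self
      · calc h s * h s' ≤ h s * h s := by gcongr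
          _ = h s ^ 2 := (sq _).symm
          _ ≤ _ := le_self_add
    exact mul_le_mul' hab (hpair s s')
  have hW1 : ∀ s, Measurable fun s' => W s s' := fun s =>
    hW.comp (measurable_const.prodMk measurable_id)
  have hW2 : ∀ s', Measurable fun s => W s s' := fun s' =>
    hW.comp (measurable_id.prodMk measurable_const)
  have hsqm : Measurable fun s => h s ^ (2 : ℝ) := hh.pow_const _
  have ha : Measurable fun p : ℝ × ℝ => h p.1 ^ (2 : ℝ) * W p.1 p.2 :=
    (hsqm.comp measurable_fst).mul hW
  have hb : Measurable fun p : ℝ × ℝ => h p.2 ^ (2 : ℝ) * W p.1 p.2 :=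
    (hsqm.comp measurable_snd).mul hW
  have e1 : ∫⁻ s, ∫⁻ s', h s ^ (2 : ℝ) * W s s' ≤ (∫⁻ s, h s ^ (2 : ℝ)) * A := by
    rw [← lintegral_mul_const _ hsqm]
    refine lintegral_mono fun s => ?_
    rw [lintegral_const_mul _ (hW1 s)]
    exact mul_le_mul_right (h1 s) _
  have e2 : ∫⁻ s, ∫⁻ s', h s' ^ (2 : ℝ) * W s s' ≤ (∫⁻ s, h s ^ (2 : ℝ)) * A := by
    rw [lintegral_lintegral_swap hb.aemeasurable, ← lintegral_mul_const _ hsqm]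
    refine lintegral_mono fun s' => ?_
    rw [lintegral_const_mul _ (hW2 s')]
    exact mul_le_mul_right (h2 s') _
  calc ∫⁻ y, (∫⁻ s, h s * k s y) ^ (2 : ℝ) ∂μ
      = ∫⁻ y, (∫⁻ s, ∫⁻ s', h s * h s' * (k s y * k s' y)) ∂μ := lintegral_congr hsq
    _ = ∫⁻ s, ∫⁻ y, (∫⁻ s', h s * h s' * (k s y * k s' y)) ∂μ :=
        lintegral_lintegral_swap hm3.lintegral_prod_right'.aemeasurable
    _ = ∫⁻ s, ∫⁻ s', ∫⁻ y, h s * h s' * (k s y * k s' y) ∂μ :=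
        lintegral_congr fun s => lintegral_lintegral_swap (hm2 s).aemeasurable
    _ ≤ ∫⁻ s, ∫⁻ s', (h s ^ (2 : ℝ) * W s s' + h s' ^ (2 : ℝ) * W s s') :=
        lintegral_mono fun s => lintegral_mono fun s' => hpt s s'
    _ = (∫⁻ s, ∫⁻ s', h s ^ (2 : ℝ) * W s s') + ∫⁻ s, ∫⁻ s', h s' ^ (2 : ℝ) * W s s' := by
        have hai : Measurable fun s => ∫⁻ s', h s ^ (2 : ℝ) * W s s' := ha.lintegral_prod_right'
        rw [← lintegral_add_left hai]
        exact lintegral_congr fun s =>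
          lintegral_add_left (ha.comp (measurable_const.prodMk measurable_id)) _
    _ ≤ (∫⁻ s, h s ^ (2 : ℝ)) * A + (∫⁻ s, h s ^ (2 : ℝ)) * A := add_le_add e1 e2
    _ = 2 * A * ∫⁻ s, h s ^ (2 : ℝ) := by ring

/-- The `TT*` step: the kernel is the overlap of two slabs through points of one line. It sees the
choice of slopes only through the bound `B` on their differences, and `jap (s - s')^(-(1+ε))` is
integrable, so Schur's test applies to every measurable choice `l`. -/
theorem exists_slabDual_sq_le (ι : Type*) [Fintype ι] {ε : ℝ} (hε : 0 < ε) (hε1 : ε ≤ 1) :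
    ∃ C : ℝ≥0, ∀ (B : ℝ) (l : ℝ → ι → ℝ), Measurable l →
      (∀ s s', slopeSize (l s - l s') ≤ B) → ∀ (v : ι → ℝ) (h : ℝ → ℝ≥0∞), Measurable h →
      ∫⁻ y, slabDual l v h y ^ (2 : ℝ) ≤ C * ENNReal.ofReal (1 + B) ^ ε * ∫⁻ s, h s ^ (2 : ℝ) := by
  obtain ⟨C, hC⟩ := exists_slabHalf_pair_le ι
  have hfin : ∫⁻ x : ℝ, jap x ^ (-(1 + ε)) ≠ ⊤ := lintegral_jap_ne_top (by simpa using hε)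
  obtain ⟨J, hJ⟩ := WithTop.ne_top_iff_exists.1 hfin
  refine ⟨C * (2 * J), fun B l hl hB v h hh => ?_⟩
  have hQt : C * ENNReal.ofReal (1 + B) ^ ε ≠ ⊤ := ENNReal.mul_ne_top ENNReal.coe_ne_top
    (ENNReal.rpow_ne_top_of_nonneg hε.le ENNReal.ofReal_ne_top)
  have hkm : Measurable fun p : ℝ × (ℝ × (ι → ℝ)) => slabHalf (l p.1) ((p.1, v) - p.2) :=
    measurable_slabHalf_comp (hl.comp measurable_fst)
      ((measurable_fst.prodMk measurable_const).sub measurable_snd)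
  have hmj : Measurable fun p : ℝ × ℝ =>
      C * ENNReal.ofReal (1 + B) ^ ε * jap (p.1 - p.2) ^ (-(1 + ε)) :=
    measurable_const.mul ((measurable_jap.comp (measurable_fst.sub measurable_snd)).pow_const _)
  have hi : ∀ s : ℝ, ∫⁻ s' : ℝ, C * ENNReal.ofReal (1 + B) ^ ε * jap (s - s') ^ (-(1 + ε))
      = C * ENNReal.ofReal (1 + B) ^ ε * J := by
    intro s
    rw [lintegral_const_mul' _ _ hQt, lintegral_comp_sub_left_jap, ← hJ]; rfl
  have hi' : ∀ s' : ℝ, ∫⁻ s : ℝ, C * ENNReal.ofReal (1 + B) ^ ε * jap (s - s') ^ (-(1 + ε))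
      = C * ENNReal.ofReal (1 + B) ^ ε * J := by
    intro s'
    rw [← hi s']
    refine lintegral_congr fun s => ?_
    rw [← jap_neg, neg_sub]
  refine (lintegral_dual_sq_le hkm hmj (fun s s' => ?_) (fun s => (hi s).le)
    (fun s' => (hi' s').le) hh).trans_eq ?_
  · refine (hC ε hε.le hε1 s s' v (l s) (l s')).trans ?_
    have : ENNReal.ofReal (1 + slopeSize (l s - l s')) ^ ε ≤ ENNReal.ofReal (1 + B) ^ ε := by
      gcongr
      exact hB s s'
    gcongr
  · rw [ENNReal.coe_mul, ENNReal.coe_mul, ENNReal.coe_ofNat]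
    ring

/-- The linearized slab maximal operator on a line. -/
theorem lintegral_mul_slab_le {l : ℝ → ι → ℝ} (hl : Measurable l) (v : ι → ℝ) {h : ℝ → ℝ≥0∞}
    (hh : Measurable h) {F : ℝ × (ι → ℝ) → ℝ≥0∞} (hF : Measurable F) :
    ∫⁻ s, h s * ∫⁻ y, F y * slabKernel (l s) ((s, v) - y) ≤
      (∫⁻ y, F y ^ (2 : ℝ) * jap (v - y.2) ^ (-((Fintype.card ι : ℝ) + 3))) ^ (1 / 2 : ℝ) *
      (∫⁻ y, slabDual l v h y ^ (2 : ℝ)) ^ (1 / 2 : ℝ) := by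
  -- Half of the transversal decay stays with `F`, giving a weight that can later be integrated in
  -- `v`; the other half goes to the dual operator and localizes the overlaps.
  set w : ℝ × (ι → ℝ) → ℝ≥0∞ := fun y => jap (v - y.2) ^ (-((Fintype.card ι : ℝ) + 3) / 2) with hw
  have hwm : Measurable w := (measurable_jap.comp (measurable_const.sub measurable_snd)).pow_const _
  have hmeas : Measurable fun p : ℝ × (ℝ × (ι → ℝ)) =>
      h p.1 * (F p.2 * slabKernel (l p.1) ((p.1, v) - p.2)) :=
    (hh.comp measurable_fst).mul ((hF.comp measurable_snd).mul (measurable_slabKernel_comp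
      (hl.comp measurable_fst) ((measurable_fst.prodMk measurable_const).sub measurable_snd)))
  have hms : ∀ s, Measurable fun y => F y * slabKernel (l s) ((s, v) - y) := fun s =>
    hF.mul (measurable_slabKernel_comp measurable_const (measurable_const.sub measurable_id))
  have e : ∫⁻ s, h s * ∫⁻ y, F y * slabKernel (l s) ((s, v) - y)
      = ∫⁻ y, (F y * w y) * slabDual l v h y := by
    calc _ = ∫⁻ s, ∫⁻ y, h s * (F y * slabKernel (l s) ((s, v) - y)) := by
          congr 1; ext s; rw [lintegral_const_mul _ (hms s)]
      _ = ∫⁻ y, ∫⁻ s, h s * (F y * slabKernel (l s) ((s, v) - y)) :=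
          lintegral_lintegral_swap hmeas.aemeasurable
      _ = _ := by
          congr 1; ext y
          have hd : Measurable fun s => h s * slabHalf (l s) ((s, v) - y) :=
            (measurable_slabDual_integrand hl v hh).comp (measurable_const.prodMk measurable_id)
          rw [slabDual, ← lintegral_const_mul _ hd]
          congr 1; ext s
          rw [slabKernel_eq]
          simp only [hw, Prod.snd_sub]
          ring
  rw [e]
  refine (lintegral_mul_le_sqrt (f := fun y => F y * w y) (hF.mul hwm).aemeasurable
    (measurable_slabDual hl v hh).aemeasurable).trans_eq ?_
  congr 2
  refine lintegral_congr fun y => ?_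
  rw [ENNReal.mul_rpow_of_nonneg _ _ (by norm_num), hw, ← ENNReal.rpow_mul]
  congr 2; ring

/-- Convolution with the slab kernel of slope `m`. -/
def slabConv (F : ℝ × (ι → ℝ) → ℝ≥0∞) (m : ι → ℝ) (x : ℝ × (ι → ℝ)) : ℝ≥0∞ :=
  ∫⁻ y, F y * slabKernel m (x - y)

theorem measurable_slabConv {F : ℝ × (ι → ℝ) → ℝ≥0∞} (hF : Measurable F) (m : ι → ℝ) :
    Measurable (slabConv F m) :=
  ((hF.comp measurable_snd).mul (measurable_slabKernel_comp measurable_const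
    (measurable_fst.sub measurable_snd))).lintegral_prod_right'

/-- The supremum `S` is realized by a measurable choice of slope along the line. Pairing with `S`
itself and using the dual bound gives `∫ S² ≤ (∫ S²)^(1/2) (Q X)^(1/2)`, from which one square root
is divided out. -/
theorem exists_line_maximal_le (ι : Type*) [Fintype ι] {ε : ℝ} (hε : 0 < ε) (hε1 : ε ≤ 1) :
    ∃ C : ℝ≥0, ∀ (B : ℝ) (T : Type) [Finite T] [Nonempty T] (l : T → ι → ℝ),
      (∀ t t', slopeSize (l t - l t') ≤ B) → ∀ (F : ℝ × (ι → ℝ) → ℝ≥0∞), Measurable F →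
      ∀ v : ι → ℝ, ∫⁻ s, (⨆ t, slabConv F (l t) (s, v)) ^ (2 : ℝ) ≤ C * ENNReal.ofReal (1 + B) ^ ε *
        ∫⁻ y, F y ^ (2 : ℝ) * jap (v - y.2) ^ (-((Fintype.card ι : ℝ) + 3)) := by
  classical
  obtain ⟨C, hC⟩ := exists_slabDual_sq_le ι hε hε1
  refine ⟨C, fun B T _ _ l hB F hF v => ?_⟩
  set X := ∫⁻ y, F y ^ (2 : ℝ) * jap (v - y.2) ^ (-((Fintype.card ι : ℝ) + 3)) with hX
  set Q := C * ENNReal.ofReal (1 + B) ^ ε with hQ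
  set S : ℝ → ℝ≥0∞ := fun s => ⨆ t, slabConv F (l t) (s, v) with hS
  have hKm : ∀ t, Measurable fun s => slabConv F (l t) (s, v) := fun t =>
    (measurable_slabConv hF (l t)).comp (measurable_id.prodMk measurable_const)
  have hSm : Measurable S := Measurable.iSup hKm
  obtain ⟨e, he⟩ := exists_surjective_nat T
  have hex : ∀ s, ∃ k, S s ≤ slabConv F (l (e k)) (s, v) := by
    intro s
    obtain ⟨t, ht⟩ := exists_eq_ciSup_of_finite (f := fun t => slabConv F (l t) (s, v))
    obtain ⟨k, rfl⟩ := he t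
    exact ⟨k, ht.ge⟩
  -- Taking the first index that attains the supremum makes the choice measurable.
  set τ : ℝ → ℕ := fun s => Nat.find (hex s) with hτ
  have hτm : Measurable τ := measurable_find hex fun k => measurableSet_le hSm (hKm (e k))
  set L : ℝ → ι → ℝ := fun s => l (e (τ s)) with hL
  have hLm : Measurable L := (measurable_from_nat (f := fun k => l (e k))).comp hτm
  have hSL : ∀ s, S s ≤ ∫⁻ y, F y * slabKernel (L s) ((s, v) - y) := fun s => Nat.find_spec (hex s)
  -- The truncations have finite `L²` norm, which permits the division; monotone convergence removes
  -- them at the end.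
  set h : ℕ → ℝ → ℝ≥0∞ := fun n => (Set.Icc (-(n : ℝ)) n).indicator fun s => min (S s) n with hh
  have hhm : ∀ n, Measurable (h n) := fun n =>
    (hSm.min measurable_const).indicator measurableSet_Icc
  have hbound : ∀ n, ∫⁻ s, h n s ^ (2 : ℝ) ≤ Q * X := by
    intro n
    have hfin : ∫⁻ s, h n s ^ (2 : ℝ) ≠ ⊤ := by
      have : ∀ s, h n s ^ (2 : ℝ) ≤ (Set.Icc (-(n : ℝ)) n).indicator (fun _ => (n : ℝ≥0∞) ^ (2 : ℝ)) s := by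
        intro s
        by_cases hs : s ∈ Set.Icc (-(n : ℝ)) n
        · simp only [hh, Set.indicator_of_mem hs]
          gcongr; exact min_le_right _ _
        · simp [hh, Set.indicator_of_notMem hs]
      refine ne_top_of_le_ne_top ?_ (lintegral_mono this)
      rw [lintegral_indicator measurableSet_Icc, setLIntegral_const]
      refine ENNReal.mul_ne_top (ENNReal.rpow_ne_top_of_nonneg (by norm_num) (by simp)) ?_
      simp
    have h1 : ∫⁻ s, h n s ^ (2 : ℝ) ≤ (∫⁻ s, h n s ^ (2 : ℝ)) ^ (1 - 1 / 2 : ℝ) *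
        (X ^ (1 / 2 : ℝ) * Q ^ (1 / 2 : ℝ)) := by
      calc ∫⁻ s, h n s ^ (2 : ℝ)
          ≤ ∫⁻ s, h n s * ∫⁻ y, F y * slabKernel (L s) ((s, v) - y) := by
            refine lintegral_mono fun s => ?_
            rw [ENNReal.rpow_two, sq]
            gcongr
            refine le_trans ?_ (hSL s)
            by_cases hs : s ∈ Set.Icc (-(n : ℝ)) n
            · simp only [hh, Set.indicator_of_mem hs]; exact min_le_left _ _
            · simp [hh, Set.indicator_of_notMem hs]
        _ ≤ X ^ (1 / 2 : ℝ) * (∫⁻ y, slabDual L v (h n) y ^ (2 : ℝ)) ^ (1 / 2 : ℝ) :=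
            lintegral_mul_slab_le hLm v (hhm n) hF
        _ ≤ X ^ (1 / 2 : ℝ) * (Q * ∫⁻ s, h n s ^ (2 : ℝ)) ^ (1 / 2 : ℝ) := by
            gcongr
            exact hC B L hLm (fun s s' => hB _ _) v (h n) (hhm n)
        _ = _ := by
            rw [ENNReal.mul_rpow_of_nonneg _ _ (by norm_num : (0 : ℝ) ≤ 1 / 2)]
            norm_num
            ring
    have h2 := rpow_le_of_le_rpow_mul (by norm_num) hfin h1
    rw [← ENNReal.mul_rpow_of_nonneg _ _ (by norm_num : (0 : ℝ) ≤ 1 / 2)] at h2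
    have h3 := (ENNReal.rpow_le_rpow_iff (by norm_num : (0 : ℝ) < 1 / 2)).1 h2
    rwa [mul_comm] at h3
  have hmono : Monotone fun n s => h n s ^ (2 : ℝ) := by
    intro n n' hnn s
    have hc : (n : ℝ) ≤ n' := by exact_mod_cast hnn
    change h n s ^ (2 : ℝ) ≤ h n' s ^ (2 : ℝ)
    gcongr
    by_cases hs : s ∈ Set.Icc (-(n : ℝ)) n
    · have hs' : s ∈ Set.Icc (-(n' : ℝ)) n' := ⟨by linarith [hs.1], by linarith [hs.2]⟩
      simp only [hh, Set.indicator_of_mem hs, Set.indicator_of_mem hs']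
      gcongr
    · simp [hh, Set.indicator_of_notMem hs]
  have hsup : ∀ s, S s ^ (2 : ℝ) ≤ ⨆ n, h n s ^ (2 : ℝ) := by
    intro s
    refine ENNReal.le_of_forall_pos_nnreal_lt fun a _ ha => ?_
    have : ∃ n : ℕ, |s| ≤ n ∧ a ≤ (min (S s) n) ^ (2 : ℝ) := by
      by_cases hst : S s = ⊤
      · obtain ⟨n, hn⟩ := exists_nat_ge (max |s| (max 1 a))
        refine ⟨n, (le_max_left _ _).trans hn, ?_⟩
        have h1 : (1 : ℝ) ≤ n := ((le_max_left _ _).trans (le_max_right _ _)).trans hn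
        have h2 : (a : ℝ) ≤ n := ((le_max_right _ _).trans (le_max_right _ _)).trans hn
        rw [hst, min_eq_right le_top]
        have h2' : (a : ℝ≥0∞) ≤ n := by
          have : a ≤ (n : ℝ≥0) := by exact_mod_cast h2
          exact_mod_cast this
        have h1' : (1 : ℝ≥0∞) ≤ n := by exact_mod_cast h1
        calc (a : ℝ≥0∞) ≤ n := h2'
          _ = (n : ℝ≥0∞) ^ (1 : ℝ) := (ENNReal.rpow_one _).symm
          _ ≤ _ := ENNReal.rpow_le_rpow_of_exponent_le h1' (by norm_num)
      · obtain ⟨n, hn⟩ := exists_nat_ge (max |s| (S s).toReal)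
        refine ⟨n, (le_max_left _ _).trans hn, ?_⟩
        have : S s ≤ n := by
          rw [← ENNReal.ofReal_toReal hst, ← ENNReal.ofReal_natCast]
          exact ENNReal.ofReal_le_ofReal ((le_max_right _ _).trans hn)
        rw [min_eq_left this]
        exact ha.le
    obtain ⟨n, hn1, hn2⟩ := this
    refine le_trans ?_ (le_iSup (fun n => h n s ^ (2 : ℝ)) n)
    have hs : s ∈ Set.Icc (-(n : ℝ)) n := abs_le.1 hn1
    simpa only [hh, Set.indicator_of_mem hs] using hn2
  calc ∫⁻ s, S s ^ (2 : ℝ) ≤ ∫⁻ s, ⨆ n, h n s ^ (2 : ℝ) := lintegral_mono hsup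
    _ = ⨆ n, ∫⁻ s, h n s ^ (2 : ℝ) := lintegral_iSup (fun n => (hhm n).pow_const _) hmono
    _ ≤ Q * X := iSup_le hbound

/-- The maximal operator over slabs of finitely many slopes is bounded on `L²`, with at most a
small power loss in the size of the set of slopes. -/
theorem exists_slab_maximal_le (ι : Type*) [Fintype ι] {ε : ℝ} (hε : 0 < ε) (hε1 : ε ≤ 1) :
    ∃ C : ℝ≥0, ∀ (B : ℝ) (T : Type) [Finite T] [Nonempty T] (l : T → ι → ℝ),
      (∀ t t', slopeSize (l t - l t') ≤ B) → ∀ (F : ℝ × (ι → ℝ) → ℝ≥0∞), Measurable F →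
      ∫⁻ x, (⨆ t, slabConv F (l t) x) ^ (2 : ℝ) ≤
        C * ENNReal.ofReal (1 + B) ^ ε * ∫⁻ y, F y ^ (2 : ℝ) := by
  obtain ⟨C, hC⟩ := exists_line_maximal_le ι hε hε1
  have hfin : ∫⁻ u : ι → ℝ, jap u ^ (-((Fintype.card ι : ℝ) + 3)) ≠ ⊤ :=
    lintegral_jap_ne_top (by simp)
  set J := ∫⁻ u : ι → ℝ, jap u ^ (-((Fintype.card ι : ℝ) + 3)) with hJ
  refine ⟨C * J.toNNReal, fun B T _ _ l hB F hF => ?_⟩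
  have hQt : C * ENNReal.ofReal (1 + B) ^ ε ≠ ⊤ := ENNReal.mul_ne_top ENNReal.coe_ne_top
    (ENNReal.rpow_ne_top_of_nonneg hε.le ENNReal.ofReal_ne_top)
  have hSm : Measurable fun x => (⨆ t, slabConv F (l t) x) ^ (2 : ℝ) :=
    (Measurable.iSup fun t => measurable_slabConv hF (l t)).pow_const _
  have hFm : Measurable fun p : (ι → ℝ) × (ℝ × (ι → ℝ)) =>
      F p.2 ^ (2 : ℝ) * jap (p.1 - p.2.2) ^ (-((Fintype.card ι : ℝ) + 3)) :=
    ((hF.comp measurable_snd).pow_const _).mul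
      ((measurable_jap.comp (measurable_fst.sub (measurable_snd.comp measurable_snd))).pow_const _)
  -- The estimates on the lines are integrated over `v`; the weight in `v - y.2` has a finite
  -- integral.
  calc ∫⁻ x, (⨆ t, slabConv F (l t) x) ^ (2 : ℝ)
      = ∫⁻ v, ∫⁻ s, (⨆ t, slabConv F (l t) (s, v)) ^ (2 : ℝ) := by
        rw [Measure.volume_eq_prod, lintegral_prod_symm' _ hSm]
    _ ≤ ∫⁻ v, C * ENNReal.ofReal (1 + B) ^ ε *
        ∫⁻ y : ℝ × (ι → ℝ), F y ^ (2 : ℝ) * jap (v - y.2) ^ (-((Fintype.card ι : ℝ) + 3)) :=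
        lintegral_mono fun v => hC B T l hB F hF v
    _ = C * ENNReal.ofReal (1 + B) ^ ε * ∫⁻ y : ℝ × (ι → ℝ), ∫⁻ v : ι → ℝ,
        F y ^ (2 : ℝ) * jap (v - y.2) ^ (-((Fintype.card ι : ℝ) + 3)) := by
        rw [lintegral_const_mul' _ _ hQt, lintegral_lintegral_swap hFm.aemeasurable]
    _ = C * ENNReal.ofReal (1 + B) ^ ε * ∫⁻ y : ℝ × (ι → ℝ), F y ^ (2 : ℝ) * J := by
        congr 2; ext y
        have hm : Measurable fun v : ι → ℝ => jap (v - y.2) ^ (-((Fintype.card ι : ℝ) + 3)) :=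
          (measurable_jap.comp (measurable_id.sub measurable_const)).pow_const _
        rw [lintegral_const_mul _ hm,
          lintegral_sub_right_eq_self (fun v : ι → ℝ => jap v ^ (-((Fintype.card ι : ℝ) + 3)))]
    _ = _ := by
        rw [lintegral_mul_const' _ _ hfin, ENNReal.coe_mul, ENNReal.coe_toNNReal hfin]
        ring

end MaximalTheorem

/-! ### Means over the cells of a matrix, with bounds uniform in the matrix. -/

section Young

/-- The factor `|det M|⁻¹`. -/
def invDet {d : ℕ} (M : GL (Fin d) ℝ) : ℝ≥0∞ :=
  ENNReal.ofReal |(M : Matrix (Fin d) (Fin d) ℝ).det|⁻¹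

variable {d : ℕ}

theorem det_GL_ne_zero (M : GL (Fin d) ℝ) : (M : Matrix (Fin d) (Fin d) ℝ).det ≠ 0 :=
  ((Matrix.isUnit_iff_isUnit_det _).1 M.isUnit).ne_zero

theorem invDet_ne_top (M : GL (Fin d) ℝ) : invDet M ≠ ⊤ := ENNReal.ofReal_ne_top

theorem invDet_mul (M N : GL (Fin d) ℝ) : invDet (M * N) = invDet M * invDet N := by
  rw [invDet, invDet, invDet, ← ENNReal.ofReal_mul (by positivity), Units.val_mul, Matrix.det_mul,
    abs_mul, mul_inv]

theorem invDet_one : invDet (1 : GL (Fin d) ℝ) = 1 := by simp [invDet]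

theorem invDet_inv_mul (M : GL (Fin d) ℝ) : invDet M⁻¹ * invDet M = 1 := by
  rw [← invDet_mul, inv_mul_cancel, invDet_one]

theorem invDet_mul_inv (M : GL (Fin d) ℝ) : invDet M * invDet M⁻¹ = 1 := by
  rw [mul_comm, invDet_inv_mul]

theorem matEquiv_mul_apply (M N : GL (Fin d) ℝ) (x : Eucl d) :
    matEquiv (M * N) x = matEquiv M (matEquiv N x) := by
  apply (WithLp.equiv 2 (Fin d → ℝ)).injective
  ext k
  change matEquiv (M * N) x k = matEquiv M (matEquiv N x) k
  rw [matEquiv_apply, matEquiv_apply, Units.val_mul, ← Matrix.mulVec_mulVec]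
  rfl

theorem matEquiv_one_apply (x : Eucl d) : matEquiv 1 x = x := by
  apply (WithLp.equiv 2 (Fin d → ℝ)).injective
  ext k
  change matEquiv 1 x k = x k
  rw [matEquiv_apply]; simp

theorem matEquiv_inv_matEquiv (M : GL (Fin d) ℝ) (x : Eucl d) :
    matEquiv M⁻¹ (matEquiv M x) = x := by
  rw [← matEquiv_mul_apply, inv_mul_cancel, matEquiv_one_apply]

theorem matEquiv_matEquiv_inv (M : GL (Fin d) ℝ) (x : Eucl d) :
    matEquiv M (matEquiv M⁻¹ x) = x := by
  rw [← matEquiv_mul_apply, mul_inv_cancel, matEquiv_one_apply]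

theorem lintegral_comp_matEquiv (M : GL (Fin d) ℝ) (f : Eucl d → ℝ≥0∞) :
    ∫⁻ x, f (matEquiv M x) = invDet M * ∫⁻ x, f x := by
  have hdet : LinearMap.det ((matEquiv M : Eucl d ≃L[ℝ] Eucl d) : Eucl d →ₗ[ℝ] Eucl d)
      = (M : Matrix (Fin d) (Fin d) ℝ).det :=
    LinearMap.det_toLpLin 2 (M : Matrix (Fin d) (Fin d) ℝ)
  have h := Measure.map_linearMap_addHaar_eq_smul_addHaar (volume : Measure (Eucl d))
    (f := ((matEquiv M : Eucl d ≃L[ℝ] Eucl d) : Eucl d →ₗ[ℝ] Eucl d))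
    (by rw [hdet]; exact det_GL_ne_zero M)
  rw [hdet] at h
  have h2 := lintegral_map_equiv (μ := (volume : Measure (Eucl d))) f
    (matEquiv M).toHomeomorph.toMeasurableEquiv
  change _ = ∫⁻ x, f (matEquiv M x) at h2
  rw [← h2]
  change ∫⁻ y, f y ∂(Measure.map (matEquiv M) volume) = _
  rw [show Measure.map (matEquiv M) (volume : Measure (Eucl d)) = invDet M • volume by
    rw [invDet, ← abs_inv]; exact h]
  rw [lintegral_smul_measure, smul_eq_mul]

/-- Young's inequality for the convolution of a function with a positive kernel. -/
theorem lintegral_conv_rpow_le {F w : Eucl d → ℝ≥0∞} (hF : Measurable F) (hw : Measurable w)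
    {s : ℝ} (hs : 1 ≤ s) :
    ∫⁻ x, (∫⁻ y, F y * w (x - y)) ^ s ≤ (∫⁻ y, w y) ^ s * ∫⁻ y, F y ^ s := by
  have hs0 : 0 < s := by linarith
  have hpt : ∀ x, (∫⁻ y, F y * w (x - y)) ^ s ≤
      (∫⁻ y, F y ^ s * w (x - y)) * (∫⁻ y, w y) ^ (s - 1) := by
    intro x
    have hwx : Measurable fun y => w (x - y) := hw.comp (measurable_const.sub measurable_id)
    -- Hölder for the factorization `F w = (F^s w)^(1/s) w^(1-1/s)`.
    have h := ENNReal.lintegral_mul_norm_pow_le (μ := (volume : Measure (Eucl d)))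
      (f := fun y => F y ^ s * w (x - y)) (g := fun y => w (x - y))
      ((hF.pow_const s).mul hwx).aemeasurable hwx.aemeasurable (p := 1 / s) (q := 1 - 1 / s)
      (by positivity) (by rw [sub_nonneg, div_le_one hs0]; exact hs) (by ring)
    have e : ∀ y, (F y ^ s * w (x - y)) ^ (1 / s) * w (x - y) ^ (1 - 1 / s) = F y * w (x - y) := by
      intro y
      rw [ENNReal.mul_rpow_of_nonneg _ _ (by positivity), ← ENNReal.rpow_mul, mul_one_div_cancel hs0.ne',
        ENNReal.rpow_one, mul_assoc, ← ENNReal.rpow_add_of_nonneg _ _ (by positivity)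
          (by rw [sub_nonneg, div_le_one hs0]; exact hs)]
      simp
    simp only [e] at h
    rw [lintegral_sub_left_eq_self (fun y => w y) x] at h
    refine (ENNReal.rpow_le_rpow h hs0.le).trans_eq ?_
    rw [ENNReal.mul_rpow_of_nonneg _ _ hs0.le, ← ENNReal.rpow_mul, ← ENNReal.rpow_mul,
      one_div_mul_cancel hs0.ne', ENNReal.rpow_one]
    congr 2
    field_simp
  have hm : Measurable fun p : Eucl d × Eucl d => F p.2 ^ s * w (p.1 - p.2) :=
    ((hF.comp measurable_snd).pow_const s).mul (hw.comp (measurable_fst.sub measurable_snd))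
  calc ∫⁻ x, (∫⁻ y, F y * w (x - y)) ^ s
      ≤ ∫⁻ x, (∫⁻ y, F y ^ s * w (x - y)) * (∫⁻ y, w y) ^ (s - 1) := lintegral_mono hpt
    _ = (∫⁻ x, ∫⁻ y, F y ^ s * w (x - y)) * (∫⁻ y, w y) ^ (s - 1) :=
        lintegral_mul_const _ hm.lintegral_prod_right'
    _ = (∫⁻ y, ∫⁻ x, F y ^ s * w (x - y)) * (∫⁻ y, w y) ^ (s - 1) := by
        rw [lintegral_lintegral_swap hm.aemeasurable]
    _ = (∫⁻ y, F y ^ s * ∫⁻ x, w x) * (∫⁻ y, w y) ^ (s - 1) := by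
        congr 1
        refine lintegral_congr fun y => ?_
        have hwy : Measurable fun x => w (x - y) := hw.comp (measurable_id.sub measurable_const)
        rw [lintegral_const_mul _ hwy,
          lintegral_sub_right_eq_self (fun x => w x) y]
    _ = _ := by
        rw [lintegral_mul_const _ (hF.pow_const s)]
        have : (∫⁻ y, w y) * (∫⁻ y, w y) ^ (s - 1) = (∫⁻ y, w y) ^ s := by
          conv_lhs => rw [← ENNReal.rpow_one (∫⁻ y, w y), ← ENNReal.rpow_mul, one_mul]
          rw [← ENNReal.rpow_add_of_nonneg _ _ zero_le_one (by linarith)]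
          simp
        rw [mul_assoc, this, mul_comm]

/-- The average of `H` against the weight `(1 + |M⁻¹ (x - y)|)^(-Λ)`, normalized by the
determinant. -/
def matMean (M : GL (Fin d) ℝ) (Λ : ℝ) (H : Eucl d → ℝ≥0∞) (x : Eucl d) : ℝ≥0∞ :=
  ∫⁻ y, H y * (invDet M * jap (matEquiv M⁻¹ (x - y)) ^ (-Λ))

theorem measurable_matWeight (M : GL (Fin d) ℝ) (Λ : ℝ) :
    Measurable fun y : Eucl d => invDet M * jap (matEquiv M⁻¹ y) ^ (-Λ) :=
  measurable_const.mul
    ((measurable_jap.comp (matEquiv M⁻¹).continuous.measurable).pow_const _)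

theorem measurable_matMean (M : GL (Fin d) ℝ) (Λ : ℝ) {H : Eucl d → ℝ≥0∞} (hH : Measurable H) :
    Measurable (matMean M Λ H) :=
  ((hH.comp measurable_snd).mul ((measurable_matWeight M Λ).comp
    (measurable_fst.sub measurable_snd))).lintegral_prod_right'

theorem matMean_mono (M : GL (Fin d) ℝ) (Λ : ℝ) {H H' : Eucl d → ℝ≥0∞} (h : ∀ x, H x ≤ H' x)
    (x : Eucl d) : matMean M Λ H x ≤ matMean M Λ H' x :=
  lintegral_mono fun y => mul_le_mul_left (h y) _

theorem lintegral_matWeight (M : GL (Fin d) ℝ) (Λ : ℝ) :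
    ∫⁻ y : Eucl d, invDet M * jap (matEquiv M⁻¹ y) ^ (-Λ) = ∫⁻ y : Eucl d, jap y ^ (-Λ) := by
  rw [lintegral_const_mul' _ _ (invDet_ne_top M),
    lintegral_comp_matEquiv M⁻¹ (fun y => jap y ^ (-Λ)), ← mul_assoc, invDet_mul_inv, one_mul]

/-- The total mass of the normalized weight does not depend on `M`, so Young's inequality is uniform
over all dilations and shears. -/
theorem lintegral_matMean_rpow_le (M : GL (Fin d) ℝ) (Λ : ℝ) {H : Eucl d → ℝ≥0∞}
    (hH : Measurable H) {s : ℝ} (hs : 1 ≤ s) :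
    ∫⁻ x, matMean M Λ H x ^ s ≤ (∫⁻ y : Eucl d, jap y ^ (-Λ)) ^ s * ∫⁻ y, H y ^ s := by
  rw [← lintegral_matWeight M Λ]
  exact lintegral_conv_rpow_le hH (measurable_matWeight M Λ) hs

/-- The Peetre inequality for the pulled back distribution, read in the original coordinates.
Uniformity in `M` is inherited from uniformity in the distribution. -/
theorem exists_peetre_pullback_le {L r : ℝ} (hL : 0 ≤ L) (hr : 0 < r) (hr1 : r ≤ 1)
    {θ ψ : 𝓢(Eucl d, ℂ)} (hθ : sconv θ ψ = ψ) :
    ∃ C : ℝ≥0, ∀ (f : 𝓢'(Eucl d, ℂ)) (M : GL (Fin d) ℝ) (x : Eucl d),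
      peetre L (conv (pullback M f) ψ) (matEquiv M⁻¹ x) ^ r ≤
        C * matMean M (L * r) (fun y => ‖conv f (dilate M ψ) y‖ₑ ^ r) x := by
  obtain ⟨C, hC⟩ := exists_peetre_rpow_le hL hr hr1 hθ
  refine ⟨C, fun f M x => (hC _ _).trans_eq ?_⟩
  congr 1
  rw [peetreMean, matMean]
  have h := lintegral_comp_matEquiv M⁻¹ fun z => ‖conv (pullback M f) ψ z‖ₑ ^ r *
    jap (matEquiv M⁻¹ x - z) ^ (-(L * r))
  have h2 : ∫⁻ z, ‖conv (pullback M f) ψ z‖ₑ ^ r * jap (matEquiv M⁻¹ x - z) ^ (-(L * r)) =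
      invDet M * ∫⁻ y, ‖conv (pullback M f) ψ (matEquiv M⁻¹ y)‖ₑ ^ r *
        jap (matEquiv M⁻¹ x - matEquiv M⁻¹ y) ^ (-(L * r)) := by
    rw [h, ← mul_assoc, invDet_mul_inv, one_mul]
  rw [h2, ← lintegral_const_mul' _ _ (invDet_ne_top M)]
  refine lintegral_congr fun y => ?_
  rw [conv_dilate, map_sub]
  ring

end Young

/-! ### Shear cells as slabs; the maximal function over the shears of a scale. -/

section ShearCoordinates

variable {d : ℕ}

/-- The matrix `A_(i)^{-j} B_(i)^{[-ℓ]}` of the index `t`. -/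
def indexGL (t : ShearIndex d) : GL (Fin d) ℝ :=
  (anisoGL t.1 ^ t.2.1)⁻¹ * (shearGL t.1 t.2.2.1)⁻¹

theorem ShearletSystem.atom_eq (S : ShearletSystem d) (t : ShearIndex d) :
    S.atom t = dilate (indexGL t) (S.cone t.1) := rfl

theorem indexGL_inv (t : ShearIndex d) :
    (indexGL t)⁻¹ = shearGL t.1 t.2.2.1 * anisoGL t.1 ^ t.2.1 := by
  rw [indexGL, mul_inv_rev, inv_inv, inv_inv]

theorem anisoGL_val (i : Fin d) : (anisoGL i : Matrix (Fin d) (Fin d) ℝ) =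
    Matrix.diagonal fun k => if k = i then (4 : ℝ) else 2 := rfl

theorem anisoGL_pow_val (i : Fin d) (j : ℕ) :
    ((anisoGL i ^ j : GL (Fin d) ℝ) : Matrix (Fin d) (Fin d) ℝ) =
      Matrix.diagonal fun k => if k = i then (4 : ℝ) ^ j else 2 ^ j := by
  rw [Units.val_pow_eq_pow_val, anisoGL_val, Matrix.diagonal_pow]
  congr 1
  ext k
  simp only [Pi.pow_apply]
  split_ifs <;> rfl

theorem matEquiv_aniso_apply (i : Fin d) (j : ℕ) (x : Eucl d) (k : Fin d) :
    matEquiv (anisoGL i ^ j) x k = (if k = i then (4 : ℝ) ^ j else 2 ^ j) * x k := by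
  rw [matEquiv_apply, anisoGL_pow_val, Matrix.mulVec_diagonal]

theorem shearMatrix_apply_of_ne {i r : Fin d} (ℓ : {k : Fin d // k ≠ i} → ℤ) (h : r ≠ i)
    (c : Fin d) : shearMatrix i ℓ r c = if r = c then 1 else 0 := by
  simp [shearMatrix, h]

theorem matEquiv_shear_apply_of_ne {i k : Fin d} (ℓ : {k : Fin d // k ≠ i} → ℤ) (h : k ≠ i)
    (x : Eucl d) : matEquiv (shearGL i ℓ) x k = x k := by
  rw [matEquiv_apply]
  change ∑ c, shearMatrix i ℓ k c * x c = x k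
  simp [shearMatrix_apply_of_ne ℓ h]

theorem matEquiv_shear_apply_self {i : Fin d} (ℓ : {k : Fin d // k ≠ i} → ℤ)
    (x : Eucl d) : matEquiv (shearGL i ℓ) x i = x i + ∑ k, (ℓ k : ℝ) * x k := by
  rw [matEquiv_apply]
  change ∑ c, shearMatrix i ℓ i c * x c = _
  rw [Fintype.sum_eq_add_sum_subtype_ne _ i]
  congr 1
  · simp [shearMatrix]
  · refine Finset.sum_congr rfl fun k _ => ?_
    have hk : i ≠ k := fun h => k.2 h.symm
    simp [shearMatrix, hk, k.2]

/-- The coordinates in which the axis `i` is split off. -/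
def splitAxis (i : Fin d) : Eucl d ≃ᵐ ℝ × ({k : Fin d // k ≠ i} → ℝ) :=
  (MeasurableEquiv.toLp 2 (Fin d → ℝ)).symm.trans
    ((MeasurableEquiv.piEquivPiSubtypeProd (fun _ : Fin d => ℝ) (fun k => k = i)).trans
      ((MeasurableEquiv.funUnique {k : Fin d // k = i} ℝ).prodCongr (MeasurableEquiv.refl _)))

theorem splitAxis_fst (i : Fin d) (x : Eucl d) : (splitAxis i x).1 = x i := rfl

theorem splitAxis_snd (i : Fin d) (x : Eucl d) (k : {k : Fin d // k ≠ i}) :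
    (splitAxis i x).2 k = x k := rfl

theorem splitAxis_sub (i : Fin d) (x y : Eucl d) :
    splitAxis i (x - y) = splitAxis i x - splitAxis i y := rfl

theorem measurePreserving_splitAxis (i : Fin d) :
    MeasurePreserving (splitAxis i) volume volume := by
  have h1 := EuclideanSpace.volume_preserving_symm_measurableEquiv_toLp (Fin d)
  have h2 : MeasurePreserving (MeasurableEquiv.piEquivPiSubtypeProd (fun _ : Fin d => ℝ)
      (fun k => k = i)) volume (volume.prod volume) := by
    convert volume_preserving_piEquivPiSubtypeProd (fun _ : Fin d => ℝ) (fun k => k = i)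
    · rfl
    · rw [Measure.volume_eq_prod]
      congr!
  have h0 : MeasurePreserving (MeasurableEquiv.funUnique {k : Fin d // k = i} ℝ) volume volume := by
    convert volume_preserving_funUnique {k : Fin d // k = i} ℝ
  have h3 := h0.prod (MeasurePreserving.id (volume : Measure ({k : Fin d // ¬k = i} → ℝ)))
  exact h3.comp (h2.comp h1)

theorem lintegral_comp_splitAxis (i : Fin d) (F : ℝ × ({k : Fin d // k ≠ i} → ℝ) → ℝ≥0∞) :
    ∫⁻ x, F (splitAxis i x) = ∫⁻ z, F z :=
  ((measurePreserving_splitAxis i).lintegral_map_equiv F _).symm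

theorem jap_rpow_neg_le_of_norm_le {E F : Type*} [NormedAddCommGroup E] [NormedAddCommGroup F]
    {x : E} {y : F} (h : ‖x‖ ≤ ‖y‖) {L : ℝ} (hL : 0 ≤ L) : jap y ^ (-L) ≤ jap x ^ (-L) := by
  rw [ENNReal.rpow_neg, ENNReal.rpow_neg]
  exact ENNReal.inv_le_inv.2 (ENNReal.rpow_le_rpow (jap_mono h) hL)

theorem abs_apply_le_norm (x : Eucl d) (k : Fin d) : |x k| ≤ ‖x‖ := by
  simpa using PiLp.norm_apply_le x k

theorem norm_splitAxis_snd_le (i : Fin d) (x : Eucl d) : ‖(splitAxis i x).2‖ ≤ ‖x‖ :=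
  (pi_norm_le_iff_of_nonneg (norm_nonneg x)).2 fun k => by
    rw [splitAxis_snd, Real.norm_eq_abs]; exact abs_apply_le_norm x k

/-- The decay of the weight of an index is at least that of the slab kernel. -/
theorem jap_index_le_slabKernel (t : ShearIndex d) {Λ : ℝ} (hΛ : (d : ℝ) + 10 ≤ Λ) (x : Eucl d) :
    jap (matEquiv (indexGL t)⁻¹ x) ^ (-Λ) ≤
      slabKernel (fun k => (t.2.2.1 k : ℝ)) (splitAxis t.1 (matEquiv (anisoGL t.1 ^ t.2.1) x)) := by
  obtain ⟨i, j, ℓ, hℓ⟩ := t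
  simp only
  rw [indexGL_inv, matEquiv_mul_apply]
  simp only
  set z := matEquiv (anisoGL i ^ j) x with hz
  set y := matEquiv (shearGL i ℓ) z with hy
  have hcard : (Fintype.card {k : Fin d // k ≠ i} : ℝ) + 1 = d := by
    have h1 : Fintype.card {k : Fin d // k ≠ i} = Fintype.card (Fin d) - 1 := by
      simp
    have hd : 0 < d := i.pos
    rw [h1, Fintype.card_fin, Nat.cast_sub hd]; simp
  have hy1 : (splitAxis i z).1 + (fun k => (ℓ k : ℝ)) ⬝ᵥ (splitAxis i z).2 = (splitAxis i y).1 := by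
    rw [splitAxis_fst, splitAxis_fst, hy, matEquiv_shear_apply_self]
    rfl
  have hy2 : (splitAxis i z).2 = (splitAxis i y).2 := by
    ext k
    rw [splitAxis_snd, splitAxis_snd, hy, matEquiv_shear_apply_of_ne ℓ k.2]
  rw [slabKernel, hy1, hy2]
  -- As `d + 10 = 8 + ((d - 1) + 3)`, the decay can be shared between the sheared coordinate and the
  -- transversal ones.
  have e : -Λ ≤ -(8 : ℝ) + -((Fintype.card {k : Fin d // k ≠ i} : ℝ) + 3) := by linarith
  calc jap y ^ (-Λ) ≤ jap y ^ (-(8 : ℝ) + -((Fintype.card {k : Fin d // k ≠ i} : ℝ) + 3)) :=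
        ENNReal.rpow_le_rpow_of_exponent_le (one_le_jap y) e
    _ = jap y ^ (-(8 : ℝ)) * jap y ^ (-((Fintype.card {k : Fin d // k ≠ i} : ℝ) + 3)) :=
        ENNReal.rpow_add _ _ (jap_ne_zero _) (jap_ne_top _)
    _ ≤ _ := by
        refine mul_le_mul' (jap_rpow_neg_le_of_norm_le ?_ (by norm_num))
          (jap_rpow_neg_le_of_norm_le (norm_splitAxis_snd_le i y) (by positivity))
        rw [splitAxis_fst, Real.norm_eq_abs]
        exact abs_apply_le_norm y i

theorem det_shearGL (i : Fin d) (ℓ : {k : Fin d // k ≠ i} → ℤ) :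
    ((shearGL i ℓ : GL (Fin d) ℝ) : Matrix (Fin d) (Fin d) ℝ).det = 1 := by
  have h : ((shearGL i ℓ : GL (Fin d) ℝ) : Matrix (Fin d) (Fin d) ℝ) =
      1 + Matrix.replicateCol Unit (Pi.single i (1 : ℝ)) * Matrix.replicateRow Unit
        (fun c => if h : c ≠ i then (ℓ ⟨c, h⟩ : ℝ) else 0) := by
    ext r c
    change shearMatrix i ℓ r c = _
    rw [Matrix.add_apply, Matrix.mul_apply]
    by_cases hr : r = i
    · subst hr
      by_cases hc : r = c
      · subst hc; simp [shearMatrix]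
      · simp [shearMatrix, hc]
    · simp [shearMatrix, hr, Matrix.one_apply]
  rw [h, Matrix.det_one_add_replicateCol_mul_replicateRow]
  simp

theorem invDet_indexGL (t : ShearIndex d) : invDet (indexGL t) = invDet (anisoGL t.1 ^ t.2.1)⁻¹ := by
  have h1 : invDet (shearGL t.1 t.2.2.1) = 1 := by simp [invDet, det_shearGL]
  have h2 := invDet_inv_mul (shearGL t.1 t.2.2.1)
  rw [h1, mul_one] at h2
  rw [indexGL, invDet_mul, h2, mul_one]

/-- After the dilation by `A^j` all cells of scale `j` in one cone become slabs of unit thickness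
that differ only in their slope `ℓ`. The determinant cancels against the normalization of the mean.
-/
theorem matMean_index_le_slabConv (t : ShearIndex d) {Λ : ℝ} (hΛ : (d : ℝ) + 10 ≤ Λ)
    {H : Eucl d → ℝ≥0∞} (x : Eucl d) :
    matMean (indexGL t) Λ H x ≤
      slabConv (fun z => H (matEquiv (anisoGL t.1 ^ t.2.1)⁻¹ ((splitAxis t.1).symm z)))
        (fun k => (t.2.2.1 k : ℝ)) (splitAxis t.1 (matEquiv (anisoGL t.1 ^ t.2.1) x)) := by
  set A := anisoGL t.1 ^ t.2.1 with hA
  set m : {k : Fin d // k ≠ t.1} → ℝ := fun k => (t.2.2.1 k : ℝ) with hm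
  have hcv := lintegral_comp_matEquiv A fun z => H (matEquiv A⁻¹ z) *
    slabKernel m (splitAxis t.1 (matEquiv A x) - splitAxis t.1 z)
  calc matMean (indexGL t) Λ H x
      ≤ ∫⁻ y, invDet A⁻¹ * (H (matEquiv A⁻¹ (matEquiv A y)) *
          slabKernel m (splitAxis t.1 (matEquiv A x) - splitAxis t.1 (matEquiv A y))) := by
        refine lintegral_mono fun y => ?_
        rw [matEquiv_inv_matEquiv, invDet_indexGL, mul_left_comm, ← splitAxis_sub, ← map_sub]
        gcongr
        exact jap_index_le_slabKernel t hΛ (x - y)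
    _ = invDet A⁻¹ * (invDet A * ∫⁻ z, H (matEquiv A⁻¹ z) *
          slabKernel m (splitAxis t.1 (matEquiv A x) - splitAxis t.1 z)) := by
        rw [lintegral_const_mul' _ _ (invDet_ne_top _), ← hcv]
    _ = ∫⁻ z, H (matEquiv A⁻¹ z) *
          slabKernel m (splitAxis t.1 (matEquiv A x) - splitAxis t.1 z) := by
        rw [← mul_assoc, invDet_inv_mul, one_mul]
    _ = _ := by
        rw [slabConv, ← lintegral_comp_splitAxis t.1]
        simp only [MeasurableEquiv.symm_apply_apply]

theorem slopeSize_shear_le {i : Fin d} {j : ℕ} (ℓ ℓ' : ShearParam i j) :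
    slopeSize ((fun k => (ℓ.1 k : ℝ)) - fun k => (ℓ'.1 k : ℝ)) ≤ 2 * d * 2 ^ j := by
  have hk : ∀ k, |((fun k => (ℓ.1 k : ℝ)) - fun k => (ℓ'.1 k : ℝ)) k| ≤ 2 * 2 ^ j := by
    intro k
    have h1 : |(ℓ.1 k : ℝ)| ≤ 2 ^ j := by exact_mod_cast ℓ.2 k
    have h2 : |(ℓ'.1 k : ℝ)| ≤ 2 ^ j := by exact_mod_cast ℓ'.2 k
    rw [Pi.sub_apply]
    linarith [abs_sub (ℓ.1 k : ℝ) (ℓ'.1 k)]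
  refine (Finset.sum_le_card_nsmul _ _ _ fun k _ => hk k).trans ?_
  have hc : Fintype.card {k : Fin d // k ≠ i} ≤ d := by
    simp
  rw [Finset.card_univ, nsmul_eq_mul]
  have : (Fintype.card {k : Fin d // k ≠ i} : ℝ) ≤ d := by exact_mod_cast hc
  nlinarith [pow_pos (two_pos : (0 : ℝ) < 2) j]

instance finite_shearParam (i : Fin d) (j : ℕ) : Finite (ShearParam i j) := by
  have : {ℓ : {k : Fin d // k ≠ i} → ℤ | ∀ k, ℓ k ∈ Set.Icc (-(2 : ℤ) ^ j) (2 ^ j)}.Finite :=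
    Set.Finite.pi' fun _ => Set.finite_Icc _ _
  have h2 : {ℓ : {k : Fin d // k ≠ i} → ℤ | ∀ k, |ℓ k| ≤ 2 ^ j}.Finite :=
    this.subset fun ℓ hℓ k => abs_le.1 (hℓ k)
  exact h2.to_subtype

instance nonempty_shearParam (i : Fin d) (j : ℕ) : Nonempty (ShearParam i j) :=
  ⟨⟨0, fun k => by simp⟩⟩

/-- The maximal function over all shears of one scale. -/
theorem exists_shear_maximal_le (i : Fin d) {ε : ℝ} (hε : 0 < ε) (hε1 : ε ≤ 1) {Λ : ℝ}
    (hΛ : (d : ℝ) + 10 ≤ Λ) : ∃ C : ℝ≥0, ∀ (j : ℕ) (H : Eucl d → ℝ≥0∞), Measurable H →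
      ∫⁻ x, (⨆ ℓ : ShearParam i j, matMean (indexGL ⟨i, j, ℓ⟩) Λ H x) ^ (2 : ℝ) ≤
        C * 2 ^ ((j : ℝ) * ε) * ∫⁻ x, H x ^ (2 : ℝ) := by
  obtain ⟨C, hC⟩ := exists_slab_maximal_le {k : Fin d // k ≠ i} hε hε1
  refine ⟨C * (1 + 2 * d) ^ ε, fun j H hH => ?_⟩
  set A : GL (Fin d) ℝ := anisoGL i ^ j with hA
  set F : ℝ × ({k : Fin d // k ≠ i} → ℝ) → ℝ≥0∞ :=
    fun z => H (matEquiv A⁻¹ ((splitAxis i).symm z)) with hF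
  have hFm : Measurable F := hH.comp
    ((matEquiv A⁻¹).continuous.measurable.comp (splitAxis i).symm.measurable)
  have h1 : ENNReal.ofReal (1 + 2 * d * 2 ^ j) ^ ε ≤
      ((1 + 2 * d : ℝ≥0) ^ ε : ℝ≥0) * 2 ^ ((j : ℝ) * ε) := by
    rw [ENNReal.rpow_mul, ENNReal.coe_rpow_of_nonneg _ hε.le,
      ← ENNReal.mul_rpow_of_nonneg _ _ hε.le]
    refine ENNReal.rpow_le_rpow ?_ hε.le
    rw [ENNReal.rpow_natCast]
    refine ENNReal.ofReal_le_of_le_toReal ?_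
    rw [ENNReal.toReal_mul]
    simp only [ENNReal.toReal_pow, ENNReal.toReal_ofNat, ENNReal.coe_toReal]
    push_cast
    have : (1 : ℝ) ≤ 2 ^ j := one_le_pow₀ (by norm_num)
    nlinarith
  calc ∫⁻ x, (⨆ ℓ : ShearParam i j, matMean (indexGL ⟨i, j, ℓ⟩) Λ H x) ^ (2 : ℝ)
      ≤ ∫⁻ x, (⨆ ℓ : ShearParam i j, slabConv F (fun k => (ℓ.1 k : ℝ))
          (splitAxis i (matEquiv A x))) ^ (2 : ℝ) := by
        refine lintegral_mono fun x => ENNReal.rpow_le_rpow ?_ (by norm_num)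
        exact iSup_mono fun ℓ => matMean_index_le_slabConv ⟨i, j, ℓ⟩ hΛ x
    _ = invDet A * ∫⁻ z, (⨆ ℓ : ShearParam i j, slabConv F (fun k => (ℓ.1 k : ℝ)) z) ^ (2 : ℝ) := by
        rw [lintegral_comp_matEquiv A fun x => (⨆ ℓ : ShearParam i j,
          slabConv F (fun k => (ℓ.1 k : ℝ)) (splitAxis i x)) ^ (2 : ℝ),
          lintegral_comp_splitAxis i fun z => (⨆ ℓ : ShearParam i j,
            slabConv F (fun k => (ℓ.1 k : ℝ)) z) ^ (2 : ℝ)]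
    _ ≤ invDet A * (C * ENNReal.ofReal (1 + 2 * d * 2 ^ j) ^ ε * ∫⁻ z, F z ^ (2 : ℝ)) := by
        refine mul_le_mul_right ?_ _
        exact hC (2 * d * 2 ^ j) (ShearParam i j) (fun ℓ k => (ℓ.1 k : ℝ)) slopeSize_shear_le F hFm
    _ ≤ invDet A * ((C * (1 + 2 * d) ^ ε : ℝ≥0) * 2 ^ ((j : ℝ) * ε) * ∫⁻ z, F z ^ (2 : ℝ)) := by
        refine mul_le_mul_right (mul_le_mul_left ?_ _) _
        rw [ENNReal.coe_mul, mul_assoc (C : ℝ≥0∞)]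
        exact mul_le_mul_right h1 _
    _ = _ := by
        have h2 : ∫⁻ z, F z ^ (2 : ℝ) = invDet A⁻¹ * ∫⁻ x, H x ^ (2 : ℝ) := by
          rw [← lintegral_comp_matEquiv A⁻¹ fun x => H x ^ (2 : ℝ),
            ← lintegral_comp_splitAxis i]
          simp only [hF, MeasurableEquiv.symm_apply_apply]
        rw [h2]
        calc _ = (invDet A * invDet A⁻¹) * ((C * (1 + 2 * d) ^ ε : ℝ≥0) * 2 ^ ((j : ℝ) * ε) *
              ∫⁻ x, H x ^ (2 : ℝ)) := by ring
          _ = _ := by rw [invDet_mul_inv, one_mul]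

end ShearCoordinates

/-! ### Inequalities between `ℓ^p`, `ℓ^q` and `ℓ¹` for finite families. -/

section FiniteFamilies

theorem sum_rpow_le_rpow_sum {ι : Type*} (s : Finset ι) (a : ι → ℝ≥0∞) {t : ℝ} (ht : 1 ≤ t) :
    ∑ k ∈ s, a k ^ t ≤ (∑ k ∈ s, a k) ^ t := by
  classical
  induction s using Finset.induction_on with
  | empty => simp
  | insert k s hk ih =>
    rw [Finset.sum_insert hk, Finset.sum_insert hk]
    exact (add_le_add le_rfl ih).trans (ENNReal.add_rpow_le_rpow_add _ _ ht)

theorem le_lqNorm {ι : Type*} {q : ℝ≥0∞} (hq : 0 < q) (a : ι → ℝ≥0∞) (k : ι) :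
    a k ≤ lqNorm q a := by
  rw [lqNorm]
  split_ifs with h
  · exact le_iSup a k
  · have hq' : 0 < q.toReal := ENNReal.toReal_pos hq.ne' h
    calc a k = (a k ^ q.toReal) ^ (1 / q.toReal) := by
          rw [← ENNReal.rpow_mul, mul_one_div_cancel hq'.ne', ENNReal.rpow_one]
      _ ≤ _ := ENNReal.rpow_le_rpow (ENNReal.le_tsum k) (by positivity)

variable {ι : Type*} [Fintype ι]

/-- For `p ≤ q` this is Hölder; for `p ≥ q` it is the inclusion of `ℓ^q` in `ℓ^p`, without loss. The
maximum in the exponent covers both cases, including `q = ∞`. -/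
theorem sum_rpow_le_card_mul_lqNorm {p : ℝ} (hp : 0 < p) {q : ℝ≥0∞} (hq : 0 < q)
    (a : ι → ℝ≥0∞) : ∑ k, a k ^ p ≤
      (Fintype.card ι : ℝ≥0∞) ^ max 0 (1 - p * (1 / q).toReal) * lqNorm q a ^ p := by
  by_cases hqt : q = ⊤
  · subst hqt
    have : max 0 (1 - p * (1 / (⊤ : ℝ≥0∞)).toReal) = 1 := by simp
    rw [this, ENNReal.rpow_one]
    refine (Finset.sum_le_card_nsmul _ _ _ fun k _ =>
      ENNReal.rpow_le_rpow (le_lqNorm hq a k) hp.le).trans_eq ?_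
    rw [nsmul_eq_mul, Finset.card_univ]
  · have hq' : 0 < q.toReal := ENNReal.toReal_pos hq.ne' hqt
    set s := q.toReal with hs
    have hu : (1 / q).toReal = 1 / s := by simp [hs]
    have hl : lqNorm q a ^ p = (∑ k, a k ^ s) ^ (p / s) := by
      rw [lqNorm, if_neg hqt, tsum_fintype, ← ENNReal.rpow_mul, one_div_mul_eq_div]
    rw [hu, hl]
    rcases le_total p s with h | h
    · have h1 : max 0 (1 - p * (1 / s)) = 1 - p / s := by
        rw [mul_one_div, max_eq_right]; rw [sub_nonneg, div_le_one hq']; exact h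
      have h2 := ENNReal.rpow_sum_le_const_mul_sum_rpow Finset.univ (fun k => a k ^ p)
        (p := s / p) (by rw [le_div_iff₀ hp]; linarith)
      have h3 := ENNReal.rpow_le_rpow h2 (div_pos hp hq').le
      rw [h1]
      calc ∑ k, a k ^ p = ((∑ k, a k ^ p) ^ (s / p)) ^ (p / s) := by
            rw [← ENNReal.rpow_mul, div_mul_div_cancel₀ hp.ne', div_self hq'.ne', ENNReal.rpow_one]
        _ ≤ _ := h3
        _ = _ := by
            rw [ENNReal.mul_rpow_of_nonneg _ _ (div_pos hp hq').le, ← ENNReal.rpow_mul,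
              Finset.card_univ]
            congr 2
            · field_simp
            · refine Finset.sum_congr rfl fun k _ => ?_
              rw [← ENNReal.rpow_mul, mul_div_cancel₀ _ hp.ne']
    · have h1 : max 0 (1 - p * (1 / s)) = 0 := by
        rw [mul_one_div, max_eq_left]; rw [sub_nonpos, one_le_div hq']; exact h
      rw [h1, ENNReal.rpow_zero, one_mul]
      refine le_trans (le_of_eq ?_) (sum_rpow_le_rpow_sum Finset.univ (fun k => a k ^ s)
        (t := p / s) (by rw [one_le_div hq']; exact h))
      refine Finset.sum_congr rfl fun k _ => ?_
      rw [← ENNReal.rpow_mul, mul_div_cancel₀ _ hq'.ne']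

/-- Write `a = a^(1-p) a^p` and bound the first factor by the supremum. The right-hand side is
arranged for Hölder with the exponents `1 - p` and `p`, so that both factors are measured by
integrals of `p`-th powers. -/
theorem sum_rpow_le_iSup_rpow_mul {p : ℝ} (hp : 0 < p) (hp1 : p ≤ 1) (a : ι → ℝ≥0∞) :
    (∑ k, a k) ^ p ≤ ((⨆ k, a k) ^ p) ^ (1 - p) * (∑ k, a k ^ p) ^ p := by
  rw [← ENNReal.rpow_mul, mul_comm p, ENNReal.rpow_mul, ← ENNReal.mul_rpow_of_nonneg _ _ hp.le]
  refine ENNReal.rpow_le_rpow ?_ hp.le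
  rw [Finset.mul_sum]
  refine Finset.sum_le_sum fun k _ => ?_
  calc a k = a k ^ (1 - p) * a k ^ p := by
        rw [← ENNReal.rpow_add_of_nonneg _ _ (by linarith) hp.le]; simp
    _ ≤ _ := mul_le_mul_left (ENNReal.rpow_le_rpow (le_iSup a k) (by linarith)) _

theorem measurable_lqNorm {ι α : Type*} [Countable ι] [MeasurableSpace α] (q : ℝ≥0∞)
    {a : ι → α → ℝ≥0∞} (ha : ∀ k, Measurable (a k)) : Measurable fun x => lqNorm q fun k => a k x := by
  unfold lqNorm
  split_ifs
  · exact Measurable.iSup ha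
  · exact (Measurable.tsum fun k => (ha k).pow_const _).pow_const _

end FiniteFamilies

/-! ### From `ℓ^q` to `ℓ¹` over the shears of one scale, in `L^p`. -/

section SingleScale

variable {d : ℕ}

instance fintypeShearParam (i : Fin d) (j : ℕ) : Fintype (ShearParam i j) := Fintype.ofFinite _

theorem card_shearParam_le (i : Fin d) (j : ℕ) :
    Fintype.card (ShearParam i j) ≤ (3 * 2 ^ j) ^ (d - 1) := by
  classical
  let F : ShearParam i j → ({k : Fin d // k ≠ i} → Finset.Icc (-(2 : ℤ) ^ j) (2 ^ j)) :=
    fun ℓ k => ⟨ℓ.1 k, Finset.mem_Icc.2 (abs_le.1 (ℓ.2 k))⟩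
  have hF : Function.Injective F := by
    intro ℓ ℓ' h
    ext k
    exact congrArg Subtype.val (congrFun h k)
  have h1 : Fintype.card {k : Fin d // k ≠ i} = d - 1 := by simp
  have h2 : ((2 : ℤ) ^ j + 1 - -(2 : ℤ) ^ j).toNat ≤ 3 * 2 ^ j := by
    have : (1 : ℤ) ≤ 2 ^ j := one_le_pow₀ (by norm_num)
    rw [Int.toNat_le]; push_cast; linarith
  refine (Fintype.card_le_of_injective F hF).trans ?_
  rw [Fintype.card_fun, h1, Fintype.card_coe, Int.card_Icc]
  exact Nat.pow_le_pow_left h2 _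

theorem card_shearParam_rpow_le (i : Fin d) (j : ℕ) {e : ℝ} (he : 0 ≤ e) :
    (Fintype.card (ShearParam i j) : ℝ≥0∞) ^ e ≤
      ((3 : ℝ≥0) ^ ((d - 1 : ℕ) * e) : ℝ≥0) * 2 ^ ((j : ℝ) * ((d - 1 : ℕ) * e)) := by
  have h : (Fintype.card (ShearParam i j) : ℝ≥0∞) ≤ (3 * 2 ^ j) ^ (d - 1) := by
    exact_mod_cast card_shearParam_le i j
  refine (ENNReal.rpow_le_rpow h he).trans_eq ?_
  rw [← ENNReal.rpow_natCast, ← ENNReal.rpow_mul, ENNReal.mul_rpow_of_nonneg _ _ (by positivity),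
    ← ENNReal.rpow_natCast, ← ENNReal.rpow_mul, ENNReal.coe_rpow_of_nonneg _ (by positivity)]
  simp

/-- The bound of a finite family of means by its `L^p` norm, summed over one scale. -/
theorem exists_sum_lintegral_mean_le (i : Fin d) {p r : ℝ} (hr : 0 < r) (hrp : r ≤ p)
    {Λ : ℝ} (hΛ : (d : ℝ) < Λ) {q : ℝ≥0∞} (hq : 0 < q) :
    ∃ C : ℝ≥0, ∀ (j : ℕ) (g : ShearParam i j → Eucl d → ℝ≥0∞), (∀ ℓ, Measurable (g ℓ)) →
      ∫⁻ x, ∑ ℓ, matMean (indexGL ⟨i, j, ℓ⟩) Λ (fun y => g ℓ y ^ r) x ^ (p / r) ≤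
        C * 2 ^ ((j : ℝ) * ((d - 1 : ℕ) * max 0 (1 - p * (1 / q).toReal))) *
          ∫⁻ x, (lqNorm q fun ℓ => g ℓ x) ^ p := by
  have hp : 0 < p := hr.trans_le hrp
  have hK : ∫⁻ y : Eucl d, jap y ^ (-Λ) ≠ ⊤ := lintegral_jap_ne_top (by simpa using hΛ)
  set K := ∫⁻ y : Eucl d, jap y ^ (-Λ) with hKd
  refine ⟨(K ^ (p / r)).toNNReal * 3 ^ ((d - 1 : ℕ) * max 0 (1 - p * (1 / q).toReal)),
    fun j g hg => ?_⟩
  have hgr : ∀ ℓ, Measurable fun y => g ℓ y ^ r := fun ℓ => (hg ℓ).pow_const _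
  have h1 : ∀ ℓ, ∫⁻ x, matMean (indexGL ⟨i, j, ℓ⟩) Λ (fun y => g ℓ y ^ r) x ^ (p / r) ≤
      K ^ (p / r) * ∫⁻ x, g ℓ x ^ p := by
    intro ℓ
    refine (lintegral_matMean_rpow_le _ Λ (hgr ℓ) (by rw [one_le_div hr]; exact hrp)).trans_eq ?_
    congr 1
    refine lintegral_congr fun x => ?_
    rw [← ENNReal.rpow_mul, mul_div_cancel₀ _ hr.ne']
  have hKt : K ^ (p / r) ≠ ⊤ := ENNReal.rpow_ne_top_of_nonneg (by positivity) hK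
  have hcard : (Fintype.card (ShearParam i j) : ℝ≥0∞) ^ max 0 (1 - p * (1 / q).toReal) ≠ ⊤ :=
    ENNReal.rpow_ne_top_of_nonneg (le_max_left _ _) (ENNReal.natCast_ne_top _)
  calc ∫⁻ x, ∑ ℓ, matMean (indexGL ⟨i, j, ℓ⟩) Λ (fun y => g ℓ y ^ r) x ^ (p / r)
      = ∑ ℓ, ∫⁻ x, matMean (indexGL ⟨i, j, ℓ⟩) Λ (fun y => g ℓ y ^ r) x ^ (p / r) :=
        lintegral_finsetSum _ fun ℓ _ => (measurable_matMean _ Λ (hgr ℓ)).pow_const _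
    _ ≤ ∑ ℓ, K ^ (p / r) * ∫⁻ x, g ℓ x ^ p := Finset.sum_le_sum fun ℓ _ => h1 ℓ
    _ = K ^ (p / r) * ∫⁻ x, ∑ ℓ, g ℓ x ^ p := by
        rw [← Finset.mul_sum, lintegral_finsetSum _ fun ℓ _ => (hg ℓ).pow_const _]
    _ ≤ K ^ (p / r) * ∫⁻ x, (Fintype.card (ShearParam i j) : ℝ≥0∞) ^
          max 0 (1 - p * (1 / q).toReal) * (lqNorm q fun ℓ => g ℓ x) ^ p :=
        mul_le_mul_right (lintegral_mono fun x => sum_rpow_le_card_mul_lqNorm hp hq _) _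
    _ ≤ K ^ (p / r) * ((((3 : ℝ≥0) ^ ((d - 1 : ℕ) * max 0 (1 - p * (1 / q).toReal)) : ℝ≥0) *
          2 ^ ((j : ℝ) * ((d - 1 : ℕ) * max 0 (1 - p * (1 / q).toReal)))) *
            ∫⁻ x, (lqNorm q fun ℓ => g ℓ x) ^ p) := by
        rw [lintegral_const_mul' _ _ hcard]
        exact mul_le_mul_right (mul_le_mul_left (card_shearParam_rpow_le i j (le_max_left _ _)) _) _
    _ = _ := by
        rw [ENNReal.coe_mul, ENNReal.coe_toNNReal hKt]
        ring

/-- With `N` shears, Hölder costs `N^(p-1)`, Young at the exponent `p/r ≥ 1` treats each term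
separately, and the return to the `ℓ^q` norm costs `N^(max(0, 1-p/q))`. -/
theorem exists_single_scale_of_one_le (i : Fin d) {p : ℝ} (hp : 1 ≤ p) {q : ℝ≥0∞} (hq : 0 < q)
    {Λ : ℝ} (hΛ : (d : ℝ) < Λ) {r : ℝ} (hr : 0 < r) (hrp : r ≤ p) (C₁ : ℝ≥0) :
    ∃ C : ℝ≥0, ∀ (j : ℕ) (g b : ShearParam i j → Eucl d → ℝ≥0∞), (∀ ℓ, Measurable (g ℓ)) →
      (∀ ℓ x, b ℓ x = (C₁ * matMean (indexGL ⟨i, j, ℓ⟩) Λ (fun y => g ℓ y ^ r) x) ^ (1 / r)) →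
      ∫⁻ x, (∑ ℓ, b ℓ x) ^ p ≤
        C * 2 ^ ((j : ℝ) * ((d - 1 : ℕ) * (p - 1 + max 0 (1 - p * (1 / q).toReal)))) *
          ∫⁻ x, (lqNorm q fun ℓ => g ℓ x) ^ p := by
  obtain ⟨C, hC⟩ := exists_sum_lintegral_mean_le i hr hrp hΛ hq
  have hp0 : 0 < p := by linarith
  refine ⟨3 ^ ((d - 1 : ℕ) * (p - 1)) * C₁ ^ (p / r) * C, fun j g b hg hb => ?_⟩
  have hbp : ∀ ℓ x, b ℓ x ^ p = (C₁ : ℝ≥0∞) ^ (p / r) *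
      matMean (indexGL ⟨i, j, ℓ⟩) Λ (fun y => g ℓ y ^ r) x ^ (p / r) := by
    intro ℓ x
    rw [hb, ← ENNReal.rpow_mul, ← ENNReal.mul_rpow_of_nonneg _ _ (by positivity), one_div_mul_eq_div]
  have hN : (Fintype.card (ShearParam i j) : ℝ≥0∞) ^ (p - 1) ≠ ⊤ :=
    ENNReal.rpow_ne_top_of_nonneg (by linarith) (ENNReal.natCast_ne_top _)
  have hCt : (C₁ : ℝ≥0∞) ^ (p / r) ≠ ⊤ :=
    ENNReal.rpow_ne_top_of_nonneg (by positivity) ENNReal.coe_ne_top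
  calc ∫⁻ x, (∑ ℓ, b ℓ x) ^ p
      ≤ ∫⁻ x, (Fintype.card (ShearParam i j) : ℝ≥0∞) ^ (p - 1) * ((C₁ : ℝ≥0∞) ^ (p / r) *
          ∑ ℓ, matMean (indexGL ⟨i, j, ℓ⟩) Λ (fun y => g ℓ y ^ r) x ^ (p / r)) := by
        refine lintegral_mono fun x => ?_
        refine (ENNReal.rpow_sum_le_const_mul_sum_rpow Finset.univ (fun ℓ => b ℓ x) hp).trans_eq ?_
        simp only [hbp, Finset.card_univ, Finset.mul_sum]
    _ = (Fintype.card (ShearParam i j) : ℝ≥0∞) ^ (p - 1) * ((C₁ : ℝ≥0∞) ^ (p / r) *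
          ∫⁻ x, ∑ ℓ, matMean (indexGL ⟨i, j, ℓ⟩) Λ (fun y => g ℓ y ^ r) x ^ (p / r)) := by
        rw [lintegral_const_mul' _ _ hN, lintegral_const_mul' _ _ hCt]
    _ ≤ (((3 : ℝ≥0) ^ ((d - 1 : ℕ) * (p - 1)) : ℝ≥0) * 2 ^ ((j : ℝ) * ((d - 1 : ℕ) * (p - 1)))) *
          ((C₁ : ℝ≥0∞) ^ (p / r) *
          (C * 2 ^ ((j : ℝ) * ((d - 1 : ℕ) * max 0 (1 - p * (1 / q).toReal))) *
          ∫⁻ x, (lqNorm q fun ℓ => g ℓ x) ^ p)) :=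
        mul_le_mul' (card_shearParam_rpow_le i j (by linarith)) (mul_le_mul_right (hC j g hg) _)
    _ = _ := by
        rw [mul_add ((d - 1 : ℕ) : ℝ), mul_add (j : ℝ), ENNReal.rpow_add _ _ (by norm_num) (by norm_num),
          ENNReal.coe_mul, ENNReal.coe_mul, ENNReal.coe_rpow_of_nonneg C₁ (by positivity)]
        ring

/-- The choice `r = p/2` turns `p`-th powers of the `b ℓ` into squares of means, so the supremum is
governed by the `L²` slab maximal theorem at the cost `2^(jε)`. The loss from the cardinality enters
only through `∑ b^p`, hence raised to the small power `p`. -/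
theorem exists_single_scale_of_lt_one (i : Fin d) {p : ℝ} (hp : 0 < p) (hp1 : p < 1) {q : ℝ≥0∞}
    (hq : 0 < q) {Λ : ℝ} (hΛ : (d : ℝ) + 10 ≤ Λ) {ε : ℝ} (hε : 0 < ε) (hε1 : ε ≤ 1) (C₁ : ℝ≥0) :
    ∃ C : ℝ≥0, ∀ (j : ℕ) (g b : ShearParam i j → Eucl d → ℝ≥0∞), (∀ ℓ, Measurable (g ℓ)) →
      (∀ ℓ x, b ℓ x = (C₁ * matMean (indexGL ⟨i, j, ℓ⟩) Λ (fun y => g ℓ y ^ (p / 2)) x) ^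
        (1 / (p / 2))) →
      ∫⁻ x, (∑ ℓ, b ℓ x) ^ p ≤
        C * 2 ^ ((j : ℝ) * (ε * (1 - p) + (d - 1 : ℕ) * (p * max 0 (1 - p * (1 / q).toReal)))) *
          ∫⁻ x, (lqNorm q fun ℓ => g ℓ x) ^ p := by
  obtain ⟨C, hC⟩ := exists_sum_lintegral_mean_le i (half_pos hp) (half_le_self hp.le)
    (by linarith : (d : ℝ) < Λ) hq
  obtain ⟨C', hC'⟩ := exists_shear_maximal_le i hε hε1 hΛ
  refine ⟨(C₁ ^ (2 : ℝ) * C') ^ (1 - p) * (C₁ ^ (2 : ℝ) * C) ^ p, fun j g b hg hb => ?_⟩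
  have hp2 : p / (p / 2) = 2 := by field_simp
  rw [hp2] at hC
  have hbp : ∀ ℓ x, b ℓ x ^ p = (C₁ : ℝ≥0∞) ^ (2 : ℝ) *
      matMean (indexGL ⟨i, j, ℓ⟩) Λ (fun y => g ℓ y ^ (p / 2)) x ^ (2 : ℝ) := by
    intro ℓ x
    rw [hb, ← ENNReal.rpow_mul, ← ENNReal.mul_rpow_of_nonneg _ _ (by positivity), one_div_mul_eq_div,
      hp2]
  have hgr : ∀ ℓ, Measurable fun y => g ℓ y ^ (p / 2) := fun ℓ => (hg ℓ).pow_const _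
  have hbm : ∀ ℓ, Measurable (b ℓ) := by
    intro ℓ
    rw [show b ℓ = _ from funext (hb ℓ)]
    exact (measurable_const.mul (measurable_matMean _ Λ (hgr ℓ))).pow_const _
  have hCt : (C₁ : ℝ≥0∞) ^ (2 : ℝ) ≠ ⊤ := ENNReal.rpow_ne_top_of_nonneg (by norm_num) ENNReal.coe_ne_top
  set X := ∫⁻ x, (lqNorm q fun ℓ => g ℓ x) ^ p with hX
  set G : Eucl d → ℝ≥0∞ := fun y => (lqNorm q fun ℓ => g ℓ y) ^ (p / 2) with hG
  have hGm : Measurable G := (measurable_lqNorm q hg).pow_const _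
  -- Every `g ℓ` is dominated by the `ℓ^q` norm, so the supremum is taken over averages of the
  -- single function `G`.
  have hS : ∫⁻ x, (⨆ ℓ, b ℓ x) ^ p ≤ (C₁ : ℝ≥0∞) ^ (2 : ℝ) * (C' * 2 ^ ((j : ℝ) * ε) * X) := by
    calc ∫⁻ x, (⨆ ℓ, b ℓ x) ^ p
        ≤ ∫⁻ x, (C₁ : ℝ≥0∞) ^ (2 : ℝ) *
            (⨆ ℓ : ShearParam i j, matMean (indexGL ⟨i, j, ℓ⟩) Λ G x) ^ (2 : ℝ) := by
          refine lintegral_mono fun x => ?_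
          obtain ⟨ℓ, hℓ⟩ := exists_eq_ciSup_of_finite (f := fun ℓ => b ℓ x)
          rw [← hℓ, hbp]
          refine mul_le_mul_right (ENNReal.rpow_le_rpow ?_ (by norm_num)) _
          refine le_trans (matMean_mono _ Λ (fun y => ?_) x)
            (le_iSup (fun ℓ : ShearParam i j => matMean (indexGL ⟨i, j, ℓ⟩) Λ G x) ℓ)
          exact ENNReal.rpow_le_rpow (le_lqNorm hq (fun ℓ => g ℓ y) ℓ) (by positivity)
      _ = (C₁ : ℝ≥0∞) ^ (2 : ℝ) * ∫⁻ x,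
            (⨆ ℓ : ShearParam i j, matMean (indexGL ⟨i, j, ℓ⟩) Λ G x) ^ (2 : ℝ) :=
          lintegral_const_mul' _ _ hCt
      _ ≤ (C₁ : ℝ≥0∞) ^ (2 : ℝ) * (C' * 2 ^ ((j : ℝ) * ε) * ∫⁻ x, G x ^ (2 : ℝ)) :=
          mul_le_mul_right (hC' j G hGm) _
      _ = _ := by
          congr 2
          refine lintegral_congr fun x => ?_
          rw [hG, ← ENNReal.rpow_mul, div_mul_cancel₀ _ two_ne_zero]
  have hT : ∫⁻ x, ∑ ℓ, b ℓ x ^ p ≤ (C₁ : ℝ≥0∞) ^ (2 : ℝ) *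
      (C * 2 ^ ((j : ℝ) * ((d - 1 : ℕ) * max 0 (1 - p * (1 / q).toReal))) * X) := by
    simp only [hbp, ← Finset.mul_sum]
    rw [lintegral_const_mul' _ _ hCt]
    exact mul_le_mul_right (hC j g hg) _
  calc ∫⁻ x, (∑ ℓ, b ℓ x) ^ p
      ≤ ∫⁻ x, ((⨆ ℓ, b ℓ x) ^ p) ^ (1 - p) * (∑ ℓ, b ℓ x ^ p) ^ p :=
        lintegral_mono fun x => sum_rpow_le_iSup_rpow_mul hp hp1.le _
    _ ≤ (∫⁻ x, (⨆ ℓ, b ℓ x) ^ p) ^ (1 - p) * (∫⁻ x, ∑ ℓ, b ℓ x ^ p) ^ p := by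
        refine ENNReal.lintegral_mul_norm_pow_le ?_ ?_ (by linarith) hp.le (by ring)
        · exact ((Measurable.iSup hbm).pow_const _).aemeasurable
        · exact (Finset.measurable_fun_sum _ fun ℓ _ => (hbm ℓ).pow_const _).aemeasurable
    _ ≤ ((C₁ : ℝ≥0∞) ^ (2 : ℝ) * (C' * 2 ^ ((j : ℝ) * ε) * X)) ^ (1 - p) *
        ((C₁ : ℝ≥0∞) ^ (2 : ℝ) *
          (C * 2 ^ ((j : ℝ) * ((d - 1 : ℕ) * max 0 (1 - p * (1 / q).toReal))) * X)) ^ p :=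
        mul_le_mul' (ENNReal.rpow_le_rpow hS (by linarith)) (ENNReal.rpow_le_rpow hT hp.le)
    _ = _ := by
        have h1p : 0 ≤ 1 - p := by linarith
        have hXX : X ^ (1 - p) * X ^ p = X := by
          rw [← ENNReal.rpow_add_of_nonneg _ _ h1p hp.le]; simp
        simp only [← mul_assoc]
        rw [ENNReal.mul_rpow_of_nonneg _ X h1p, ENNReal.mul_rpow_of_nonneg _ X hp.le,
          ENNReal.mul_rpow_of_nonneg _ (2 ^ _) h1p, ENNReal.mul_rpow_of_nonneg _ (2 ^ _) hp.le,
          ENNReal.coe_mul, ENNReal.coe_rpow_of_nonneg _ h1p, ENNReal.coe_rpow_of_nonneg _ hp.le,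
          ENNReal.coe_mul, ENNReal.coe_mul, ENNReal.coe_rpow_of_nonneg C₁ (by norm_num),
          mul_add (j : ℝ), ENNReal.rpow_add _ _ (by norm_num) (by norm_num),
          ← ENNReal.rpow_mul, ← ENNReal.rpow_mul]
        conv_rhs => rw [← hXX]
        rw [show (j : ℝ) * ε * (1 - p) = j * (ε * (1 - p)) by ring,
          show (j : ℝ) * ((d - 1 : ℕ) : ℝ) * max 0 (1 - p * (1 / q).toReal) * p =
            j * ((d - 1 : ℕ) * p * max 0 (1 - p * (1 / q).toReal)) by ring]
        ring

/-- The loss in passing from the `ℓ^q` sum to the `ℓ¹` sum of Peetre-type quantities over all shears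
of one scale is strictly smaller than the number of shears to the power `1 + (1 - 1/q)₊`. -/
theorem exists_single_scale_le (hd : 2 ≤ d) (i : Fin d) {p : ℝ} (hp : 0 < p) {q : ℝ≥0∞}
    (hq : 0 < q) {Λ : ℝ} (hΛ : (d : ℝ) + 10 ≤ Λ) :
    ∃ τ < p * ((d - 1) * (1 + max 0 (1 - (1 / q).toReal))), ∀ C₁ : ℝ≥0, ∃ C : ℝ≥0,
      ∀ (j : ℕ) (g a : ShearParam i j → Eucl d → ℝ≥0∞), (∀ ℓ, Measurable (g ℓ)) →
      (∀ ℓ x, a ℓ x ^ (min 1 p / 2) ≤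
        C₁ * matMean (indexGL ⟨i, j, ℓ⟩) Λ (fun y => g ℓ y ^ (min 1 p / 2)) x) →
      ∫⁻ x, (∑ ℓ, a ℓ x) ^ p ≤
        C * 2 ^ ((j : ℝ) * τ) * ∫⁻ x, (lqNorm q fun ℓ => g ℓ x) ^ p := by
  set u := (1 / q).toReal with hu
  have hu0 : 0 ≤ u := ENNReal.toReal_nonneg
  have hd' : ((d - 1 : ℕ) : ℝ) = d - 1 := by rw [Nat.cast_sub (by omega)]; simp
  have hd1 : (1 : ℝ) ≤ d - 1 := by
    have : (2 : ℝ) ≤ d := by exact_mod_cast hd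
    linarith
  set r := min 1 p / 2 with hr
  have hr0 : 0 < r := by positivity
  have red : ∀ (C₁ : ℝ≥0) (j : ℕ) (g a : ShearParam i j → Eucl d → ℝ≥0∞),
      (∀ ℓ x, a ℓ x ^ r ≤ C₁ * matMean (indexGL ⟨i, j, ℓ⟩) Λ (fun y => g ℓ y ^ r) x) →
      ∫⁻ x, (∑ ℓ, a ℓ x) ^ p ≤ ∫⁻ x, (∑ ℓ, (C₁ * matMean (indexGL ⟨i, j, ℓ⟩) Λ
        (fun y => g ℓ y ^ r) x) ^ (1 / r)) ^ p := by
    intro C₁ j g a ha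
    refine lintegral_mono fun x => ENNReal.rpow_le_rpow (Finset.sum_le_sum fun ℓ _ => ?_) hp.le
    rw [one_div]
    exact (ENNReal.le_rpow_inv_iff hr0).2 (ha ℓ x)
  -- Here `u = 1/q`: for `u = 0` this is `1 < 2`, and for `u > 0` the left side is below `1`. The
  -- strict gap is the room for `ε` when `p < 1`.
  have hm : max 0 (1 - p * u) < 1 + max 0 (1 - u) := by
    rcases hu0.eq_or_lt with h | h
    · rw [← h]; norm_num
    · exact (max_lt one_pos (by nlinarith)).trans_le (by linarith [le_max_left 0 (1 - u)])
  rcases le_or_gt 1 p with h1 | h1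
  · refine ⟨(d - 1 : ℕ) * (p - 1 + max 0 (1 - p * u)), ?_, fun C₁ => ?_⟩
    · rw [hd', mul_left_comm]
      refine mul_lt_mul_of_pos_left ?_ (by linarith)
      have : p - 1 + max 0 (1 - p * u) ≤ max (p - 1) (p * (1 - u)) := by
        rcases le_total 0 (1 - p * u) with h | h
        · rw [max_eq_right h]; exact le_max_of_le_right (by linarith)
        · rw [max_eq_left h]; exact le_max_of_le_left (by linarith)
      refine this.trans_lt (max_lt ?_ ?_)
      · nlinarith [le_max_left 0 (1 - u)]
      · nlinarith [le_max_right 0 (1 - u)]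
    · have hrp : r ≤ p := by rw [hr, min_eq_left h1]; linarith
      obtain ⟨C, hC⟩ := exists_single_scale_of_one_le i h1 hq (by linarith : (d : ℝ) < Λ) hr0 hrp C₁
      exact ⟨C, fun j g a hg ha => (red C₁ j g a ha).trans (hC j g _ hg fun ℓ x => rfl)⟩
  · have hrp : r = p / 2 := by rw [hr, min_eq_right h1.le]
    set Δ := p * ((d - 1) * (1 + max 0 (1 - u))) - p * ((d - 1) * max 0 (1 - p * u)) with hΔ
    have hΔ0 : 0 < Δ := by
      rw [hΔ, sub_pos]
      exact mul_lt_mul_of_pos_left (mul_lt_mul_of_pos_left hm (by linarith)) hp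
    -- At most half of the gap `Δ` is spent on the maximal operator, which keeps the exponent
    -- strictly below the allowed one.
    set ε := min 1 (Δ / 2) with hε
    have hε0 : 0 < ε := lt_min one_pos (by linarith)
    refine ⟨ε * (1 - p) + (d - 1 : ℕ) * (p * max 0 (1 - p * u)), ?_, fun C₁ => ?_⟩
    · have h2 : ε ≤ Δ / 2 := min_le_right _ _
      have h3 : ε * (1 - p) < Δ := by nlinarith
      rw [hd']
      linarith
    · obtain ⟨C, hC⟩ := exists_single_scale_of_lt_one i hp h1 hq hΛ hε0 (min_le_left _ _) C₁
      rw [← hrp] at hC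
      exact ⟨C, fun j g a hg ha => (red C₁ j g a ha).trans (hC j g _ hg fun ℓ x => rfl)⟩

end SingleScale

/-! ### Dilations, involution and convolution on the frequency side. -/

section FourierDilation

variable {d : ℕ}

/-- The action of the transposed matrix on the frequency side. -/
def dualPoint (M : GL (Fin d) ℝ) (ξ : Eucl d) : Eucl d :=
  WithLp.toLp 2 ((M : Matrix (Fin d) (Fin d) ℝ).transpose.mulVec ξ.ofLp)

theorem dualPoint_apply (M : GL (Fin d) ℝ) (ξ : Eucl d) (k : Fin d) :
    dualPoint M ξ k = ∑ r, (M : Matrix (Fin d) (Fin d) ℝ) r k * ξ r := rfl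

theorem inner_matEquiv (M : GL (Fin d) ℝ) (x ξ : Eucl d) :
    inner ℝ (matEquiv M x) ξ = inner ℝ x (dualPoint M ξ) := by
  simp only [PiLp.inner_apply, matEquiv_apply, dualPoint_apply, Matrix.mulVec, dotProduct,
    RCLike.inner_apply, conj_trivial, Finset.mul_sum, Finset.sum_mul]
  rw [Finset.sum_comm]
  refine Finset.sum_congr rfl fun a _ => Finset.sum_congr rfl fun b _ => ?_
  ring

theorem dualPoint_mul (M N : GL (Fin d) ℝ) (ξ : Eucl d) :
    dualPoint (M * N) ξ = dualPoint N (dualPoint M ξ) := by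
  refine ext_inner_left ℝ fun x => ?_
  rw [← inner_matEquiv, matEquiv_mul_apply, inner_matEquiv, inner_matEquiv]

theorem dualPoint_one (ξ : Eucl d) : dualPoint 1 ξ = ξ := by
  refine ext_inner_left ℝ fun x => ?_
  rw [← inner_matEquiv, matEquiv_one_apply]

theorem integral_comp_matEquiv (M : GL (Fin d) ℝ) (f : Eucl d → ℂ) :
    |(M : Matrix (Fin d) (Fin d) ℝ).det| • ∫ x, f (matEquiv M x) = ∫ x, f x := by
  have hmap : Measure.map (matEquiv M) (volume : Measure (Eucl d)) = invDet M • volume := by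
    ext s hs
    have h := lintegral_comp_matEquiv M (s.indicator 1)
    rw [lintegral_indicator_one hs] at h
    rw [Measure.map_apply (matEquiv M).continuous.measurable hs, Measure.smul_apply, smul_eq_mul, ← h,
      ← lintegral_indicator_one ((matEquiv M).continuous.measurable hs)]
    rfl
  have h2 := integral_map_equiv (μ := (volume : Measure (Eucl d)))
    (matEquiv M).toHomeomorph.toMeasurableEquiv f
  change ∫ y, f y ∂(Measure.map (matEquiv M) volume) = ∫ x, f (matEquiv M x) at h2
  rw [← h2, hmap, integral_smul_measure, smul_smul, invDet, ENNReal.toReal_ofReal (by positivity),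
    mul_inv_cancel₀ (abs_pos.2 (det_GL_ne_zero M)).ne', one_smul]

theorem fourier_dilate (M : GL (Fin d) ℝ) (ψ : 𝓢(Eucl d, ℂ)) (ξ : Eucl d) :
    (𝓕 (dilate M ψ) : 𝓢(Eucl d, ℂ)) ξ = (𝓕 ψ : 𝓢(Eucl d, ℂ)) (dualPoint M ξ) := by
  rw [SchwartzMap.fourier_coe, SchwartzMap.fourier_coe, Real.fourier_eq', Real.fourier_eq',
    ← integral_comp_matEquiv M, ← integral_smul]
  refine integral_congr_ae (Filter.Eventually.of_forall fun x => ?_)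
  simp only [dilate_apply, matEquiv_inv_matEquiv, inner_matEquiv]
  rw [smul_comm, smul_smul, mul_inv_cancel₀ (abs_pos.2 (det_GL_ne_zero M)).ne', one_smul]

theorem fourier_invol (ψ : 𝓢(Eucl d, ℂ)) (ξ : Eucl d) :
    (𝓕 (invol ψ) : 𝓢(Eucl d, ℂ)) ξ = (starRingEnd ℂ) ((𝓕 ψ : 𝓢(Eucl d, ℂ)) ξ) := by
  rw [SchwartzMap.fourier_coe, SchwartzMap.fourier_coe, Real.fourier_eq', Real.fourier_eq',
    ← integral_conj, ← integral_neg_eq_self]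
  refine integral_congr_ae (Filter.Eventually.of_forall fun x => ?_)
  simp only [invol_apply, neg_neg, smul_eq_mul, map_mul, ← Complex.exp_conj, Complex.conj_I,
    Complex.conj_ofReal, inner_neg_left]
  congr 2
  push_cast
  ring

theorem invol_dilate (M : GL (Fin d) ℝ) (ψ : 𝓢(Eucl d, ℂ)) :
    invol (dilate M ψ) = dilate M (invol ψ) :=
  schwartz_ext_fourier fun ξ => by rw [fourier_invol, fourier_dilate, fourier_dilate, fourier_invol]

theorem dilate_dilate (M N : GL (Fin d) ℝ) (ψ : 𝓢(Eucl d, ℂ)) :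
    dilate M (dilate N ψ) = dilate (M * N) ψ :=
  schwartz_ext_fourier fun ξ => by rw [fourier_dilate, fourier_dilate, fourier_dilate, dualPoint_mul]

theorem dilate_sconv (M : GL (Fin d) ℝ) (κ ψ : 𝓢(Eucl d, ℂ)) :
    dilate M (sconv κ ψ) = sconv (dilate M κ) (dilate M ψ) :=
  schwartz_ext_fourier fun ξ => by
    rw [fourier_dilate, fourier_sconv, fourier_sconv, fourier_dilate, fourier_dilate]

theorem dilate_one (ψ : 𝓢(Eucl d, ℂ)) : dilate 1 ψ = ψ :=
  schwartz_ext_fourier fun ξ => by rw [fourier_dilate, dualPoint_one]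

theorem dilate_inv_dilate (M : GL (Fin d) ℝ) (ψ : 𝓢(Eucl d, ℂ)) :
    dilate M (dilate M⁻¹ ψ) = ψ := by rw [dilate_dilate, mul_inv_cancel, dilate_one]

/-- A dilation preserves the `L¹` norm, and its expansion by at most `K` costs `K^L` in the weight.
-/
theorem kernelNorm_dilate_le {L : ℝ} (hL : 0 ≤ L) (M : GL (Fin d) ℝ) {K : ℝ≥0} (hK : 1 ≤ K)
    (hM : ∀ x, ‖matEquiv M x‖ ≤ K * ‖x‖) (ψ : 𝓢(Eucl d, ℂ)) :
    kernelNorm L (dilate M ψ) ≤ (K ^ L : ℝ≥0) * kernelNorm L ψ := by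
  have h := lintegral_comp_matEquiv M⁻¹ fun z => ‖ψ z‖ₑ * jap (matEquiv M z) ^ L
  have e : kernelNorm L (dilate M ψ) = ∫⁻ z, ‖ψ z‖ₑ * jap (matEquiv M z) ^ L := by
    rw [kernelNorm]
    calc ∫⁻ y, ‖dilate M ψ y‖ₑ * jap y ^ L
        = ∫⁻ y, invDet M * (‖ψ (matEquiv M⁻¹ y)‖ₑ * jap (matEquiv M (matEquiv M⁻¹ y)) ^ L) := by
          refine lintegral_congr fun y => ?_
          rw [matEquiv_matEquiv_inv, dilate_apply, enorm_smul, mul_assoc, invDet,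
            Real.enorm_eq_ofReal (by positivity)]
      _ = _ := by
          rw [lintegral_const_mul' _ _ (invDet_ne_top M), h, ← mul_assoc, invDet_mul_inv, one_mul]
  rw [e, kernelNorm, ← lintegral_const_mul' _ _ ENNReal.coe_ne_top]
  refine lintegral_mono fun z => ?_
  have h1 : jap (matEquiv M z) ≤ K * jap z := by
    rw [jap, jap, ENNReal.coe_nnreal_eq, ← ENNReal.ofReal_mul (by positivity)]
    refine ENNReal.ofReal_le_ofReal ?_
    have : (1 : ℝ) ≤ K := hK
    nlinarith [hM z]
  calc ‖ψ z‖ₑ * jap (matEquiv M z) ^ L ≤ ‖ψ z‖ₑ * (K * jap z) ^ L :=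
        mul_le_mul_right (ENNReal.rpow_le_rpow h1 hL) _
    _ = _ := by
        rw [ENNReal.mul_rpow_of_nonneg _ _ hL, ENNReal.coe_rpow_of_nonneg _ hL]
        ring

theorem norm_le_sum_abs (x : Eucl d) : ‖x‖ ≤ ∑ k, |x k| := by
  rw [EuclideanSpace.norm_eq, Real.sqrt_le_left (Finset.sum_nonneg fun _ _ => abs_nonneg _)]
  simp only [Real.norm_eq_abs]
  exact Finset.sum_sq_le_sq_sum_of_nonneg fun _ _ => abs_nonneg _

theorem norm_le_of_abs_le {x : Eucl d} {b : ℝ} (h : ∀ k, |x k| ≤ b) : ‖x‖ ≤ d * b := by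
  refine (norm_le_sum_abs x).trans ((Finset.sum_le_card_nsmul _ _ _ fun k _ => h k).trans_eq ?_)
  simp

/-- The Schwartz function whose Fourier transform is a given test function. -/
def ofFourier (G : Eucl d → ℂ) (h : HasCompactSupport G) (hs : ContDiff ℝ ∞ G) : 𝓢(Eucl d, ℂ) :=
  𝓕⁻ (h.toSchwartzMap hs)

theorem fourier_ofFourier {G : Eucl d → ℂ} (h : HasCompactSupport G) (hs : ContDiff ℝ ∞ G)
    (ξ : Eucl d) : (𝓕 (ofFourier G h hs) : 𝓢(Eucl d, ℂ)) ξ = G ξ := by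
  rw [ofFourier, FourierTransform.fourier_fourierInv_eq]; rfl

/-- The transform of `θ` is a bump equal to `1` on the support of the transform of `ψ`; this gives
the reproducing formula behind Peetre's inequality. -/
theorem exists_sconv_eq_self {ψ : 𝓢(Eucl d, ℂ)} (h : HasCompactSupport (𝓕 ψ : 𝓢(Eucl d, ℂ))) :
    ∃ θ, sconv θ ψ = ψ := by
  obtain ⟨R, hR⟩ := h.isCompact.isBounded.subset_closedBall (0 : Eucl d)
  set b : ContDiffBump (0 : Eucl d) := ⟨|R| + 1, |R| + 2, by positivity, by linarith⟩ with hb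
  have hs : ContDiff ℝ ∞ fun x => (b x : ℂ) := Complex.ofRealCLM.contDiff.comp b.contDiff
  have hc : HasCompactSupport fun x => (b x : ℂ) := b.hasCompactSupport.comp_left Complex.ofReal_zero
  refine ⟨ofFourier _ hc hs, schwartz_ext_fourier fun ξ => ?_⟩
  rw [fourier_sconv, fourier_ofFourier]
  by_cases hξ : (𝓕 ψ : 𝓢(Eucl d, ℂ)) ξ = 0
  · rw [hξ, mul_zero]
  · have h1 := hR (subset_tsupport _ hξ)
    have h2 : b ξ = 1 := by
      refine b.one_of_mem_closedBall (Metric.closedBall_subset_closedBall ?_ h1)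
      change R ≤ |R| + 1
      linarith [le_abs_self R]
    rw [h2, Complex.ofReal_one, one_mul]

theorem hasCompactSupport_fourier_invol {ψ : 𝓢(Eucl d, ℂ)}
    (h : HasCompactSupport (𝓕 ψ : 𝓢(Eucl d, ℂ))) :
    HasCompactSupport (𝓕 (invol ψ) : 𝓢(Eucl d, ℂ)) := by
  rw [show ((𝓕 (invol ψ) : 𝓢(Eucl d, ℂ)) : Eucl d → ℂ) = fun ξ => (starRingEnd ℂ)
    ((𝓕 ψ : 𝓢(Eucl d, ℂ)) ξ) from funext fun ξ => fourier_invol ψ ξ]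
  exact h.comp_left (map_zero _)

end FourierDilation

/-! ### Frequency supports of the generators and shear coordinates. -/

section GeneratorSupport

variable {d : ℕ}

theorem ShearletSystem.psi1Hat_eq_zero (S : ShearletSystem d) {w : ℝ}
    (h : ¬ (1 / 16 ≤ |w| ∧ |w| ≤ 1 / 2)) : S.psi1Hat w = 0 := by
  by_contra h0
  refine h ?_
  rcases S.psi1Hat_supp (subset_tsupport _ h0) with ⟨h1, h2⟩ | ⟨h1, h2⟩
  · rw [abs_of_neg (by linarith)]; constructor <;> linarith
  · rw [abs_of_pos (by linarith)]; constructor <;> linarith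

theorem ShearletSystem.psi2Hat_eq_zero_of_lt (S : ShearletSystem d) {w : ℝ} (h : 1 < |w|) :
    S.psi2Hat w = 0 := by
  by_contra h0
  have := S.psi2Hat_supp (subset_tsupport _ h0)
  exact absurd (abs_le.2 this) (not_le.2 h)

/-- The support condition gives `|w| > 1`, and continuity adds the end points. The zeros at `±1` are
needed at integer arguments, for instance for `beta_zero`. -/
theorem ShearletSystem.psi2Hat_eq_zero (S : ShearletSystem d) {w : ℝ} (h : 1 ≤ |w|) :
    S.psi2Hat w = 0 := by
  have hcont : Continuous S.psi2Hat := S.psi2Hat_smooth.continuous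
  have hz : IsClosed {w | S.psi2Hat w = 0} := isClosed_eq hcont continuous_const
  have hsub : {w : ℝ | 1 < |w|} ⊆ {w | S.psi2Hat w = 0} := fun w hw => S.psi2Hat_eq_zero_of_lt hw
  have hw : w ≠ 0 := by
    rintro rfl
    norm_num at h
  have hlim : Filter.Tendsto (fun n : ℕ => (1 + 1 / ((n : ℝ) + 1)) * w) Filter.atTop (nhds w) := by
    have := (tendsto_one_div_add_atTop_nhds_zero_nat (𝕜 := ℝ)).const_add 1
    simpa using this.mul_const w
  refine hz.mem_of_tendsto hlim (Filter.Eventually.of_forall fun n => hsub ?_)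
  have hn : 0 < 1 / ((n : ℝ) + 1) := by positivity
  rw [Set.mem_ofPred_eq, abs_mul, abs_of_pos (by linarith)]
  nlinarith

/-- In its own coordinates a shearlet has its frequencies in a fixed compact set, away from `ξ i =
0`. Smoothness of the multipliers and the truncation of their integer parameters rest on this. -/
theorem ShearletSystem.cone_fourier_eq_zero (S : ShearletSystem d) (i : Fin d) {ξ : Eucl d}
    (h : ¬ (1 / 16 ≤ |ξ i| ∧ |ξ i| ≤ 1 / 2 ∧ ∀ k, |ξ k| ≤ |ξ i|)) :
    (𝓕 (S.cone i) : 𝓢(Eucl d, ℂ)) ξ = 0 := by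
  rw [S.cone_fourier]
  by_cases h1 : 1 / 16 ≤ |ξ i| ∧ |ξ i| ≤ 1 / 2
  · have : ∃ k, |ξ i| < |ξ k| := by
      by_contra! h2
      exact h ⟨h1.1, h1.2, h2⟩
    obtain ⟨k, hk⟩ := this
    have hki : k ≠ i := by rintro rfl; exact lt_irrefl _ hk
    rw [Finset.prod_eq_zero (Finset.mem_erase.2 ⟨hki, Finset.mem_univ k⟩), mul_zero]
    refine S.psi2Hat_eq_zero ?_
    rw [abs_div, le_div_iff₀ (by linarith)]
    linarith
  · rw [S.psi1Hat_eq_zero h1, zero_mul]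

theorem ShearletSystem.hasCompactSupport_cone (S : ShearletSystem d) (i : Fin d) :
    HasCompactSupport (𝓕 (S.cone i) : 𝓢(Eucl d, ℂ)) := by
  refine HasCompactSupport.intro (isCompact_closedBall (0 : Eucl d) (d * (1 / 2))) fun ξ hξ => ?_
  refine S.cone_fourier_eq_zero i fun h => hξ ?_
  rw [mem_closedBall_zero_iff]
  exact norm_le_of_abs_le fun k => (h.2.2 k).trans h.2.1

theorem ShearletSystem.hasCompactSupport_low (S : ShearletSystem d) :
    HasCompactSupport (𝓕 S.low : 𝓢(Eucl d, ℂ)) := by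
  refine HasCompactSupport.intro (isCompact_closedBall (0 : Eucl d) (d * (1 / 4))) fun ξ hξ => ?_
  by_contra h0
  refine hξ ?_
  rw [mem_closedBall_zero_iff]
  exact norm_le_of_abs_le (S.low_supp (subset_tsupport _ h0))

theorem dualPoint_aniso_apply (i : Fin d) (j : ℕ) (ξ : Eucl d) (k : Fin d) :
    dualPoint (anisoGL i ^ j) ξ k = (if k = i then (4 : ℝ) ^ j else 2 ^ j) * ξ k := by
  rw [dualPoint_apply, anisoGL_pow_val]
  simp [Matrix.diagonal_apply]

theorem dualPoint_shear_apply_self {i : Fin d} (ℓ : {k : Fin d // k ≠ i} → ℤ) (ξ : Eucl d) :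
    dualPoint (shearGL i ℓ) ξ i = ξ i := by
  rw [dualPoint_apply]
  change ∑ r, shearMatrix i ℓ r i * ξ r = ξ i
  rw [Finset.sum_eq_single i]
  · simp [shearMatrix]
  · intro r _ hr
    simp [shearMatrix_apply_of_ne ℓ hr, hr]
  · simp

theorem dualPoint_shear_apply_of_ne {i : Fin d} (ℓ : {k : Fin d // k ≠ i} → ℤ) (ξ : Eucl d)
    (k : {k : Fin d // k ≠ i}) : dualPoint (shearGL i ℓ) ξ k = ξ k + ℓ k * ξ i := by
  rw [dualPoint_apply]
  change ∑ r, shearMatrix i ℓ r k * ξ r = _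
  rw [Fintype.sum_eq_add_sum_subtype_ne _ i, add_comm]
  congr 1
  · rw [Finset.sum_eq_single k]
    · simp [shearMatrix]
    · intro r _ hr
      have : (r : Fin d) ≠ k := fun h => hr (Subtype.ext h)
      simp [shearMatrix_apply_of_ne ℓ r.2, this]
    · simp
  · have hk : i ≠ k := fun h => k.2 h.symm
    simp [shearMatrix, hk, k.2]

theorem dualPoint_inv_dualPoint (M : GL (Fin d) ℝ) (ξ : Eucl d) :
    dualPoint M⁻¹ (dualPoint M ξ) = ξ := by
  rw [← dualPoint_mul, mul_inv_cancel, dualPoint_one]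

theorem apply_eq_dualPoint_index_self (t : ShearIndex d) (ξ : Eucl d) :
    ξ t.1 = 4 ^ t.2.1 * dualPoint (indexGL t) ξ t.1 := by
  conv_lhs => rw [← dualPoint_inv_dualPoint (indexGL t) ξ, indexGL_inv, dualPoint_mul,
    dualPoint_aniso_apply, if_pos rfl, dualPoint_shear_apply_self]

theorem apply_eq_dualPoint_index_of_ne (t : ShearIndex d) (ξ : Eucl d)
    (k : {k : Fin d // k ≠ t.1}) : ξ k = 2 ^ t.2.1 *
      (dualPoint (indexGL t) ξ k + t.2.2.1 k * dualPoint (indexGL t) ξ t.1) := by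
  conv_lhs => rw [← dualPoint_inv_dualPoint (indexGL t) ξ, indexGL_inv, dualPoint_mul,
    dualPoint_aniso_apply, if_neg k.2, dualPoint_shear_apply_of_ne]

end GeneratorSupport

/-! ### Smooth cutoffs on the line. -/

section SmoothCutoffs

/-- A smooth function on the line which is equal to `1 / y` for `y ≥ 1 / 2`. -/
def recipCutoff (y : ℝ) : ℝ := Real.smoothTransition (4 * y - 1) / y

theorem recipCutoff_mul_self {y : ℝ} (hy : 1 / 2 ≤ y) : recipCutoff y * y = 1 := by
  have hy0 : y ≠ 0 := by linarith
  rw [recipCutoff, div_mul_cancel₀ _ hy0]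
  exact Real.smoothTransition.one_of_one_le (by linarith)

theorem contDiff_recipCutoff : ContDiff ℝ ∞ recipCutoff := by
  refine contDiff_iff_contDiffAt.2 fun y => ?_
  by_cases hy : y = 0
  · refine (contDiffAt_const (c := (0 : ℝ))).congr_of_eventuallyEq ?_
    have : ∀ᶠ z in nhds y, z < 1 / 4 := by
      rw [hy]; exact Iio_mem_nhds (by norm_num)
    filter_upwards [this] with z hz
    rw [recipCutoff, Real.smoothTransition.zero_of_nonpos (by linarith), zero_div]
  · unfold recipCutoff
    refine ContDiffAt.div ?_ contDiffAt_id hy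
    exact (Real.smoothTransition.contDiff.comp
      ((contDiff_const.mul contDiff_id).sub contDiff_const)).contDiffAt

/-- A smooth step function, `0` on `u ≤ -1` and `1` on `u ≥ 0`. -/
def smoothStep (u : ℝ) : ℝ := Real.smoothTransition (u + 1)

theorem smoothStep_eq_one {u : ℝ} (h : 0 ≤ u) : smoothStep u = 1 :=
  Real.smoothTransition.one_of_one_le (by linarith)

theorem smoothStep_eq_zero {u : ℝ} (h : u ≤ -1) : smoothStep u = 0 :=
  Real.smoothTransition.zero_of_nonpos (by linarith)

theorem smoothStep_nonneg (u : ℝ) : 0 ≤ smoothStep u := Real.smoothTransition.nonneg _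

theorem contDiff_smoothStep : ContDiff ℝ ∞ smoothStep :=
  Real.smoothTransition.contDiff.comp (contDiff_id.add contDiff_const)

end SmoothCutoffs

/-! ### A smooth partition of unity into cones with seams of absolute width. -/

section ConePartition

variable {d : ℕ}

/-- The sign attached to a Boolean. -/
def boolSign (b : Bool) : ℤ := if b then 1 else -1

theorem boolSign_true : boolSign true = 1 := rfl

theorem boolSign_false : boolSign false = -1 := rfl

theorem abs_boolSign (b : Bool) : |(boolSign b : ℝ)| = 1 := by cases b <;> simp [boolSign]

/-- The bump function of the half cone `e`, in terms of the values `v e e'` of the linear forms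
`z_e + z_e'`, where `z_e` is the signed coordinate. -/
def coneBump {E : Type*} [Fintype E] (v : E → E → ℝ) (e : E) : ℝ := ∏ e', smoothStep (v e e')

theorem coneBump_nonneg {E : Type*} [Fintype E] (v : E → E → ℝ) (e : E) : 0 ≤ coneBump v e :=
  Finset.prod_nonneg fun _ _ => smoothStep_nonneg _

/-- The smooth partition of unity subordinate to the cones. -/
def conePart (v : Fin d × Bool → Fin d × Bool → ℝ) (i : Fin d) : ℝ :=
  recipCutoff (∑ e, coneBump v e) * ∑ b, coneBump v (i, b)

/-- The values of the linear forms at `ξ`, on the scale `s`. -/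
def coneForm (s : ℝ) (ξ : Eucl d) (e e' : Fin d × Bool) : ℝ :=
  (boolSign e.2 * ξ e.1 + boolSign e'.2 * ξ e'.1) / s

theorem neg_lt_of_coneBump_ne_zero {E : Type*} [Fintype E] {v : E → E → ℝ} {e : E}
    (h : coneBump v e ≠ 0) (e' : E) : -1 < v e e' := by
  by_contra! h1
  exact h (Finset.prod_eq_zero (Finset.mem_univ e') (smoothStep_eq_zero h1))

/-- The two signs of `ξ k` give the two bounds. The seam has the absolute width `s`; at frequency
`4^μ`, `s` will be a fixed small fraction of `2^μ`, comparable to the spacing of the shears there.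
-/
theorem abs_le_of_conePart_ne_zero {s : ℝ} (hs : 0 < s) {ξ : Eucl d} {i : Fin d}
    (h : conePart (coneForm s ξ) i ≠ 0) (k : Fin d) : |ξ k| ≤ |ξ i| + s := by
  obtain ⟨b, -, hb⟩ := Finset.exists_ne_zero_of_sum_ne_zero (right_ne_zero_of_mul h)
  have key : ∀ τ : Bool, -s < boolSign b * ξ i + boolSign τ * ξ k := fun τ => by
    have := neg_lt_of_coneBump_ne_zero hb (k, τ)
    rwa [coneForm, lt_div_iff₀ hs, neg_one_mul] at this
  have h1 : boolSign b * ξ i ≤ |ξ i| := by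
    refine (le_abs_self _).trans_eq ?_
    rw [abs_mul, abs_boolSign, one_mul]
  have h2 := key true
  have h3 := key false
  rw [boolSign_true] at h2
  rw [boolSign_false] at h3
  push_cast at h2 h3
  rw [abs_le]
  constructor <;> linarith

/-- For the coordinate of largest modulus, with its sign, all linear forms are nonnegative and the
bump equals `1`. The sum thus stays where `recipCutoff` is the exact reciprocal. -/
theorem one_le_sum_coneBump (hd : 0 < d) {s : ℝ} (hs : 0 < s) (ξ : Eucl d) :
    1 ≤ ∑ e, coneBump (coneForm s ξ) e := by
  have : Nonempty (Fin d) := ⟨⟨0, hd⟩⟩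
  obtain ⟨i, hi⟩ := Finite.exists_max fun k => |ξ k|
  obtain ⟨b, hb⟩ : ∃ b : Bool, boolSign b * ξ i = |ξ i| := by
    rcases le_total 0 (ξ i) with h | h
    · exact ⟨true, by rw [boolSign_true, abs_of_nonneg h]; simp⟩
    · exact ⟨false, by rw [boolSign_false, abs_of_nonpos h]; simp⟩
  have h1 : coneBump (coneForm s ξ) (i, b) = 1 := by
    refine Finset.prod_eq_one fun e' _ => smoothStep_eq_one ?_
    refine div_nonneg ?_ hs.le
    simp only
    rw [hb]
    have h2 : |(boolSign e'.2 : ℝ) * ξ e'.1| ≤ |ξ i| := by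
      rw [abs_mul, abs_boolSign, one_mul]; exact hi e'.1
    linarith [neg_abs_le ((boolSign e'.2 : ℝ) * ξ e'.1)]
  rw [← h1]
  exact Finset.single_le_sum (fun e _ => coneBump_nonneg _ e) (Finset.mem_univ (i, b))

theorem sum_conePart (hd : 0 < d) {s : ℝ} (hs : 0 < s) (ξ : Eucl d) :
    ∑ i, conePart (coneForm s ξ) i = 1 := by
  simp only [conePart, ← Finset.mul_sum]
  rw [← Fintype.sum_prod_type' (f := fun i b => coneBump (coneForm s ξ) (i, b))]
  exact recipCutoff_mul_self (by linarith [one_le_sum_coneBump hd hs ξ])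

end ConePartition

/-! ### Sums of integer translates over the shears of one scale. -/

section ShearPartition

variable {d : ℕ}

/-- The squared modulus of the transversal generator. -/
def ShearletSystem.beta (S : ShearletSystem d) (u : ℝ) : ℝ := ‖S.psi2Hat u‖ ^ 2

variable (S : ShearletSystem d)

theorem ShearletSystem.beta_nonneg (u : ℝ) : 0 ≤ S.beta u := by
  unfold ShearletSystem.beta; positivity

theorem ShearletSystem.contDiff_beta : ContDiff ℝ ∞ S.beta := S.psi2Hat_smooth.norm_sq ℝ

theorem ShearletSystem.beta_eq_zero {u : ℝ} (h : 1 ≤ |u|) : S.beta u = 0 := by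
  rw [ShearletSystem.beta, S.psi2Hat_eq_zero h]; simp

theorem ShearletSystem.beta_zero : S.beta 0 = 1 := by
  have h := S.psi2Hat_sum 0 (by simp)
  rw [S.psi2Hat_eq_zero (w := 0 - 1) (by norm_num),
    S.psi2Hat_eq_zero (w := 0 + 1) (by norm_num)] at h
  simpa [ShearletSystem.beta] using h

theorem ShearletSystem.exists_half_le_beta :
    ∃ δ > 0, ∀ u : ℝ, |u| ≤ δ → 1 / 2 ≤ S.beta u := by
  have h : ∀ᶠ u in nhds (0 : ℝ), 1 / 2 < S.beta u :=
    S.contDiff_beta.continuous.continuousAt.eventually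
      (lt_mem_nhds (by rw [S.beta_zero]; norm_num))
  obtain ⟨δ, hδ, hδ'⟩ := Metric.eventually_nhds_iff.1 h
  refine ⟨δ / 2, by positivity, fun u hu => (hδ' ?_).le⟩
  rw [Real.dist_eq, sub_zero]
  linarith

/-- The sum of the integer translates of `β` which belong to one scale. -/
def ShearletSystem.shearSum (N : ℤ) (w : ℝ) : ℝ := ∑ n ∈ Finset.Icc (-N) N, S.beta (w - n)

/-- The local form of `shearSum`, where the flags tell which neighbours belong to the scale. -/
def ShearletSystem.shearLocal (fl : Bool × Bool) (u : ℝ) : ℝ :=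
  S.beta u + (if fl.1 then S.beta (u - 1) else 0) + (if fl.2 then S.beta (u + 1) else 0)

theorem ShearletSystem.contDiff_shearLocal (fl : Bool × Bool) : ContDiff ℝ ∞ (S.shearLocal fl) := by
  unfold ShearletSystem.shearLocal
  refine (S.contDiff_beta.add ?_).add ?_
  · split_ifs
    · exact S.contDiff_beta.comp (contDiff_id.sub contDiff_const)
    · exact contDiff_const
  · split_ifs
    · exact S.contDiff_beta.comp (contDiff_id.add contDiff_const)
    · exact contDiff_const

/-- The flags of the shear `n` on the scale with `|n| ≤ N`. -/
def shearFlags (N n : ℤ) : Bool × Bool := (decide (n + 1 ≤ N), decide (-N ≤ n - 1))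

/-- Since `β` vanishes off `(-1, 1)`, only the translates by `n - 1`, `n`, `n + 1` contribute, and
at the ends `±N` one neighbour may be missing. Near every `n` the sum is therefore one of four fixed
functions. -/
theorem ShearletSystem.shearSum_eq_local {N n : ℤ} (hn : |n| ≤ N) {u : ℝ} (hu : |u| ≤ 1) :
    S.shearSum N (n + u) = S.shearLocal (shearFlags N n) u := by
  obtain ⟨hn1, hn2⟩ := abs_le.1 hn
  obtain ⟨hu1, hu2⟩ := abs_le.1 hu
  have hz : ∀ m : ℤ, m ≠ n → m ≠ n + 1 → m ≠ n - 1 → S.beta (n + u - m) = 0 := by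
    intro m h1 h2 h3
    refine S.beta_eq_zero ?_
    rcases le_or_gt m n with h | h
    · have : (m : ℝ) ≤ n - 2 := by
        have : m ≤ n - 2 := by omega
        exact_mod_cast this
      exact le_abs.2 (Or.inl (by linarith))
    · have : (n : ℝ) + 2 ≤ m := by
        have : n + 2 ≤ m := by omega
        exact_mod_cast this
      exact le_abs.2 (Or.inr (by linarith))
  have hsub : ∀ m : ℤ, S.beta (n + u - m) = (if m = n then S.beta u else 0) +
      (if m = n + 1 then S.beta (u - 1) else 0) + (if m = n - 1 then S.beta (u + 1) else 0) := by
    intro m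
    by_cases h1 : m = n
    · subst h1
      have h2 : m ≠ m - 1 := by omega
      simp [h2]
    by_cases h2 : m = n + 1
    · subst h2
      simp only [h1, if_false, if_true, zero_add]
      rw [if_neg (by omega), add_zero]
      congr 1; push_cast; ring
    by_cases h3 : m = n - 1
    · subst h3
      simp only [h1, if_false, if_true, zero_add]
      rw [if_neg (by omega), zero_add]
      congr 1; push_cast; ring
    · rw [hz m h1 h2 h3]; simp [h1, h2, h3]
  rw [ShearletSystem.shearSum, Finset.sum_congr rfl fun m _ => hsub m]
  simp only [Finset.sum_add_distrib, Finset.sum_ite_eq', Finset.mem_Icc]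
  rw [ShearletSystem.shearLocal, if_pos ⟨hn1, hn2⟩]
  congr 1
  · congr 1
    simp only [shearFlags, decide_eq_true_eq]
    congr 1
    exact propext ⟨fun h => h.2, fun h => ⟨by omega, h⟩⟩
  · simp only [shearFlags, decide_eq_true_eq]
    congr 1
    exact propext ⟨fun h => h.1, fun h => ⟨h, by omega⟩⟩

/-- With `n = ⌊w⌋` and `0 ≤ u < 1` the translate `β(u + 1)` is zero anyway, and the neighbour `n +
1` is missing only for `w = N`, where `β(u - 1) = β(-1) = 0`. -/
theorem ShearletSystem.shearSum_eq_one {N : ℤ} {w : ℝ} (hw : |w| ≤ N) : S.shearSum N w = 1 := by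
  obtain ⟨h1, h2⟩ := abs_le.1 hw
  have hf := Int.floor_le w
  have hf' := Int.lt_floor_add_one w
  set n := ⌊w⌋ with hn
  have hn1 : |n| ≤ N := by
    rw [abs_le]
    constructor
    · rw [hn, Int.le_floor]; push_cast; linarith
    · have : (n : ℝ) ≤ N := hf.trans h2
      exact_mod_cast this
  set u := w - n with hu
  have hwu : w = n + u := by rw [hu]; ring
  have hu1 : |u| ≤ 1 := abs_le.2 ⟨by linarith, by linarith⟩
  rw [hwu, S.shearSum_eq_local hn1 hu1, ShearletSystem.shearLocal]
  have hsum : S.beta (u - 1) + S.beta u + S.beta (u + 1) = 1 := S.psi2Hat_sum u hu1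
  have e1 : (if (shearFlags N n).1 = true then S.beta (u - 1) else 0) = S.beta (u - 1) := by
    split_ifs with h
    · rfl
    · simp only [shearFlags, decide_eq_true_eq] at h
      have : (N : ℝ) ≤ n := by
        have : N ≤ n := by omega
        exact_mod_cast this
      exact (S.beta_eq_zero (le_abs.2 (Or.inr (by linarith)))).symm
  have e2 : (if (shearFlags N n).2 = true then S.beta (u + 1) else 0) = S.beta (u + 1) := by
    split_ifs with h
    · rfl
    · exact (S.beta_eq_zero (le_abs.2 (Or.inl (by linarith)))).symm
  rw [e1, e2]
  linarith

/-- The smooth cones spill slightly beyond `|w| ≤ N`. There the extreme translate alone, near its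
peak `β(0) = 1`, keeps the sum away from zero. -/
theorem ShearletSystem.half_le_shearSum {N : ℤ} (hN : 0 ≤ N) {δ : ℝ}
    (hδ : ∀ u : ℝ, |u| ≤ δ → 1 / 2 ≤ S.beta u) {w : ℝ} (hw : |w| ≤ N + δ) :
    1 / 2 ≤ S.shearSum N w := by
  have hle : ∀ n ∈ Finset.Icc (-N) N, S.beta (w - n) ≤ S.shearSum N w := fun n hn =>
    Finset.single_le_sum (f := fun n : ℤ => S.beta (w - n)) (fun _ _ => S.beta_nonneg _) hn
  rcases le_or_gt |w| N with h | h
  · rw [S.shearSum_eq_one h]; norm_num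
  · obtain ⟨h1, h2⟩ := abs_le.1 hw
    rcases lt_abs.1 h with h3 | h3
    · refine (hδ _ ?_).trans (hle N (Finset.mem_Icc.2 ⟨by omega, le_rfl⟩))
      rw [abs_le]; constructor <;> linarith
    · refine (hδ _ ?_).trans (hle (-N) (Finset.mem_Icc.2 ⟨le_rfl, by omega⟩))
      rw [abs_le]; push_cast; constructor <;> linarith

theorem ShearletSystem.sum_prod_beta (i : Fin d) (j : ℕ) (w : {k : Fin d // k ≠ i} → ℝ) :
    ∑ ℓ : ShearParam i j, ∏ k, S.beta (w k - ℓ.1 k) = ∏ k, S.shearSum (2 ^ j) (w k) := by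
  classical
  simp only [ShearletSystem.shearSum]
  rw [Finset.prod_univ_sum]
  refine (Finset.sum_subtype _ (fun ℓ => ?_)
    (fun ℓ : {k : Fin d // k ≠ i} → ℤ => ∏ k, S.beta (w k - ℓ k))).symm
  simp only [Fintype.mem_piFinset, Finset.mem_Icc, abs_le]

theorem ShearletSystem.cone_fourier_subtype (i : Fin d) (ξ : Eucl d) :
    (𝓕 (S.cone i) : 𝓢(Eucl d, ℂ)) ξ =
      S.psi1Hat (ξ i) * ∏ k : {k : Fin d // k ≠ i}, S.psi2Hat (ξ k / ξ i) := by
  rw [S.cone_fourier]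
  congr 1
  exact Finset.prod_subtype _ (by simp) _

end ShearPartition

/-! ### The reconstruction multipliers: a finite list in shear coordinates. -/

section Multiplier

variable {d : ℕ}

/-- The linear forms of the cone partition in shear coordinates, with integral parameters `m`. -/
def codeForm (i : Fin d) (ρ : ℝ) (m : Fin d × Bool → Fin d × Bool → ℤ) (η : Eucl d)
    (e e' : Fin d × Bool) : ℝ :=
  ρ * (m e e' * η i + (if e.1 = i then 0 else boolSign e.2 * η e.1) +
    (if e'.1 = i then 0 else boolSign e'.2 * η e'.1))

theorem contDiff_codeForm (i : Fin d) (ρ : ℝ) (m : Fin d × Bool → Fin d × Bool → ℤ)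
    (e e' : Fin d × Bool) : ContDiff ℝ ∞ fun η : Eucl d => codeForm i ρ m η e e' := by
  unfold codeForm
  refine contDiff_const.mul (((contDiff_const.mul ?_).add ?_).add ?_)
  · fun_prop
  · split_ifs <;> fun_prop
  · split_ifs <;> fun_prop

theorem contDiff_conePart_codeForm (i : Fin d) (ρ : ℝ) (m : Fin d × Bool → Fin d × Bool → ℤ) :
    ContDiff ℝ ∞ fun η : Eucl d => conePart (codeForm i ρ m η) i := by
  have h : ∀ e, ContDiff ℝ ∞ fun η : Eucl d => coneBump (codeForm i ρ m η) e := fun e =>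
    contDiff_prod fun e' _ => contDiff_smoothStep.comp (contDiff_codeForm i ρ m e e')
  unfold conePart
  exact (contDiff_recipCutoff.comp (ContDiff.sum fun e _ => h e)).mul
    (ContDiff.sum fun b _ => h (i, b))

/-- The integer `m` truncated to `[-B, B]`. -/
def clampInt (B m : ℤ) : ℤ := max (-B) (min B m)

theorem clampInt_mem {B : ℤ} (hB : 0 ≤ B) (m : ℤ) : clampInt B m ∈ Set.Icc (-B) B :=
  ⟨le_max_left _ _, max_le (by omega) (min_le_left _ _)⟩

/-- As `|x| ≥ 1/16`, an integer of modulus at least `B` gives `|m x| ≥ 1 + 1/ρ`, so the argument is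
`≥ 0` or `≤ -1`, where the step is constant. Truncation keeps the sign. -/
theorem smoothStep_clamp {B : ℤ} {ρ x y : ℝ} (hρ : 0 < ρ) (hB : 16 * (1 + 1 / ρ) ≤ B)
    (hx : 1 / 16 ≤ |x|) (hy : |y| ≤ 1) (m : ℤ) :
    smoothStep (ρ * (clampInt B m * x + y)) = smoothStep (ρ * (m * x + y)) := by
  have hρ' : ρ * (1 / ρ) = 1 := mul_one_div_cancel hρ.ne'
  obtain ⟨hy1, hy2⟩ := abs_le.1 hy
  have hB0 : (0 : ℝ) ≤ B := le_trans (by positivity) hB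
  have hB0' : 0 ≤ B := by exact_mod_cast hB0
  have big : ∀ z : ℝ, (B : ℝ) ≤ z → ∀ x', 1 / 16 ≤ x' → 1 + 1 / ρ ≤ z * x' := by
    intro z hz x' hx'
    nlinarith [one_div_pos.2 hρ]
  have pos : ∀ z : ℝ, 1 + 1 / ρ ≤ z → smoothStep (ρ * (z + y)) = 1 := fun z hz =>
    smoothStep_eq_one (mul_nonneg hρ.le (by linarith [one_div_pos.2 hρ]))
  have neg : ∀ z : ℝ, z ≤ -(1 + 1 / ρ) → smoothStep (ρ * (z + y)) = 0 := fun z hz => by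
    refine smoothStep_eq_zero ?_
    have : z + y ≤ -(1 / ρ) := by linarith
    nlinarith
  rcases le_or_gt m B with h1 | h1
  · rcases le_or_gt (-B) m with h2 | h2
    · rw [clampInt, min_eq_right h1, max_eq_right h2]
    · have e : clampInt B m = -B := by rw [clampInt, min_eq_right h1, max_eq_left h2.le]
      have h3 : (B : ℝ) ≤ -m := by
        have : B ≤ -m := by omega
        exact_mod_cast this
      rw [e]
      push_cast
      rcases le_abs.1 hx with h | h
      · rw [neg _ (by nlinarith [big B le_rfl x h]), neg _ (by nlinarith [big _ h3 x h])]
      · rw [pos _ (by nlinarith [big B le_rfl (-x) h]), pos _ (by nlinarith [big _ h3 (-x) h])]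
  · have e : clampInt B m = B := by rw [clampInt, min_eq_left h1.le, max_eq_right (by omega)]
    have h3 : (B : ℝ) ≤ m := by exact_mod_cast h1.le
    rw [e]
    rcases le_abs.1 hx with h | h
    · rw [pos _ (big B le_rfl x h), pos _ (big _ h3 x h)]
    · rw [neg _ (by nlinarith [big B le_rfl (-x) h]), neg _ (by nlinarith [big _ h3 (-x) h])]

/-- This makes the list of multipliers finite: the integers `m` may grow with the scale, but on the
support of the generator only their truncations matter. -/
theorem conePart_clamp {B : ℤ} {ρ : ℝ} (hρ : 0 < ρ) (hB : 16 * (1 + 1 / ρ) ≤ B) {i : Fin d}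
    {η : Eucl d} (h1 : 1 / 16 ≤ |η i|) (h2 : ∀ k, |η k| ≤ 1 / 2)
    (m : Fin d × Bool → Fin d × Bool → ℤ) :
    conePart (codeForm i ρ (fun e e' => clampInt B (m e e')) η) i =
      conePart (codeForm i ρ m η) i := by
  have hb : ∀ e : Fin d × Bool, |if e.1 = i then (0 : ℝ) else boolSign e.2 * η e.1| ≤ 1 / 2 := by
    intro e
    split_ifs
    · norm_num
    · rw [abs_mul, abs_boolSign, one_mul]; exact h2 _
  have h : ∀ e, coneBump (codeForm i ρ (fun e e' => clampInt B (m e e')) η) e =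
      coneBump (codeForm i ρ m η) e := by
    intro e
    refine Finset.prod_congr rfl fun e' _ => ?_
    simp only [codeForm, add_assoc]
    refine smoothStep_clamp hρ hB h1 ?_ _
    exact (abs_add_le _ _).trans (by linarith [hb e, hb e'])
  simp only [conePart, h]

variable (S : ShearletSystem d)

/-- The multipliers of the reconstruction formula, in shear coordinates. -/
def ShearletSystem.multiplier (i : Fin d) (ρ : ℝ) (m : Fin d × Bool → Fin d × Bool → ℤ)
    (fl : {k : Fin d // k ≠ i} → Bool × Bool) (η : Eucl d) : ℂ :=
  (𝓕 (S.cone i) : 𝓢(Eucl d, ℂ)) η * ((conePart (codeForm i ρ m η) i *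
    ∏ k, recipCutoff (S.shearLocal (fl k) (η k / η i)) : ℝ) : ℂ)

theorem ShearletSystem.hasCompactSupport_multiplier (i : Fin d) (ρ : ℝ)
    (m : Fin d × Bool → Fin d × Bool → ℤ) (fl : {k : Fin d // k ≠ i} → Bool × Bool) :
    HasCompactSupport (S.multiplier i ρ m fl) :=
  (S.hasCompactSupport_cone i).mul_right

/-- The quotients `η k / η i` are singular only at `η i = 0`, near which the generator vanishes. -/
theorem ShearletSystem.contDiff_multiplier (i : Fin d) (ρ : ℝ)
    (m : Fin d × Bool → Fin d × Bool → ℤ) (fl : {k : Fin d // k ≠ i} → Bool × Bool) :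
    ContDiff ℝ ∞ (S.multiplier i ρ m fl) := by
  refine contDiff_iff_contDiffAt.2 fun η => ?_
  by_cases hη : η i = 0
  · refine (contDiffAt_const (c := (0 : ℂ))).congr_of_eventuallyEq ?_
    have hc : Continuous fun z : Eucl d => |z i| := by fun_prop
    have : ∀ᶠ z in nhds η, |z i| < 1 / 16 := by
      refine hc.continuousAt.eventually (gt_mem_nhds ?_)
      simp only [hη]; norm_num
    filter_upwards [this] with z hz
    rw [ShearletSystem.multiplier, S.cone_fourier_eq_zero i fun h => absurd h.1 (not_le.2 hz), zero_mul]
  · unfold ShearletSystem.multiplier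
    refine ((𝓕 (S.cone i) : 𝓢(Eucl d, ℂ)).smooth ⊤).contDiffAt.mul
      (Complex.ofRealCLM.contDiff.contDiffAt.comp η (ContDiffAt.mul ?_ ?_))
    · exact (contDiff_conePart_codeForm i ρ m).contDiffAt
    · refine contDiffAt_prod fun k _ => ?_
      refine (contDiff_recipCutoff.comp (S.contDiff_shearLocal (fl k))).contDiffAt.comp η ?_
      refine ContDiffAt.div ?_ ?_ hη
      · exact ContDiff.contDiffAt (by fun_prop)
      · exact ContDiff.contDiffAt (by fun_prop)

/-- The Schwartz function with the given multiplier as Fourier transform. -/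
def ShearletSystem.multiplierKernel (i : Fin d) (ρ : ℝ) (m : Fin d × Bool → Fin d × Bool → ℤ)
    (fl : {k : Fin d // k ≠ i} → Bool × Bool) : 𝓢(Eucl d, ℂ) :=
  ofFourier (S.multiplier i ρ m fl) (S.hasCompactSupport_multiplier i ρ m fl)
    (S.contDiff_multiplier i ρ m fl)

/-- The kernels of the reconstruction formula are uniformly bounded, as only finitely many of them
occur. -/
theorem ShearletSystem.exists_kernelNorm_multiplier_le (L : ℝ) (B : ℤ) {n : ℕ} (ρ : Fin n → ℝ) :
    ∃ C : ℝ≥0, ∀ (i : Fin d) (a : Fin n) (m : Fin d × Bool → Fin d × Bool → ℤ),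
      (∀ e e', m e e' ∈ Set.Icc (-B) B) → ∀ fl : {k : Fin d // k ≠ i} → Bool × Bool,
      kernelNorm L (S.multiplierKernel i (ρ a) m fl) ≤ C := by
  let P := Σ i : Fin d, Fin n × (Fin d × Bool → Fin d × Bool → Set.Icc (-B) B) ×
    ({k : Fin d // k ≠ i} → Bool × Bool)
  let F : P → ℝ≥0 := fun x =>
    (kernelNorm L (S.multiplierKernel x.1 (ρ x.2.1) (fun e e' => x.2.2.1 e e') x.2.2.2)).toNNReal
  obtain ⟨C, hC⟩ := Set.finite_range F |>.bddAbove
  refine ⟨C, fun i a m hm fl => ?_⟩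
  rw [← ENNReal.coe_toNNReal (kernelNorm_ne_top L _), ENNReal.coe_le_coe]
  exact hC ⟨⟨i, a, fun e e' => ⟨m e e', hm e e'⟩, fl⟩, rfl⟩

end Multiplier

/-! ### The resolution of the identity on one cone and one scale. -/

section ReconstructionIdentity

variable {d : ℕ}

/-- The integral parameters of the linear forms in the shear coordinates of the index `t`. -/
def shearCode (t : ShearIndex d) (e e' : Fin d × Bool) : ℤ :=
  boolSign e.2 * (if h : e.1 ≠ t.1 then t.2.2.1 ⟨e.1, h⟩ else 2 ^ t.2.1) +
    boolSign e'.2 * (if h : e'.1 ≠ t.1 then t.2.2.1 ⟨e'.1, h⟩ else 2 ^ t.2.1)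

/-- Since `ξ i = 2^j (2^j η i)` and `ξ k = 2^j (η k + ℓ k η i)`, the axis `i` behaves like a
coordinate of shear `2^j`. Signed sums of coordinates then have integral coefficients along `η i`,
up to the common factor `2^j / s`. -/
theorem coneForm_eq_codeForm (t : ShearIndex d) (s : ℝ) (ξ : Eucl d) :
    coneForm s ξ = codeForm t.1 (2 ^ t.2.1 / s) (shearCode t) (dualPoint (indexGL t) ξ) := by
  have key : ∀ a : Fin d, ξ a = 2 ^ t.2.1 * ((if a = t.1 then 0 else dualPoint (indexGL t) ξ a) +
      ((if h : a ≠ t.1 then t.2.2.1 ⟨a, h⟩ else 2 ^ t.2.1 : ℤ) : ℝ) *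
        dualPoint (indexGL t) ξ t.1) := by
    intro a
    by_cases h : a = t.1
    · rw [h, if_pos rfl, dif_neg (by simp), zero_add, apply_eq_dualPoint_index_self t ξ]
      push_cast
      rw [← mul_assoc, ← mul_pow]
      norm_num
    · rw [if_neg h, dif_pos h]
      exact apply_eq_dualPoint_index_of_ne t ξ ⟨a, h⟩
  ext e e'
  rw [coneForm, codeForm, shearCode, key e.1, key e'.1]
  push_cast
  split_ifs <;> ring

/-- The flags of the index `t`. -/
def indexFlags (t : ShearIndex d) (k : {k : Fin d // k ≠ t.1}) : Bool × Bool :=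
  shearFlags (2 ^ t.2.1) (t.2.2.1 k)

variable (S : ShearletSystem d)

/-- One term of the reconstruction formula. -/
theorem ShearletSystem.multiplier_mul_conj (t : ShearIndex d) (s : ℝ) (ξ : Eucl d)
    (hξ : ξ t.1 ≠ 0) :
    S.multiplier t.1 (2 ^ t.2.1 / s) (shearCode t) (indexFlags t) (dualPoint (indexGL t) ξ) *
      (starRingEnd ℂ) ((𝓕 (S.cone t.1) : 𝓢(Eucl d, ℂ)) (dualPoint (indexGL t) ξ)) =
    ((‖S.psi1Hat ((4 ^ t.2.1)⁻¹ * ξ t.1)‖ ^ 2 * conePart (coneForm s ξ) t.1 *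
      ((∏ k : {k : Fin d // k ≠ t.1}, recipCutoff (S.shearSum (2 ^ t.2.1) (2 ^ t.2.1 * ξ k / ξ t.1))) *
        ∏ k : {k : Fin d // k ≠ t.1}, S.beta (2 ^ t.2.1 * ξ k / ξ t.1 - t.2.2.1 k)) : ℝ) : ℂ) := by
  set η := dualPoint (indexGL t) ξ with hη
  have hself : ξ t.1 = 4 ^ t.2.1 * η t.1 := apply_eq_dualPoint_index_self t ξ
  have hη0 : η t.1 ≠ 0 := fun h => hξ (by rw [hself, h, mul_zero])
  have hw : ∀ k : {k : Fin d // k ≠ t.1}, 2 ^ t.2.1 * ξ k / ξ t.1 = t.2.2.1 k + η k / η t.1 := by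
    intro k
    rw [apply_eq_dualPoint_index_of_ne t ξ k, hself, show (4 : ℝ) = 2 * 2 by norm_num, mul_pow]
    have h2 : (2 : ℝ) ^ t.2.1 ≠ 0 := by positivity
    field_simp
    ring
  have hsi : (4 ^ t.2.1)⁻¹ * ξ t.1 = η t.1 := by
    rw [hself, inv_mul_cancel_left₀ (by positivity)]
  rw [ShearletSystem.multiplier, ← coneForm_eq_codeForm, mul_right_comm, Complex.mul_conj',
    hsi, S.cone_fourier_subtype, norm_mul, norm_prod]
  have hβ : ∏ k : {k : Fin d // k ≠ t.1}, ‖S.psi2Hat (η k / η t.1)‖ ^ 2 =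
      ∏ k : {k : Fin d // k ≠ t.1}, S.beta (2 ^ t.2.1 * ξ k / ξ t.1 - t.2.2.1 k) := by
    refine Finset.prod_congr rfl fun k _ => ?_
    rw [hw, add_sub_cancel_left]; rfl
  -- The local form agrees with the full sum when all `|η k / η i| ≤ 1`; otherwise the product of
  -- the `β` vanishes and makes both sides zero.
  have hfin : (∏ k, recipCutoff (S.shearLocal (indexFlags t k) (η k / η t.1))) *
        ∏ k : {k : Fin d // k ≠ t.1}, S.beta (2 ^ t.2.1 * ξ k / ξ t.1 - t.2.2.1 k) =
      (∏ k : {k : Fin d // k ≠ t.1}, recipCutoff (S.shearSum (2 ^ t.2.1) (2 ^ t.2.1 * ξ k / ξ t.1))) *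
        ∏ k : {k : Fin d // k ≠ t.1}, S.beta (2 ^ t.2.1 * ξ k / ξ t.1 - t.2.2.1 k) := by
    by_cases hu : ∀ k : {k : Fin d // k ≠ t.1}, |η k / η t.1| ≤ 1
    · congr 1
      refine Finset.prod_congr rfl fun k _ => ?_
      rw [hw, S.shearSum_eq_local (t.2.2.2 k) (hu k)]
      rfl
    · push Not at hu
      obtain ⟨k, hk⟩ := hu
      have : ∏ k : {k : Fin d // k ≠ t.1}, S.beta (2 ^ t.2.1 * ξ k / ξ t.1 - t.2.2.1 k) = 0 := by
        refine Finset.prod_eq_zero (Finset.mem_univ k) ?_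
        rw [hw, add_sub_cancel_left]
        exact S.beta_eq_zero hk.le
      rw [this, mul_zero, mul_zero]
  rw [← hfin, ← hβ, Finset.prod_pow]
  push_cast
  ring

/-- The sum over all shears of one scale. -/
theorem ShearletSystem.sum_shear_multiplier (i : Fin d) (j : ℕ) {s δ : ℝ} (hs : 0 < s)
    (hδ : ∀ u : ℝ, |u| ≤ δ → 1 / 2 ≤ S.beta u) (hsδ : 16 * s ≤ δ * 2 ^ j) (ξ : Eucl d) :
    ∑ ℓ : ShearParam i j, S.multiplier i (2 ^ j / s) (shearCode ⟨i, j, ℓ⟩) (indexFlags ⟨i, j, ℓ⟩)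
        (dualPoint (indexGL ⟨i, j, ℓ⟩) ξ) *
      (starRingEnd ℂ) ((𝓕 (S.cone i) : 𝓢(Eucl d, ℂ)) (dualPoint (indexGL ⟨i, j, ℓ⟩) ξ)) =
    ((‖S.psi1Hat ((4 ^ j)⁻¹ * ξ i)‖ ^ 2 * conePart (coneForm s ξ) i : ℝ) : ℂ) := by
  by_cases hξ : 1 / 16 ≤ |(4 ^ j)⁻¹ * ξ i|
  swap
  · have h0 : S.psi1Hat ((4 ^ j)⁻¹ * ξ i) = 0 := S.psi1Hat_eq_zero fun h => hξ h.1
    rw [h0]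
    simp only [norm_zero]
    rw [Finset.sum_eq_zero]
    · simp
    · intro ℓ _
      have hη : dualPoint (indexGL ⟨i, j, ℓ⟩) ξ i = (4 ^ j)⁻¹ * ξ i := by
        have := apply_eq_dualPoint_index_self (⟨i, j, ℓ⟩ : ShearIndex d) ξ
        simp only at this
        rw [this, inv_mul_cancel_left₀ (by positivity)]
      rw [S.cone_fourier_subtype, hη, h0]; simp
  · have h4 : (0 : ℝ) < 4 ^ j := by positivity
    have hξ1 : 4 ^ j / 16 ≤ |ξ i| := by
      rw [abs_mul, abs_of_pos (inv_pos.2 h4), ← div_eq_inv_mul, le_div_iff₀ h4] at hξ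
      linarith
    have hξ0 : ξ i ≠ 0 := by
      intro h
      rw [h, abs_zero] at hξ1
      linarith
    have hterm : ∀ ℓ : ShearParam i j,
        S.multiplier i (2 ^ j / s) (shearCode ⟨i, j, ℓ⟩) (indexFlags ⟨i, j, ℓ⟩)
          (dualPoint (indexGL ⟨i, j, ℓ⟩) ξ) *
        (starRingEnd ℂ) ((𝓕 (S.cone i) : 𝓢(Eucl d, ℂ)) (dualPoint (indexGL ⟨i, j, ℓ⟩) ξ)) =
        ((‖S.psi1Hat ((4 ^ j)⁻¹ * ξ i)‖ ^ 2 * conePart (coneForm s ξ) i *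
          ((∏ k : {k : Fin d // k ≠ i}, recipCutoff (S.shearSum (2 ^ j) (2 ^ j * ξ k / ξ i))) *
          ∏ k : {k : Fin d // k ≠ i}, S.beta (2 ^ j * ξ k / ξ i - ℓ.1 k)) : ℝ) : ℂ) :=
      fun ℓ => S.multiplier_mul_conj ⟨i, j, ℓ⟩ s ξ hξ0
    rw [Finset.sum_congr rfl fun ℓ _ => hterm ℓ, ← Complex.ofReal_sum, ← Finset.mul_sum,
      ← Finset.mul_sum,
      S.sum_prod_beta i j fun k => 2 ^ j * ξ k / ξ i, ← Finset.prod_mul_distrib]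
    congr 1
    -- On the support of the cone function `|ξ k| ≤ |ξ i| + s`. With `|ξ i| ≥ 4^j / 16` and `hsδ`
    -- this gives `|2^j ξ k / ξ i| ≤ 2^j + δ`, so the shear sum is at least `1/2` and the reciprocal
    -- cutoff cancels it exactly.
    by_cases hc : conePart (coneForm s ξ) i = 0
    · rw [hc]; simp
    · rw [Finset.prod_eq_one, mul_one]
      intro k _
      refine recipCutoff_mul_self (S.half_le_shearSum (by positivity) hδ ?_)
      have hk := abs_le_of_conePart_ne_zero hs hc k
      have h2 : (0 : ℝ) < 2 ^ j := by positivity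
      have h42 : (4 : ℝ) ^ j = 2 ^ j * 2 ^ j := by rw [← mul_pow]; norm_num
      rw [abs_div, abs_mul, abs_of_pos h2, div_le_iff₀ (abs_pos.2 hξ0)]
      push_cast
      have hδ0 : 0 < δ := by
        by_contra! h
        nlinarith
      have h5 : 2 ^ j * s ≤ δ * |ξ i| := by
        calc 2 ^ j * s ≤ 2 ^ j * (δ * 2 ^ j / 16) := by
              refine mul_le_mul_of_nonneg_left ?_ h2.le
              linarith
          _ = δ * (4 ^ j / 16) := by rw [h42]; ring
          _ ≤ δ * |ξ i| := mul_le_mul_of_nonneg_left hξ1 hδ0.le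
      nlinarith [mul_le_mul_of_nonneg_left hk h2.le]

end ReconstructionIdentity

/-! ### Reconstruction of a Littlewood–Paley piece of high frequency. -/

section DyadicScale

variable {d : ℕ}

theorem dyadicGL_val (d ν : ℕ) : (dyadicGL d ν : Matrix (Fin d) (Fin d) ℝ) =
    Matrix.diagonal fun _ => (2 : ℝ) ^ ν := rfl

theorem matEquiv_dyadic (ν : ℕ) (x : Eucl d) : matEquiv (dyadicGL d ν) x = (2 : ℝ) ^ ν • x := by
  ext k
  rw [matEquiv_apply, dyadicGL_val, Matrix.mulVec_diagonal]
  simp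

theorem dualPoint_dyadic (ν : ℕ) (ξ : Eucl d) : dualPoint (dyadicGL d ν) ξ = (2 : ℝ) ^ ν • ξ := by
  ext k
  rw [dualPoint_apply, dyadicGL_val]
  simp [Matrix.diagonal_apply]

theorem norm_bounds_of_fourier_dyadicDilate_ne_zero (D : DyadicPair d) {ν : ℕ} {ξ : Eucl d}
    (h : (𝓕 (dyadicDilate ν D.bandPass) : 𝓢(Eucl d, ℂ)) ξ ≠ 0) :
    2 ^ ν / 2 ≤ ‖ξ‖ ∧ ‖ξ‖ ≤ 2 * 2 ^ ν := by
  rw [dyadicDilate, fourier_dilate] at h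
  set η := dualPoint (dyadicGL d ν)⁻¹ ξ with hη
  have hξ : ξ = (2 : ℝ) ^ ν • η := by
    rw [← dualPoint_dyadic, hη, ← dualPoint_mul, inv_mul_cancel, dualPoint_one]
  obtain ⟨h1, h2⟩ := D.bandPass_supp (subset_tsupport _ h)
  rw [hξ, norm_smul, Real.norm_of_nonneg (by positivity)]
  have h3 : (0 : ℝ) < 2 ^ ν := by positivity
  constructor <;> nlinarith

theorem hasCompactSupport_fourier_dyadicDilate (D : DyadicPair d) (ν : ℕ) :
    HasCompactSupport (𝓕 (dyadicDilate ν D.bandPass) : 𝓢(Eucl d, ℂ)) := by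
  refine HasCompactSupport.intro (isCompact_closedBall (0 : Eucl d) (2 * 2 ^ ν)) fun ξ hξ => ?_
  by_contra h0
  refine hξ ?_
  rw [mem_closedBall_zero_iff]
  exact (norm_bounds_of_fourier_dyadicDilate_ne_zero D h0).2

theorem hasCompactSupport_fourier_lowPass (D : DyadicPair d) :
    HasCompactSupport (𝓕 D.lowPass : 𝓢(Eucl d, ℂ)) := by
  refine HasCompactSupport.intro (isCompact_closedBall (0 : Eucl d) 2) fun ξ hξ => ?_
  by_contra h0
  refine hξ ?_
  rw [mem_closedBall_zero_iff]
  exact D.lowPass_supp (subset_tsupport _ h0)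

/-- The bound `|ℓ k| ≤ 2^j` keeps every entry of the sheared dilation at most `4^j`. An isotropic
kernel of width about `4^(-j)` is then no wider than the shear cell. -/
theorem norm_matEquiv_index_inv_le (t : ShearIndex d) (y : Eucl d) :
    ‖matEquiv (indexGL t)⁻¹ y‖ ≤ d * (d * (4 ^ t.2.1 * ‖y‖)) := by
  obtain ⟨i, j, ℓ, hℓ⟩ := t
  rw [indexGL_inv, matEquiv_mul_apply]
  simp only
  have h24 : (2 : ℝ) ^ j ≤ 4 ^ j := pow_le_pow_left₀ (by norm_num) (by norm_num) j
  have h44 : (4 : ℝ) ^ j = 2 ^ j * 2 ^ j := by rw [← mul_pow]; norm_num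
  have h2 : (0 : ℝ) < 2 ^ j := by positivity
  have hz : ∀ k, k ≠ i → |matEquiv (anisoGL i ^ j) y k| ≤ 2 ^ j * ‖y‖ := fun k hk => by
    rw [matEquiv_aniso_apply, if_neg hk, abs_mul, abs_of_pos h2]
    exact mul_le_mul_of_nonneg_left (abs_apply_le_norm y k) h2.le
  have hd1 : (1 : ℝ) ≤ d := by exact_mod_cast i.pos
  have hP : 0 ≤ 4 ^ j * ‖y‖ := by positivity
  refine norm_le_of_abs_le fun k => ?_
  by_cases hk : k = i
  · subst hk
    rw [matEquiv_shear_apply_self, matEquiv_aniso_apply, if_pos rfl]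
    have hsum : |∑ r : {r : Fin d // r ≠ k}, (ℓ r : ℝ) * matEquiv (anisoGL k ^ j) y r| ≤
        (d - 1) * (4 ^ j * ‖y‖) := by
      refine (Finset.abs_sum_le_sum_abs _ _).trans ?_
      refine (Finset.sum_le_card_nsmul _ _ (4 ^ j * ‖y‖) fun r _ => ?_).trans_eq ?_
      · rw [abs_mul, h44, mul_assoc]
        have h1 : |(ℓ r : ℝ)| ≤ 2 ^ j := by exact_mod_cast hℓ r
        exact mul_le_mul h1 (hz r r.2) (abs_nonneg _) h2.le
      · rw [nsmul_eq_mul, Finset.card_univ]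
        have : Fintype.card {r : Fin d // r ≠ k} = d - 1 := by simp
        rw [this, Nat.cast_sub k.pos]; simp
    refine (abs_add_le _ _).trans ?_
    rw [abs_mul, abs_of_pos (by positivity : (0 : ℝ) < 4 ^ j)]
    nlinarith [mul_le_mul_of_nonneg_left (abs_apply_le_norm y k) (by positivity : (0 : ℝ) ≤ 4 ^ j)]
  · rw [matEquiv_shear_apply_of_ne ℓ hk]
    refine (hz k hk).trans ?_
    have : 2 ^ j * ‖y‖ ≤ 4 ^ j * ‖y‖ := mul_le_mul_of_nonneg_right h24 (norm_nonneg y)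
    nlinarith

theorem fourier_sum_apply {ι : Type*} (s : Finset ι) (ψ : ι → 𝓢(Eucl d, ℂ)) (ξ : Eucl d) :
    (𝓕 (∑ k ∈ s, ψ k) : 𝓢(Eucl d, ℂ)) ξ = ∑ k ∈ s, (𝓕 (ψ k) : 𝓢(Eucl d, ℂ)) ξ := by
  simp only [← SchwartzMap.fourierTransformCLM_apply (𝕜 := ℂ), map_sum, sum_apply]

theorem ShearletSystem.psi1Hat_hasSum (S : ShearletSystem d) {w : ℝ} (hw : 1 / 8 ≤ |w|) :
    HasSum (fun j : ℕ => ‖S.psi1Hat ((4 ^ j)⁻¹ * w)‖ ^ 2) 1 := by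
  have e : ∀ j : ℕ, (2 : ℝ) ^ (-2 * (j : ℤ)) = (4 ^ j)⁻¹ := fun j => by
    rw [show -2 * (j : ℤ) = -((2 * j : ℕ) : ℤ) by push_cast; ring, zpow_neg, zpow_natCast, pow_mul]
    norm_num
  simpa only [e] using S.psi1Hat_sum w hw

theorem ShearletSystem.sum_psi1Hat (S : ShearletSystem d) {w : ℝ} (hw : 1 / 8 ≤ |w|) {m n : ℕ}
    (h : ∀ j, S.psi1Hat ((4 ^ j)⁻¹ * w) ≠ 0 → m ≤ j ∧ j < m + n) :
    ∑ a : Fin n, ‖S.psi1Hat ((4 ^ (m + a))⁻¹ * w)‖ ^ 2 = 1 := by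
  rw [Fin.sum_univ_eq_sum_range (fun a => ‖S.psi1Hat ((4 ^ (m + a))⁻¹ * w)‖ ^ 2) n]
  have h1 : ∑ a ∈ Finset.range n, ‖S.psi1Hat ((4 ^ (m + a))⁻¹ * w)‖ ^ 2 =
      ∑ j ∈ Finset.Ico m (m + n), ‖S.psi1Hat ((4 ^ j)⁻¹ * w)‖ ^ 2 := by
    rw [Finset.sum_Ico_eq_sum_range, Nat.add_sub_cancel_left]
  rw [h1]
  refine (hasSum_sum_of_ne_finset_zero fun j hj => ?_).unique (S.psi1Hat_hasSum hw)
  by_contra h0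
  refine hj (Finset.mem_Ico.2 (h j fun hz => h0 ?_))
  rw [hz]; simp

theorem ShearletSystem.psi1Hat_ne_zero (S : ShearletSystem d) {w : ℝ} {j : ℕ}
    (h : S.psi1Hat ((4 ^ j)⁻¹ * w) ≠ 0) : 4 ^ j ≤ 16 * |w| ∧ 2 * |w| ≤ 4 ^ j := by
  have h1 : 1 / 16 ≤ |(4 ^ j)⁻¹ * w| ∧ |(4 ^ j)⁻¹ * w| ≤ 1 / 2 := by
    by_contra h2
    exact h (S.psi1Hat_eq_zero h2)
  have h4 : (0 : ℝ) < 4 ^ j := by positivity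
  rw [abs_mul, abs_of_pos (inv_pos.2 h4), ← div_eq_inv_mul, le_div_iff₀ h4, div_le_iff₀ h4] at h1
  constructor <;> linarith

theorem ShearletSystem.multiplier_clamp (S : ShearletSystem d) {B : ℤ} {ρ : ℝ} (hρ : 0 < ρ)
    (hB : 16 * (1 + 1 / ρ) ≤ B) (i : Fin d) (m : Fin d × Bool → Fin d × Bool → ℤ)
    (fl : {k : Fin d // k ≠ i} → Bool × Bool) (η : Eucl d) :
    S.multiplier i ρ (fun e e' => clampInt B (m e e')) fl η = S.multiplier i ρ m fl η := by
  unfold ShearletSystem.multiplier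
  by_cases h : 1 / 16 ≤ |η i| ∧ |η i| ≤ 1 / 2 ∧ ∀ k, |η k| ≤ |η i|
  · rw [conePart_clamp hρ hB h.1 fun k => (h.2.2 k).trans h.2.1]
  · rw [S.cone_fourier_eq_zero i h, zero_mul, zero_mul]

/-- The sum of all multipliers of the relevant scales at a frequency of modulus about `4^μ`. -/
theorem ShearletSystem.sum_multiplier_eq_one (S : ShearletSystem d) {μ : ℕ} (hμ : 4 * d ≤ μ)
    {s δ : ℝ} (hs : 0 < s) (hs1 : s ≤ 2 ^ μ) (hδ : ∀ u : ℝ, |u| ≤ δ → 1 / 2 ≤ S.beta u)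
    (hsδ : ∀ a : Fin (d + 4), 16 * s ≤ δ * 2 ^ (μ - d + a)) {ξ : Eucl d} (h1 : 4 ^ μ / 2 ≤ ‖ξ‖)
    (h2 : ‖ξ‖ ≤ 4 * 4 ^ μ) :
    ∑ i, ∑ a : Fin (d + 4), ∑ ℓ : ShearParam i (μ - d + a),
      S.multiplier i (2 ^ (μ - d + a : ℕ) / s) (shearCode ⟨i, μ - d + a, ℓ⟩)
        (indexFlags ⟨i, μ - d + a, ℓ⟩) (dualPoint (indexGL ⟨i, μ - d + a, ℓ⟩) ξ) *
      (starRingEnd ℂ) ((𝓕 (S.cone i) : 𝓢(Eucl d, ℂ)) (dualPoint (indexGL ⟨i, μ - d + a, ℓ⟩) ξ)) =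
    1 := by
  have h4 : (4 : ℝ) ^ μ = 2 ^ μ * 2 ^ μ := by rw [← mul_pow]; norm_num
  have h2μ : (0 : ℝ) < 2 ^ μ := by positivity
  have hd : 0 < d := by
    rcases Nat.eq_zero_or_pos d with h | h
    · subst h
      have : ξ = 0 := Subsingleton.elim _ _
      rw [this, norm_zero] at h1
      have : (0 : ℝ) < 4 ^ μ := by positivity
      linarith
    · exact h
  have hd1 : (1 : ℝ) ≤ d := by exact_mod_cast hd
  have hdμ : 4 * (d : ℝ) ≤ 2 ^ μ := by
    have h5 : 4 * d ≤ 2 ^ μ := (Nat.lt_two_pow_self (n := 4 * d)).le.trans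
      (Nat.pow_le_pow_right (by norm_num) hμ)
    exact_mod_cast h5
  -- On the `i`-th smooth cone `4^μ / (4d) ≤ |ξ i| ≤ 4 * 4^μ`, so a nonzero value of the radial
  -- generator forces `μ - d ≤ j ≤ μ + 3`. These are the `d + 4` scales of the sum.
  have hsum : ∀ i, (∑ a : Fin (d + 4), ‖S.psi1Hat ((4 ^ (μ - d + a : ℕ))⁻¹ * ξ i)‖ ^ 2) *
      conePart (coneForm s ξ) i = conePart (coneForm s ξ) i := by
    intro i
    by_cases hc : conePart (coneForm s ξ) i = 0
    · rw [hc, mul_zero]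
    have hn : ‖ξ‖ ≤ d * (|ξ i| + s) := norm_le_of_abs_le (abs_le_of_conePart_ne_zero hs hc)
    have hlow : 2 ^ μ * 2 ^ μ ≤ 4 * d * |ξ i| := by nlinarith
    have hup : |ξ i| ≤ 4 * 4 ^ μ := (abs_apply_le_norm ξ i).trans h2
    rw [S.sum_psi1Hat, one_mul]
    · have h6 : 1 ≤ |ξ i| := by
        by_contra! h7
        have h8 : 4 * (d : ℝ) * |ξ i| < 4 * d := by nlinarith
        have h9 : (1 : ℝ) ≤ 2 ^ μ := one_le_pow₀ (by norm_num)
        nlinarith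
      linarith
    · intro j hj
      obtain ⟨hj1, hj2⟩ := S.psi1Hat_ne_zero hj
      constructor
      · by_contra! hlt
        have h7 : j + d + 1 ≤ μ := by omega
        have h8 : (4 : ℝ) ^ j * 4 ^ d * 4 ≤ 4 ^ μ := by
          rw [← pow_add, ← pow_succ]
          exact pow_le_pow_right₀ (by norm_num) h7
        have h9 : (d : ℝ) ≤ 4 ^ d := by
          have : d ≤ 4 ^ d := (Nat.lt_pow_self (by norm_num)).le
          exact_mod_cast this
        have h10 : (0 : ℝ) < 4 ^ j := by positivity
        nlinarith
      · have h7 : (4 : ℝ) ^ j ≤ 4 ^ (μ + 3) := by rw [pow_add]; linarith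
        have h8 := (pow_le_pow_iff_right₀ (by norm_num : (1 : ℝ) < 4)).1 h7
        omega
  have hterm : ∀ (i : Fin d) (a : Fin (d + 4)), ∑ ℓ : ShearParam i (μ - d + a),
      S.multiplier i (2 ^ (μ - d + a : ℕ) / s) (shearCode ⟨i, μ - d + a, ℓ⟩)
        (indexFlags ⟨i, μ - d + a, ℓ⟩) (dualPoint (indexGL ⟨i, μ - d + a, ℓ⟩) ξ) *
      (starRingEnd ℂ) ((𝓕 (S.cone i) : 𝓢(Eucl d, ℂ)) (dualPoint (indexGL ⟨i, μ - d + a, ℓ⟩) ξ)) =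
      ((‖S.psi1Hat ((4 ^ (μ - d + a : ℕ))⁻¹ * ξ i)‖ ^ 2 * conePart (coneForm s ξ) i : ℝ) : ℂ) :=
    fun i a => S.sum_shear_multiplier i (μ - d + a) hs hδ (hsδ a) ξ
  simp only [hterm, ← Complex.ofReal_sum, ← Finset.sum_mul, hsum]
  rw [sum_conePart hd hs ξ, Complex.ofReal_one]

/-- The reconstruction of the dyadic pieces of high frequency from the shearlets. -/
theorem exists_dyadic_reconstruction (D : DyadicPair d) (S : ShearletSystem d) {L : ℝ}
    (hL : 0 ≤ L) : ∃ C : ℝ≥0, ∀ ν, 8 * d ≤ ν → ∃ κ κ' : ShearIndex d → 𝓢(Eucl d, ℂ),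
      (∀ (i : Fin d) (a : Fin (d + 4)) (ℓ : ShearParam i (ν / 2 - d + a)),
        kernelNorm L (κ ⟨i, ν / 2 - d + a, ℓ⟩) ≤ C ∧ kernelNorm L (κ' ⟨i, ν / 2 - d + a, ℓ⟩) ≤ C) ∧
      dyadicDilate ν D.bandPass = ∑ i, ∑ a : Fin (d + 4), ∑ ℓ : ShearParam i (ν / 2 - d + a),
        dilate (indexGL ⟨i, ν / 2 - d + a, ℓ⟩) (sconv (κ' ⟨i, ν / 2 - d + a, ℓ⟩)
          (sconv (κ ⟨i, ν / 2 - d + a, ℓ⟩) (invol (S.cone i)))) := by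
  obtain ⟨δ, hδ0, hδ⟩ := S.exists_half_le_beta
  -- The seam will be `s = 2^μ / 2^K`, with `K` so large that `16 s ≤ δ 2^j` even at the lowest
  -- scale `j = μ - d`.
  obtain ⟨K, hK⟩ := exists_nat_ge (16 * 2 ^ d / δ)
  have hK2 : 16 * 2 ^ d ≤ δ * 2 ^ K := by
    rw [div_le_iff₀ hδ0] at hK
    have : (K : ℝ) ≤ 2 ^ K := by
      have : K ≤ 2 ^ K := (Nat.lt_two_pow_self).le
      exact_mod_cast this
    nlinarith
  set B : ℤ := 16 * (1 + 2 ^ d) with hB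
  -- This is `2^j / s` at `j = μ - d + a`. It does not depend on `μ`, so only `d + 4` values occur;
  -- `1/ρ ≤ 2^d` explains the choice of `B`.
  set ρ : Fin (d + 4) → ℝ := fun a => 2 ^ (a : ℕ) * 2 ^ K / 2 ^ d with hρ
  have hρ0 : ∀ a, 0 < ρ a := fun a => by simp only [hρ]; positivity
  have hρB : ∀ a, 16 * (1 + 1 / ρ a) ≤ B := by
    intro a
    have h1 : (1 : ℝ) ≤ 2 ^ (a : ℕ) * 2 ^ K := by
      rw [← pow_add]; exact one_le_pow₀ (by norm_num)
    have h2 : 1 / ρ a ≤ 2 ^ d := by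
      simp only [hρ]
      rw [one_div_div]
      exact div_le_self (by positivity) h1
    rw [hB]
    push_cast
    linarith
  obtain ⟨C₁, hC₁⟩ := S.exists_kernelNorm_multiplier_le L B ρ
  -- The factor `64 = 4^3` comes from the top scale `j = μ + 3`, and `d * d` from the norm bound of
  -- the index matrix.
  set Kd : ℝ≥0 := d * (d * 64) with hKd
  refine ⟨C₁ + Kd ^ L * (kernelNorm L D.bandPass).toNNReal, fun ν hν => ?_⟩
  set μ := ν / 2 with hμ
  have hμd : 4 * d ≤ μ := by omega
  have hν1 : (4 : ℝ) ^ μ ≤ 2 ^ ν := by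
    rw [show (4 : ℝ) = 2 ^ 2 by norm_num, ← pow_mul]
    exact pow_le_pow_right₀ (by norm_num) (by omega)
  have hν2 : (2 : ℝ) ^ ν ≤ 2 * 4 ^ μ := by
    rw [show (4 : ℝ) = 2 ^ 2 by norm_num, ← pow_mul, ← pow_succ']
    exact pow_le_pow_right₀ (by norm_num) (by omega)
  set s : ℝ := 2 ^ μ / 2 ^ K with hs
  have hs0 : 0 < s := by positivity
  have hs1 : s ≤ 2 ^ μ := div_le_self (by positivity) (one_le_pow₀ (by norm_num))
  have hμa : ∀ a : ℕ, (2 : ℝ) ^ (μ - d + a) * 2 ^ d = 2 ^ μ * 2 ^ a := by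
    intro a
    rw [← pow_add, ← pow_add]
    congr 1
    omega
  have hρs : ∀ a : Fin (d + 4), 2 ^ (μ - d + a : ℕ) / s = ρ a := by
    intro a
    simp only [hs, hρ]
    have h1 := hμa a
    have h2 : (2 : ℝ) ^ μ ≠ 0 := by positivity
    field_simp
    linarith
  have hsδ : ∀ a : Fin (d + 4), 16 * s ≤ δ * 2 ^ (μ - d + a : ℕ) := by
    intro a
    have h1 := hμa a
    have h3 : (1 : ℝ) ≤ 2 ^ (a : ℕ) := one_le_pow₀ (by norm_num)
    have h4 : (0 : ℝ) < 2 ^ μ := by positivity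
    have h5 : 2 ^ μ ≤ (2 : ℝ) ^ (μ - d + a : ℕ) * 2 ^ d := by rw [h1]; nlinarith
    have h6 : (0 : ℝ) < 2 ^ (μ - d + a : ℕ) := by positivity
    rw [hs, mul_div_assoc', div_le_iff₀ (by positivity)]
    calc 16 * 2 ^ μ ≤ 16 * ((2 : ℝ) ^ (μ - d + a : ℕ) * 2 ^ d) := by linarith
      _ = 2 ^ (μ - d + a : ℕ) * (16 * 2 ^ d) := by ring
      _ ≤ 2 ^ (μ - d + a : ℕ) * (δ * 2 ^ K) := mul_le_mul_of_nonneg_left hK2 h6.le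
      _ = _ := by ring
  -- The second kernel is the Littlewood–Paley function in the coordinates of the index; the outer
  -- dilation restores it.
  refine ⟨fun t => S.multiplierKernel t.1 (2 ^ t.2.1 / s) (fun e e' => clampInt B (shearCode t e e'))
    (indexFlags t), fun t => dilate (indexGL t)⁻¹ (dyadicDilate ν D.bandPass), ?_, ?_⟩
  · intro i a ℓ
    constructor
    · simp only
      rw [hρs a]
      refine (hC₁ i a _ (fun e e' => clampInt_mem (by positivity) _) _).trans ?_
      exact_mod_cast le_self_add
    · simp only
      rw [dyadicDilate, dilate_dilate]
      have hd1 : 1 ≤ d := i.pos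
      refine (kernelNorm_dilate_le hL _ (K := Kd) ?_ (fun x => ?_) D.bandPass).trans ?_
      · rw [hKd]
        have : 1 ≤ d * (d * 64) := Nat.mul_pos hd1 (by omega)
        exact_mod_cast this
      · rw [matEquiv_mul_apply]
        set y := matEquiv (dyadicGL d ν)⁻¹ x with hy
        have hx : ‖x‖ = 2 ^ ν * ‖y‖ := by
          have : x = (2 : ℝ) ^ ν • y := by
            rw [← matEquiv_dyadic, hy, matEquiv_matEquiv_inv]
          rw [this, norm_smul, Real.norm_of_nonneg (by positivity)]
        refine (norm_matEquiv_index_inv_le _ y).trans ?_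
        simp only
        have h4 : (4 : ℝ) ^ (μ - d + a : ℕ) ≤ 64 * 2 ^ ν := by
          have h5 : (4 : ℝ) ^ (μ - d + a : ℕ) ≤ 4 ^ (μ + 3) :=
            pow_le_pow_right₀ (by norm_num) (by have := a.2; omega)
          rw [pow_add 4 μ 3] at h5
          linarith
        rw [hx, hKd]
        push_cast
        have h6 := mul_le_mul_of_nonneg_right h4 (norm_nonneg y)
        have h7 : (0 : ℝ) ≤ d := Nat.cast_nonneg d
        calc (d : ℝ) * (d * (4 ^ (μ - d + a : ℕ) * ‖y‖)) ≤ d * (d * (64 * 2 ^ ν * ‖y‖)) := by gcongr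
          _ = _ := by ring
      · rw [ENNReal.coe_add, ENNReal.coe_mul, ENNReal.coe_toNNReal (kernelNorm_ne_top L _)]
        exact le_add_self
  · refine schwartz_ext_fourier fun ξ => ?_
    have hB' : ∀ (i : Fin d) (a : Fin (d + 4)) (ℓ : ShearParam i (μ - d + a)),
        (𝓕 (dilate (indexGL ⟨i, μ - d + a, ℓ⟩)
          (sconv (dilate (indexGL ⟨i, μ - d + a, ℓ⟩)⁻¹ (dyadicDilate ν D.bandPass))
          (sconv (S.multiplierKernel i (2 ^ (μ - d + a : ℕ) / s)
            (fun e e' => clampInt B (shearCode ⟨i, μ - d + a, ℓ⟩ e e'))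
            (indexFlags ⟨i, μ - d + a, ℓ⟩)) (invol (S.cone i))))) : 𝓢(Eucl d, ℂ)) ξ =
        (𝓕 (dyadicDilate ν D.bandPass) : 𝓢(Eucl d, ℂ)) ξ *
        (S.multiplier i (2 ^ (μ - d + a : ℕ) / s) (shearCode ⟨i, μ - d + a, ℓ⟩)
        (indexFlags ⟨i, μ - d + a, ℓ⟩) (dualPoint (indexGL ⟨i, μ - d + a, ℓ⟩) ξ) *
      (starRingEnd ℂ) ((𝓕 (S.cone i) : 𝓢(Eucl d, ℂ))
        (dualPoint (indexGL ⟨i, μ - d + a, ℓ⟩) ξ))) := by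
      intro i a ℓ
      rw [dilate_sconv, dilate_inv_dilate, fourier_sconv, fourier_dilate, fourier_sconv,
        fourier_invol, ShearletSystem.multiplierKernel, fourier_ofFourier]
      congr 2
      refine S.multiplier_clamp ?_ ?_ i _ _ _
      · rw [hρs]; exact hρ0 a
      · rw [hρs]; exact hρB a
    simp only [fourier_sum_apply, hB', ← Finset.mul_sum]
    by_cases hz : (𝓕 (dyadicDilate ν D.bandPass) : 𝓢(Eucl d, ℂ)) ξ = 0
    · rw [hz, zero_mul]
    · obtain ⟨h1, h2⟩ := norm_bounds_of_fourier_dyadicDilate_ne_zero D hz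
      rw [S.sum_multiplier_eq_one hμd hs0 hs1 hδ hsδ (by linarith) (by linarith), mul_one]

end DyadicScale

/-! ### Reconstruction of band-limited functions from finitely many shearlets. -/

section LowFrequencies

variable {d : ℕ}

theorem ShearletSystem.norm_fourier_atom_sq (S : ShearletSystem d) (t : ShearIndex d) {ξ : Eucl d}
    (hξ : ξ t.1 ≠ 0) : ‖(𝓕 (S.atom t) : 𝓢(Eucl d, ℂ)) ξ‖ ^ 2 =
      ‖S.psi1Hat ((4 ^ t.2.1)⁻¹ * ξ t.1)‖ ^ 2 *
        ∏ k : {k : Fin d // k ≠ t.1}, S.beta (2 ^ t.2.1 * ξ k / ξ t.1 - t.2.2.1 k) := by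
  rw [S.atom_eq, fourier_dilate]
  set η := dualPoint (indexGL t) ξ with hη
  have hself : ξ t.1 = 4 ^ t.2.1 * η t.1 := apply_eq_dualPoint_index_self t ξ
  have hη0 : η t.1 ≠ 0 := fun h => hξ (by rw [hself, h, mul_zero])
  have hw : ∀ k : {k : Fin d // k ≠ t.1},
      2 ^ t.2.1 * ξ k / ξ t.1 - t.2.2.1 k = η k / η t.1 := by
    intro k
    rw [apply_eq_dualPoint_index_of_ne t ξ k, hself, show (4 : ℝ) = 2 * 2 by norm_num, mul_pow]
    have h2 : (2 : ℝ) ^ t.2.1 ≠ 0 := by positivity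
    field_simp
    ring
  have hsi : (4 ^ t.2.1)⁻¹ * ξ t.1 = η t.1 := by
    rw [hself, inv_mul_cancel_left₀ (by positivity)]
  rw [S.cone_fourier_subtype, hsi, norm_mul, norm_prod, mul_pow, ← Finset.prod_pow]
  simp only [hw]
  rfl

theorem ShearletSystem.sum_norm_fourier_atom_sq (S : ShearletSystem d) {i : Fin d} {ξ : Eucl d}
    (hξ : ξ i ≠ 0) (hk : ∀ k, |ξ k| ≤ |ξ i|) (j : ℕ) :
    ∑ ℓ : ShearParam i j, ‖(𝓕 (S.atom ⟨i, j, ℓ⟩) : 𝓢(Eucl d, ℂ)) ξ‖ ^ 2 =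
      ‖S.psi1Hat ((4 ^ j)⁻¹ * ξ i)‖ ^ 2 := by
  have h : ∀ ℓ : ShearParam i j, ‖(𝓕 (S.atom ⟨i, j, ℓ⟩) : 𝓢(Eucl d, ℂ)) ξ‖ ^ 2 =
      ‖S.psi1Hat ((4 ^ j)⁻¹ * ξ i)‖ ^ 2 *
        ∏ k : {k : Fin d // k ≠ i}, S.beta (2 ^ j * ξ k / ξ i - ℓ.1 k) :=
    fun ℓ => S.norm_fourier_atom_sq ⟨i, j, ℓ⟩ hξ
  rw [Finset.sum_congr rfl fun ℓ _ => h ℓ, ← Finset.mul_sum,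
    S.sum_prod_beta i j fun k => 2 ^ j * ξ k / ξ i, Finset.prod_eq_one, mul_one]
  intro k _
  refine S.shearSum_eq_one ?_
  rw [abs_div, abs_mul, abs_of_pos (by positivity : (0 : ℝ) < 2 ^ j), mul_div_assoc]
  push_cast
  exact mul_le_of_le_one_right (by positivity) (div_le_one_of_le₀ (hk k) (abs_nonneg _))

/-- All indices of scale at most `J`. -/
def indicesUpTo (d J : ℕ) : Finset (ShearIndex d) :=
  Finset.univ.sigma fun _ => (Finset.range (J + 1)).sigma fun _ => Finset.univ

/-- The energy of the shearlets of scale at most `J` and of the low-pass generator. -/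
def ShearletSystem.energy (S : ShearletSystem d) (J : ℕ) (ξ : Eucl d) : ℝ :=
  ∑ t ∈ indicesUpTo d J, ‖(𝓕 (S.atom t) : 𝓢(Eucl d, ℂ)) ξ‖ ^ 2 +
    ‖(𝓕 S.low : 𝓢(Eucl d, ℂ)) ξ‖ ^ 2

theorem ShearletSystem.contDiff_energy (S : ShearletSystem d) (J : ℕ) :
    ContDiff ℝ ∞ (S.energy J) := by
  unfold ShearletSystem.energy
  exact (ContDiff.sum fun t _ => ((𝓕 (S.atom t) : 𝓢(Eucl d, ℂ)).smooth ⊤).norm_sq ℝ).add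
    (((𝓕 S.low : 𝓢(Eucl d, ℂ)).smooth ⊤).norm_sq ℝ)

/-- If all coordinates are at most `1/8`, the low-pass generator is unimodular. Otherwise, in the
cone of the largest coordinate, the sum over shears and scales equals `1`, and the condition on `J`
ensures that no larger scale is needed. Without sharp cone cutoffs the energy is smooth but may
exceed `1`. -/
theorem ShearletSystem.one_le_energy (S : ShearletSystem d) {J : ℕ} {ξ : Eucl d}
    (hJ : 16 * ‖ξ‖ < 4 ^ (J + 1)) : 1 ≤ S.energy J ξ := by
  unfold ShearletSystem.energy
  by_cases h : ∀ k, |ξ k| ≤ 1 / 8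
  · rw [S.low_unimodular ξ h]
    have : 0 ≤ ∑ t ∈ indicesUpTo d J, ‖(𝓕 (S.atom t) : 𝓢(Eucl d, ℂ)) ξ‖ ^ 2 :=
      Finset.sum_nonneg fun _ _ => by positivity
    linarith
  · push Not at h
    obtain ⟨k₀, hk₀⟩ := h
    have : Nonempty (Fin d) := ⟨k₀⟩
    obtain ⟨i, hi⟩ := Finite.exists_max fun k => |ξ k|
    have hi8 : 1 / 8 < |ξ i| := hk₀.trans_le (hi k₀)
    have hξ : ξ i ≠ 0 := by
      intro h0
      rw [h0, abs_zero] at hi8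
      linarith
    have h1 : ∑ j ∈ Finset.range (J + 1), ‖S.psi1Hat ((4 ^ j)⁻¹ * ξ i)‖ ^ 2 = 1 := by
      refine (hasSum_sum_of_ne_finset_zero fun j hj => ?_).unique (S.psi1Hat_hasSum hi8.le)
      by_contra h0
      refine hj (Finset.mem_range.2 ?_)
      have h2 := (S.psi1Hat_ne_zero (w := ξ i) (j := j) fun hz => h0 (by rw [hz]; simp)).1
      have h3 : (4 : ℝ) ^ j < 4 ^ (J + 1) := by
        linarith [abs_apply_le_norm ξ i]
      exact (pow_lt_pow_iff_right₀ (by norm_num)).1 h3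
    have h2 : ∑ j ∈ Finset.range (J + 1), ∑ ℓ : ShearParam i j,
        ‖(𝓕 (S.atom ⟨i, j, ℓ⟩) : 𝓢(Eucl d, ℂ)) ξ‖ ^ 2 = 1 := by
      rw [← h1]
      exact Finset.sum_congr rfl fun j _ => S.sum_norm_fourier_atom_sq hξ hi j
    have h3 : 1 ≤ ∑ t ∈ indicesUpTo d J, ‖(𝓕 (S.atom t) : 𝓢(Eucl d, ℂ)) ξ‖ ^ 2 := by
      rw [indicesUpTo, Finset.sum_sigma]
      simp only [Finset.sum_sigma]
      rw [← h2]
      exact Finset.single_le_sum (f := fun i => ∑ j ∈ Finset.range (J + 1), ∑ ℓ : ShearParam i j,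
        ‖(𝓕 (S.atom ⟨i, j, ℓ⟩) : 𝓢(Eucl d, ℂ)) ξ‖ ^ 2)
        (fun _ _ => Finset.sum_nonneg fun _ _ => Finset.sum_nonneg fun _ _ => by positivity)
        (Finset.mem_univ i)
    have h4 : 0 ≤ ‖(𝓕 S.low : 𝓢(Eucl d, ℂ)) ξ‖ ^ 2 := by positivity
    linarith

/-- The reconstruction of a band-limited function from finitely many shearlets and the low-pass
generator. -/
theorem exists_finite_reconstruction (S : ShearletSystem d) {φ : 𝓢(Eucl d, ℂ)}
    (h : HasCompactSupport (𝓕 φ : 𝓢(Eucl d, ℂ))) :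
    ∃ (T : Finset (ShearIndex d)) (κ : ShearIndex d → 𝓢(Eucl d, ℂ)) (κ₀ : 𝓢(Eucl d, ℂ)),
      φ = ∑ t ∈ T, sconv (κ t) (invol (S.atom t)) + sconv κ₀ S.low := by
  obtain ⟨R, hR⟩ := h.isCompact.isBounded.subset_closedBall (0 : Eucl d)
  obtain ⟨J, hJ⟩ := exists_nat_ge (16 * R)
  have hJ4 : (J : ℝ) < 4 ^ (J + 1) := by
    have : J < 4 ^ (J + 1) := (Nat.lt_succ_self J).trans (Nat.lt_pow_self (by norm_num))
    exact_mod_cast this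
  -- The canonical dual symbols, divided by the energy. For the low-pass term the conjugate of `Ψ̂`
  -- goes into the symbol, because the norm contains `f * Ψ` and not its involution.
  set m : 𝓢(Eucl d, ℂ) → Eucl d → ℂ := fun ψ ξ =>
    (𝓕 φ : 𝓢(Eucl d, ℂ)) ξ * ((recipCutoff (S.energy J ξ) : ℂ) * (𝓕 ψ : 𝓢(Eucl d, ℂ)) ξ) with hm
  have hmc : ∀ ψ, HasCompactSupport (m ψ) := fun ψ => h.mul_right
  have hms : ∀ ψ, ContDiff ℝ ∞ (m ψ) := fun ψ =>
    ((𝓕 φ : 𝓢(Eucl d, ℂ)).smooth ⊤).mul ((Complex.ofRealCLM.contDiff.comp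
      (contDiff_recipCutoff.comp (S.contDiff_energy J))).mul ((𝓕 ψ : 𝓢(Eucl d, ℂ)).smooth ⊤))
  refine ⟨indicesUpTo d J, fun t => ofFourier (m (S.atom t)) (hmc _) (hms _),
    ofFourier (m (invol S.low)) (hmc _) (hms _), schwartz_ext_fourier fun ξ => ?_⟩
  have hadd : ∀ a b : 𝓢(Eucl d, ℂ), (𝓕 (a + b) : 𝓢(Eucl d, ℂ)) ξ =
      (𝓕 a : 𝓢(Eucl d, ℂ)) ξ + (𝓕 b : 𝓢(Eucl d, ℂ)) ξ := fun a b => by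
    simp only [← SchwartzMap.fourierTransformCLM_apply (𝕜 := ℂ), map_add, add_apply]
  rw [hadd, fourier_sum_apply]
  simp only [fourier_sconv, fourier_ofFourier, fourier_invol, hm]
  by_cases hz : (𝓕 φ : 𝓢(Eucl d, ℂ)) ξ = 0
  · simp [hz]
  · have hξ : ‖ξ‖ ≤ R := mem_closedBall_zero_iff.1 (hR (subset_tsupport _ hz))
    have hE : 1 ≤ S.energy J ξ := S.one_le_energy (by linarith)
    have hone : (recipCutoff (S.energy J ξ) : ℂ) * (S.energy J ξ : ℂ) = 1 := by
      rw [← Complex.ofReal_mul, recipCutoff_mul_self (by linarith), Complex.ofReal_one]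
    have hE2 : (S.energy J ξ : ℂ) = ∑ t ∈ indicesUpTo d J, (𝓕 (S.atom t) : 𝓢(Eucl d, ℂ)) ξ *
        (starRingEnd ℂ) ((𝓕 (S.atom t) : 𝓢(Eucl d, ℂ)) ξ) +
        (starRingEnd ℂ) ((𝓕 S.low : 𝓢(Eucl d, ℂ)) ξ) * (𝓕 S.low : 𝓢(Eucl d, ℂ)) ξ := by
      rw [ShearletSystem.energy]
      push_cast
      simp only [Complex.mul_conj', Complex.conj_mul']
    have : ∑ t ∈ indicesUpTo d J, (𝓕 φ : 𝓢(Eucl d, ℂ)) ξ * ((recipCutoff (S.energy J ξ) : ℂ) *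
          (𝓕 (S.atom t) : 𝓢(Eucl d, ℂ)) ξ) * (starRingEnd ℂ) ((𝓕 (S.atom t) : 𝓢(Eucl d, ℂ)) ξ) +
        (𝓕 φ : 𝓢(Eucl d, ℂ)) ξ * ((recipCutoff (S.energy J ξ) : ℂ) *
          (starRingEnd ℂ) ((𝓕 S.low : 𝓢(Eucl d, ℂ)) ξ)) * (𝓕 S.low : 𝓢(Eucl d, ℂ)) ξ =
        (𝓕 φ : 𝓢(Eucl d, ℂ)) ξ * ((recipCutoff (S.energy J ξ) : ℂ) * (S.energy J ξ : ℂ)) := by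
      rw [hE2, mul_add, mul_add, Finset.mul_sum, Finset.mul_sum]
      congr 1
      · exact Finset.sum_congr rfl fun t _ => by ring
      · ring
    rw [this, hone, mul_one]

end LowFrequencies

/-! ### Summation of geometrically decaying sequences in `L^p(ℓ^q)`. -/

section SequenceNorms

theorem lqNorm_mono {ι : Type*} (q : ℝ≥0∞) {a b : ι → ℝ≥0∞} (h : ∀ k, a k ≤ b k) :
    lqNorm q a ≤ lqNorm q b := by
  unfold lqNorm
  split_ifs
  · exact iSup_mono h
  · exact ENNReal.rpow_le_rpow (ENNReal.tsum_le_tsum fun k =>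
      ENNReal.rpow_le_rpow (h k) ENNReal.toReal_nonneg) (by positivity)

theorem lqNorm_const_mul {ι : Type*} {q : ℝ≥0∞} (hq : 0 < q) (c : ℝ≥0∞) (a : ι → ℝ≥0∞) :
    lqNorm q (fun k => c * a k) = c * lqNorm q a := by
  unfold lqNorm
  split_ifs with h
  · rw [ENNReal.mul_iSup]
  · have hq' : 0 < q.toReal := ENNReal.toReal_pos hq.ne' h
    simp only [ENNReal.mul_rpow_of_nonneg _ _ hq'.le]
    rw [ENNReal.tsum_mul_left, ENNReal.mul_rpow_of_nonneg _ _ (by positivity), ← ENNReal.rpow_mul,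
      mul_one_div_cancel hq'.ne', ENNReal.rpow_one]

theorem lqNorm_comp_le {ι ι' : Type*} (q : ℝ≥0∞) {e : ι' → ι} (he : Function.Injective e)
    (a : ι → ℝ≥0∞) : lqNorm q (fun k => a (e k)) ≤ lqNorm q a := by
  unfold lqNorm
  split_ifs
  · exact iSup_comp_le a e
  · exact ENNReal.rpow_le_rpow (ENNReal.tsum_comp_le_tsum_of_injective he _) (by positivity)

theorem sum_rpow_le_card_rpow_mul {ι : Type*} (s : Finset ι) (a : ι → ℝ≥0∞) {p : ℝ} (hp : 0 < p) :
    (∑ k ∈ s, a k) ^ p ≤ (s.card : ℝ≥0∞) ^ p * ∑ k ∈ s, a k ^ p := by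
  rcases s.eq_empty_or_nonempty with rfl | hs
  · simp [hp]
  obtain ⟨m, hm, hmax⟩ := s.exists_max_image a hs
  have h1 : ∑ k ∈ s, a k ≤ s.card * a m := by
    refine (Finset.sum_le_card_nsmul s a (a m) hmax).trans_eq ?_
    rw [nsmul_eq_mul]
  refine (ENNReal.rpow_le_rpow h1 hp.le).trans ?_
  rw [ENNReal.mul_rpow_of_nonneg _ _ hp.le]
  exact mul_le_mul_right (Finset.single_le_sum (f := fun k => a k ^ p) (fun _ _ => zero_le) hm) _

theorem tsum_two_rpow_ne_top {δ : ℝ} (hδ : 0 < δ) :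
    ∑' ν : ℕ, (2 : ℝ≥0∞) ^ (-((ν : ℝ) * δ)) ≠ ⊤ := by
  have h : ∀ ν : ℕ, (2 : ℝ≥0∞) ^ (-((ν : ℝ) * δ)) = ((2 : ℝ≥0∞) ^ (-δ)) ^ ν := fun ν => by
    rw [← ENNReal.rpow_natCast, ← ENNReal.rpow_mul]
    congr 1; ring
  simp only [h]
  rw [ENNReal.tsum_geometric, ENNReal.inv_ne_top, ne_eq, tsub_eq_zero_iff_le, not_le]
  exact ENNReal.rpow_lt_one_of_one_lt_of_neg (by norm_num) (by linarith)

/-- Geometrically decaying pieces can be summed in `L^p(ℓ^q)`. -/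
theorem exists_lintegral_lqNorm_le {α : Type*} [MeasurableSpace α] (μ : Measure α) {p δ : ℝ}
    (hp : 0 < p) (hδ : 0 < δ) {q : ℝ≥0∞} (hq : 0 < q) :
    ∃ C : ℝ≥0, ∀ (c : ℕ → α → ℝ≥0∞) (K : ℝ≥0∞), (∀ ν, Measurable (c ν)) →
      (∀ ν : ℕ, ∫⁻ x, c ν x ^ p ∂μ ≤ 2 ^ (-((ν : ℝ) * δ)) * K) →
      ∫⁻ x, (lqNorm q fun ν => c ν x) ^ p ∂μ ≤ C * K := by
  -- Half of the decay makes the numerical sequence `2^(-νδ')` lie in `ℓ^q`; the other half sums the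
  -- integrals, once the supremum of `2^(νδ') c ν` to the power `p` is replaced by a sum over `ν`.
  set δ' := δ / 2 / p with hδ'
  have hδ'0 : 0 < δ' := by positivity
  have hB : lqNorm q (fun ν : ℕ => (2 : ℝ≥0∞) ^ (-((ν : ℝ) * δ'))) ≠ ⊤ := by
    unfold lqNorm
    split_ifs with h
    · refine ne_top_of_le_ne_top ENNReal.one_ne_top (iSup_le fun ν => ?_)
      rw [← ENNReal.rpow_zero (x := 2)]
      refine ENNReal.rpow_le_rpow_of_exponent_le (by norm_num) ?_
      have : 0 ≤ (ν : ℝ) * δ' := by positivity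
      linarith
    · have hq' : 0 < q.toReal := ENNReal.toReal_pos hq.ne' h
      refine ENNReal.rpow_ne_top_of_nonneg (by positivity) ?_
      have e : ∀ ν : ℕ, ((2 : ℝ≥0∞) ^ (-((ν : ℝ) * δ'))) ^ q.toReal =
          2 ^ (-((ν : ℝ) * (δ' * q.toReal))) := fun ν => by
        rw [← ENNReal.rpow_mul]; congr 1; ring
      simp only [e]
      exact tsum_two_rpow_ne_top (by positivity)
  set B := lqNorm q (fun ν : ℕ => (2 : ℝ≥0∞) ^ (-((ν : ℝ) * δ'))) with hBd
  set G := ∑' ν : ℕ, (2 : ℝ≥0∞) ^ (-((ν : ℝ) * (δ / 2))) with hG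
  have hGt : G ≠ ⊤ := tsum_two_rpow_ne_top (by positivity)
  have hBp : B ^ p ≠ ⊤ := ENNReal.rpow_ne_top_of_nonneg hp.le hB
  refine ⟨(B ^ p).toNNReal * G.toNNReal, fun c K hc hK => ?_⟩
  have hpt : ∀ x, (lqNorm q fun ν => c ν x) ^ p ≤
      B ^ p * ∑' ν : ℕ, 2 ^ ((ν : ℝ) * (δ / 2)) * c ν x ^ p := by
    intro x
    set M := ⨆ ν : ℕ, (2 : ℝ≥0∞) ^ ((ν : ℝ) * δ') * c ν x with hM
    have h1 : lqNorm q (fun ν => c ν x) ≤ M * B := by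
      rw [hBd, ← lqNorm_const_mul hq]
      refine lqNorm_mono q fun ν => ?_
      calc c ν x = (2 ^ ((ν : ℝ) * δ') * 2 ^ (-((ν : ℝ) * δ'))) * c ν x := by
            rw [← ENNReal.rpow_add _ _ (by norm_num) (by norm_num), add_neg_cancel,
              ENNReal.rpow_zero, one_mul]
        _ = (2 ^ ((ν : ℝ) * δ') * c ν x) * 2 ^ (-((ν : ℝ) * δ')) := by ring
        _ ≤ _ := mul_le_mul_left (le_iSup (fun ν : ℕ => (2 : ℝ≥0∞) ^ ((ν : ℝ) * δ') * c ν x) ν) _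
    refine (ENNReal.rpow_le_rpow h1 hp.le).trans ?_
    rw [ENNReal.mul_rpow_of_nonneg _ _ hp.le, mul_comm]
    refine mul_le_mul_right ?_ _
    rw [← ENNReal.le_rpow_inv_iff hp]
    refine iSup_le fun ν => ?_
    rw [ENNReal.le_rpow_inv_iff hp, ENNReal.mul_rpow_of_nonneg _ _ hp.le, ← ENNReal.rpow_mul]
    have e : (ν : ℝ) * δ' * p = ν * (δ / 2) := by rw [hδ']; field_simp
    rw [e]
    exact ENNReal.le_tsum (f := fun ν : ℕ => (2 : ℝ≥0∞) ^ ((ν : ℝ) * (δ / 2)) * c ν x ^ p) ν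
  have hcm : ∀ ν : ℕ, Measurable fun x => (2 : ℝ≥0∞) ^ ((ν : ℝ) * (δ / 2)) * c ν x ^ p := fun ν =>
    measurable_const.mul ((hc ν).pow_const p)
  calc ∫⁻ x, (lqNorm q fun ν => c ν x) ^ p ∂μ
      ≤ ∫⁻ x, B ^ p * ∑' ν : ℕ, 2 ^ ((ν : ℝ) * (δ / 2)) * c ν x ^ p ∂μ := lintegral_mono hpt
    _ = B ^ p * ∑' ν : ℕ, 2 ^ ((ν : ℝ) * (δ / 2)) * ∫⁻ x, c ν x ^ p ∂μ := by
        rw [lintegral_const_mul' _ _ hBp, lintegral_tsum fun ν => (hcm ν).aemeasurable]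
        congr 2
        ext ν
        rw [lintegral_const_mul _ ((hc ν).pow_const p)]
    _ ≤ B ^ p * ∑' ν : ℕ, 2 ^ (-((ν : ℝ) * (δ / 2))) * K := by
        refine mul_le_mul_right (ENNReal.tsum_le_tsum fun ν => ?_) _
        calc (2 : ℝ≥0∞) ^ ((ν : ℝ) * (δ / 2)) * ∫⁻ x, c ν x ^ p ∂μ
            ≤ 2 ^ ((ν : ℝ) * (δ / 2)) * (2 ^ (-((ν : ℝ) * δ)) * K) := mul_le_mul_right (hK ν) _
          _ = _ := by
              rw [← mul_assoc, ← ENNReal.rpow_add _ _ (by norm_num) (by norm_num)]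
              congr 2; ring
    _ = _ := by
        rw [ENNReal.tsum_mul_right, ENNReal.coe_mul, ENNReal.coe_toNNReal hBp,
          ENNReal.coe_toNNReal hGt, mul_assoc]

end SequenceNorms

/-! ### Bounds for fixed band-limited convolutions and for single scales. -/

section Estimates

variable {d : ℕ}

theorem measurable_peetre {g : Eucl d → ℂ} (hg : Continuous g) (L : ℝ) :
    Measurable (peetre L g) := by
  refine LowerSemicontinuous.measurable (lowerSemicontinuous_iSup fun y => ?_)
  refine Continuous.lowerSemicontinuous ?_
  exact (ENNReal.continuous_mul_const (jap_rpow_ne_top y (-L))).comp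
    (hg.comp (continuous_id.sub continuous_const)).enorm

theorem pullback_one (f : 𝓢'(Eucl d, ℂ)) : pullback 1 f = f :=
  DFunLike.ext _ _ fun η => by rw [pullback_apply, dilate_one]

/-- Convolution with a Schwartz function is bounded in `L^p` on band-limited distributions. -/
theorem exists_lintegral_conv_sconv_le {p : ℝ} (hp : 0 < p) (κ : 𝓢(Eucl d, ℂ)) {ψ : 𝓢(Eucl d, ℂ)}
    (hψ : HasCompactSupport (𝓕 ψ : 𝓢(Eucl d, ℂ))) : ∃ C : ℝ≥0, ∀ f : 𝓢'(Eucl d, ℂ),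
      ∫⁻ x, ‖conv f (sconv κ ψ) x‖ₑ ^ p ≤ C * ∫⁻ x, ‖conv f ψ x‖ₑ ^ p := by
  -- Young's inequality fails directly for `p < 1`. Band limitation allows means of `|f * ψ|^r` with
  -- `p / r > 1` instead, and `L` is such that `L r = d + 10` exceeds the dimension.
  set r := min 1 p / 2 with hr
  have hr0 : 0 < r := by positivity
  have hr1 : r ≤ 1 := by linarith [min_le_left 1 p]
  have hrp : r ≤ p := by linarith [min_le_right 1 p]
  set L : ℝ := (d + 10) / r with hL
  have hL0 : 0 ≤ L := by positivity
  have hLr : L * r = d + 10 := div_mul_cancel₀ _ hr0.ne'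
  obtain ⟨θ, hθ⟩ := exists_sconv_eq_self hψ
  obtain ⟨C, hC⟩ := exists_peetre_pullback_le hL0 hr0 hr1 hθ
  have hK : ∫⁻ y : Eucl d, jap y ^ (-(L * r)) ≠ ⊤ := lintegral_jap_ne_top (by rw [hLr]; simp)
  set K := ∫⁻ y : Eucl d, jap y ^ (-(L * r)) with hKd
  have hκ := kernelNorm_ne_top L κ
  have hp1 : 0 ≤ p / r := by positivity
  have hcon : kernelNorm L κ ^ p * ((C : ℝ≥0∞) ^ (p / r) * K ^ (p / r)) ≠ ⊤ :=
    ENNReal.mul_ne_top (ENNReal.rpow_ne_top_of_nonneg hp.le hκ) (ENNReal.mul_ne_top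
      (ENNReal.rpow_ne_top_of_nonneg hp1 ENNReal.coe_ne_top) (ENNReal.rpow_ne_top_of_nonneg hp1 hK))
  refine ⟨(kernelNorm L κ ^ p * ((C : ℝ≥0∞) ^ (p / r) * K ^ (p / r))).toNNReal, fun f => ?_⟩
  rw [ENNReal.coe_toNNReal hcon]
  have hpt : ∀ x, ‖conv f (sconv κ ψ) x‖ₑ ^ p ≤ kernelNorm L κ ^ p * ((C : ℝ≥0∞) ^ (p / r) *
      matMean 1 (L * r) (fun y => ‖conv f ψ y‖ₑ ^ r) x ^ (p / r)) := by
    intro x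
    have h1 := (enorm_le_peetre_self L (conv f (sconv κ ψ)) x).trans (peetre_conv_sconv_le hL0 f κ ψ x)
    have h2 := hC f 1 x
    rw [inv_one, matEquiv_one_apply, pullback_one, dilate_one] at h2
    refine (ENNReal.rpow_le_rpow h1 hp.le).trans ?_
    rw [ENNReal.mul_rpow_of_nonneg _ _ hp.le]
    refine mul_le_mul_right ?_ _
    rw [← ENNReal.mul_rpow_of_nonneg _ _ hp1]
    refine le_trans (le_of_eq ?_) (ENNReal.rpow_le_rpow h2 hp1)
    rw [← ENNReal.rpow_mul, mul_div_cancel₀ _ hr0.ne']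
  have hm : Measurable fun y => ‖conv f ψ y‖ₑ ^ r := (measurable_enorm_conv f ψ).pow_const _
  have hKp : kernelNorm L κ ^ p ≠ ⊤ := ENNReal.rpow_ne_top_of_nonneg hp.le hκ
  have hCp : (C : ℝ≥0∞) ^ (p / r) ≠ ⊤ := ENNReal.rpow_ne_top_of_nonneg hp1 ENNReal.coe_ne_top
  refine (lintegral_mono hpt).trans ?_
  rw [lintegral_const_mul' _ _ hKp, lintegral_const_mul' _ _ hCp, mul_assoc, mul_assoc]
  refine mul_le_mul_right (mul_le_mul_right ?_ _) _
  refine (lintegral_matMean_rpow_le 1 (L * r) hm (by rw [one_le_div hr0]; exact hrp)).trans_eq ?_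
  congr 1
  refine lintegral_congr fun y => ?_
  rw [← ENNReal.rpow_mul, mul_div_cancel₀ _ hr0.ne']

/-- The `p`-th power of the high-frequency part of the shear anisotropic quasi-norm. -/
def shearEnergy (S : ShearletSystem d) (α p : ℝ) (q : ℝ≥0∞) (f : 𝓢'(Eucl d, ℂ)) : ℝ≥0∞ :=
  ∫⁻ x, (lqNorm q fun t : ShearIndex d =>
    ENNReal.ofReal (cellVolume d t.2.1 ^ (-α)) * ‖conv f (invol (S.atom t)) x‖ₑ) ^ p

theorem ofReal_cellVolume_rpow (d j : ℕ) (α : ℝ) :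
    ENNReal.ofReal (cellVolume d j ^ (-α)) = 2 ^ ((j : ℝ) * ((d + 1) * α)) := by
  have h1 : cellVolume d j ^ (-α) = (2 : ℝ) ^ ((j : ℝ) * ((d + 1) * α)) := by
    rw [cellVolume, Real.inv_rpow (by positivity), Real.rpow_neg (by positivity), inv_inv,
      ← Real.rpow_natCast, ← Real.rpow_mul (by norm_num)]
    congr 1
    push_cast
    ring
  rw [h1, ← ENNReal.ofReal_rpow_of_pos (by norm_num)]
  simp

/-- One direction and one scale form a subfamily of the full `ℓ^q` sum, on which the weight
`|Q_j|^(-α) = 2^(j(d+1)α)` is constant. -/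
theorem lintegral_lqNorm_scale_le (S : ShearletSystem d) (α : ℝ) {p : ℝ} (hp : 0 < p) {q : ℝ≥0∞}
    (hq : 0 < q) (f : 𝓢'(Eucl d, ℂ)) (i : Fin d) (j : ℕ) :
    ∫⁻ x, (lqNorm q fun ℓ : ShearParam i j => ‖conv f (invol (S.atom ⟨i, j, ℓ⟩)) x‖ₑ) ^ p ≤
      2 ^ (-((j : ℝ) * ((d + 1) * α) * p)) * shearEnergy S α p q f := by
  have hne : (2 : ℝ≥0∞) ^ (-((j : ℝ) * ((d + 1) * α) * p)) ≠ ⊤ :=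
    ENNReal.rpow_ne_top_of_ne_zero (by norm_num) (by norm_num)
  rw [shearEnergy, ← lintegral_const_mul' _ _ hne]
  refine lintegral_mono fun x => ?_
  have h1 : (2 : ℝ≥0∞) ^ ((j : ℝ) * ((d + 1) * α)) *
      (lqNorm q fun ℓ : ShearParam i j => ‖conv f (invol (S.atom ⟨i, j, ℓ⟩)) x‖ₑ) ≤
      lqNorm q fun t : ShearIndex d =>
        ENNReal.ofReal (cellVolume d t.2.1 ^ (-α)) * ‖conv f (invol (S.atom t)) x‖ₑ := by
    rw [← lqNorm_const_mul hq, ← ofReal_cellVolume_rpow]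
    have he : Function.Injective fun ℓ : ShearParam i j => (⟨i, j, ℓ⟩ : ShearIndex d) := by
      intro ℓ ℓ' h
      simpa using h
    exact lqNorm_comp_le q he fun t : ShearIndex d =>
        ENNReal.ofReal (cellVolume d t.2.1 ^ (-α)) * ‖conv f (invol (S.atom t)) x‖ₑ
  have h2 := mul_le_mul_right (ENNReal.rpow_le_rpow h1 hp.le)
    ((2 : ℝ≥0∞) ^ (-((j : ℝ) * ((d + 1) * α) * p)))
  refine le_trans (le_of_eq ?_) h2
  rw [ENNReal.mul_rpow_of_nonneg _ _ hp.le, ← ENNReal.rpow_mul, ← mul_assoc,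
    ← ENNReal.rpow_add _ _ (by norm_num) (by norm_num), neg_add_cancel, ENNReal.rpow_zero, one_mul]

theorem hasCompactSupport_fourier_dilate (M : GL (Fin d) ℝ) {ψ : 𝓢(Eucl d, ℂ)}
    (h : HasCompactSupport (𝓕 ψ : 𝓢(Eucl d, ℂ))) :
    HasCompactSupport (𝓕 (dilate M ψ) : 𝓢(Eucl d, ℂ)) := by
  have hcont : Continuous (dualPoint M⁻¹) := by
    unfold dualPoint
    fun_prop
  refine HasCompactSupport.intro (h.isCompact.image hcont) fun ξ hξ => ?_
  rw [fourier_dilate]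
  refine image_eq_zero_of_notMem_tsupport fun hmem => hξ ⟨_, hmem, ?_⟩
  exact dualPoint_inv_dualPoint M ξ

/-- The `L^p` bound of a band-limited convolution by the shear anisotropic quasi-norm. -/
theorem exists_lintegral_conv_le (S : ShearletSystem d) (α : ℝ) {p : ℝ} (hp : 0 < p) {q : ℝ≥0∞}
    (hq : 0 < q) {φ : 𝓢(Eucl d, ℂ)} (hφ : HasCompactSupport (𝓕 φ : 𝓢(Eucl d, ℂ))) :
    ∃ C : ℝ≥0, ∀ f : 𝓢'(Eucl d, ℂ), ∫⁻ x, ‖conv f φ x‖ₑ ^ p ≤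
      C * (shearEnergy S α p q f + ∫⁻ x, ‖conv f S.low x‖ₑ ^ p) := by
  obtain ⟨T, κ, κ₀, hrec⟩ := exists_finite_reconstruction S hφ
  have hatom : ∀ t, HasCompactSupport (𝓕 (invol (S.atom t)) : 𝓢(Eucl d, ℂ)) := fun t =>
    hasCompactSupport_fourier_invol (hasCompactSupport_fourier_dilate _ (S.hasCompactSupport_cone _))
  choose Ct hCt using fun t => exists_lintegral_conv_sconv_le hp (κ t) (hatom t)
  obtain ⟨C₀, hC₀⟩ := exists_lintegral_conv_sconv_le hp κ₀ S.hasCompactSupport_low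
  set W : ShearIndex d → ℝ≥0 := fun t => (2 : ℝ≥0) ^ (-((t.2.1 : ℝ) * ((d + 1) * α) * p)) with hW
  refine ⟨2 ^ p * (T.card ^ p * ∑ t ∈ T, Ct t * W t + C₀), fun f => ?_⟩
  set X := shearEnergy S α p q f with hX
  set Y := ∫⁻ x, ‖conv f S.low x‖ₑ ^ p with hY
  have hsplit : ∀ a b : ℝ≥0∞, (a + b) ^ p ≤ 2 ^ p * (a ^ p + b ^ p) := fun a b => by
    simpa using sum_rpow_le_card_rpow_mul (Finset.univ : Finset (Fin 2)) ![a, b] hp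
  have hpt : ∀ x, ‖conv f φ x‖ₑ ^ p ≤ 2 ^ p * ((T.card : ℝ≥0∞) ^ p *
      ∑ t ∈ T, ‖conv f (sconv (κ t) (invol (S.atom t))) x‖ₑ ^ p +
      ‖conv f (sconv κ₀ S.low) x‖ₑ ^ p) := by
    intro x
    have hadd : conv f φ x = ∑ t ∈ T, conv f (sconv (κ t) (invol (S.atom t))) x +
        conv f (sconv κ₀ S.low) x := by
      rw [← conv_finset_sum, hrec, conv_eq_convZero, conv_eq_convZero, conv_eq_convZero]
      simp only [map_add]
    rw [hadd]
    refine (ENNReal.rpow_le_rpow (enorm_add_le _ _) hp.le).trans ((hsplit _ _).trans ?_)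
    refine mul_le_mul_right (add_le_add_left ?_ _) _
    refine (ENNReal.rpow_le_rpow (enorm_sum_le _ _) hp.le).trans ?_
    exact sum_rpow_le_card_rpow_mul T _ hp
  have hm : ∀ ψ : 𝓢(Eucl d, ℂ), Measurable fun x => ‖conv f ψ x‖ₑ ^ p := fun ψ =>
    (measurable_enorm_conv f ψ).pow_const p
  have h2p : (2 : ℝ≥0∞) ^ p ≠ ⊤ := ENNReal.rpow_ne_top_of_nonneg hp.le (by norm_num)
  have hTp : (T.card : ℝ≥0∞) ^ p ≠ ⊤ := ENNReal.rpow_ne_top_of_nonneg hp.le (by simp)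
  have hone : ∀ t, ∫⁻ x, ‖conv f (sconv (κ t) (invol (S.atom t))) x‖ₑ ^ p ≤ Ct t * (W t * X) := by
    intro t
    obtain ⟨i, j, ℓ⟩ := t
    refine (hCt _ f).trans (mul_le_mul_right ?_ _)
    have h3 : ((W ⟨i, j, ℓ⟩ : ℝ≥0) : ℝ≥0∞) = 2 ^ (-((j : ℝ) * ((d + 1) * α) * p)) := by
      simp only [hW]
      rw [ENNReal.coe_rpow_of_ne_zero (by norm_num)]
      rfl
    rw [h3]
    refine le_trans (lintegral_mono fun x => ENNReal.rpow_le_rpow ?_ hp.le)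
      (lintegral_lqNorm_scale_le S α hp hq f i j)
    exact le_lqNorm hq (fun ℓ : ShearParam i j => ‖conv f (invol (S.atom ⟨i, j, ℓ⟩)) x‖ₑ) ℓ
  calc ∫⁻ x, ‖conv f φ x‖ₑ ^ p
      ≤ ∫⁻ x, 2 ^ p * ((T.card : ℝ≥0∞) ^ p *
        ∑ t ∈ T, ‖conv f (sconv (κ t) (invol (S.atom t))) x‖ₑ ^ p +
        ‖conv f (sconv κ₀ S.low) x‖ₑ ^ p) := lintegral_mono hpt
    _ = 2 ^ p * ((T.card : ℝ≥0∞) ^ p *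
        ∑ t ∈ T, (∫⁻ x, ‖conv f (sconv (κ t) (invol (S.atom t))) x‖ₑ ^ p) +
        (∫⁻ x, ‖conv f (sconv κ₀ S.low) x‖ₑ ^ p)) := by
        rw [lintegral_const_mul' _ _ h2p, lintegral_add_right _ (hm _), lintegral_const_mul' _ _ hTp,
          lintegral_finsetSum _ fun t _ => hm _]
    _ ≤ 2 ^ p * ((T.card : ℝ≥0∞) ^ p * ∑ t ∈ T, Ct t * (W t * (X + Y)) + C₀ * (X + Y)) := by
        refine mul_le_mul_right (add_le_add (mul_le_mul_right (Finset.sum_le_sum fun t _ =>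
          (hone t).trans (mul_le_mul_right (mul_le_mul_right le_self_add _) _)) _) ?_) _
        exact (hC₀ f).trans (mul_le_mul_right le_add_self _)
    _ = _ := by
        rw [ENNReal.coe_mul, ENNReal.coe_add, ENNReal.coe_mul, ENNReal.coe_rpow_of_nonneg _ hp.le,
          ENNReal.coe_rpow_of_nonneg _ hp.le]
        push_cast
        rw [mul_assoc, add_mul, mul_assoc, Finset.sum_mul]
        simp only [mul_assoc]

end Estimates

/-! ### Geometric decay of the Littlewood–Paley pieces. -/

section HighFrequencies

variable {d : ℕ}

theorem exists_uniform_single_scale_le (hd : 2 ≤ d) {p : ℝ} (hp : 0 < p) {q : ℝ≥0∞}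
    (hq : 0 < q) {Λ : ℝ} (hΛ : (d : ℝ) + 10 ≤ Λ) (C₁ : Fin d → ℝ≥0) :
    ∃ τ < p * ((d - 1) * (1 + max 0 (1 - (1 / q).toReal))), ∃ C : ℝ≥0,
      ∀ (i : Fin d) (j : ℕ) (g a : ShearParam i j → Eucl d → ℝ≥0∞), (∀ ℓ, Measurable (g ℓ)) →
      (∀ ℓ x, a ℓ x ^ (min 1 p / 2) ≤
        C₁ i * matMean (indexGL ⟨i, j, ℓ⟩) Λ (fun y => g ℓ y ^ (min 1 p / 2)) x) →
      ∫⁻ x, (∑ ℓ, a ℓ x) ^ p ≤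
        C * 2 ^ ((j : ℝ) * τ) * ∫⁻ x, (lqNorm q fun ℓ => g ℓ x) ^ p := by
  choose τ hτ hC using fun i => exists_single_scale_le hd i hp hq hΛ
  choose C hC using fun i => hC i (C₁ i)
  have : Nonempty (Fin d) := ⟨⟨0, by omega⟩⟩
  obtain ⟨i₀, hi₀⟩ := Finite.exists_max τ
  refine ⟨τ i₀, hτ i₀, ∑ i, C i, fun i j g a hg ha => (hC i j g a hg ha).trans ?_⟩
  refine mul_le_mul_left (mul_le_mul' ?_ ?_) _
  · exact_mod_cast Finset.single_le_sum (f := C) (fun _ _ => zero_le) (Finset.mem_univ i)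
  · exact ENNReal.rpow_le_rpow_of_exponent_le (by norm_num)
      (mul_le_mul_of_nonneg_left (hi₀ i) (Nat.cast_nonneg j))

/-- The scales `j` that interact with the frequencies of size `2 ^ ν` satisfy `2 * j = ν + O(1)`. -/
theorem abs_two_mul_scale_sub_le {ν : ℕ} (hν : 8 * d ≤ ν) (a : Fin (d + 4)) :
    |2 * ((ν / 2 - d + a : ℕ) : ℝ) - ν| ≤ 2 * d + 9 := by
  have ha := a.2
  have h1 : ν ≤ 2 * (ν / 2 - d + a) + (2 * d + 9) := by omega
  have h2 : 2 * (ν / 2 - d + a) ≤ ν + (2 * d + 9) := by omega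
  have h1' : (ν : ℝ) ≤ 2 * ((ν / 2 - d + a : ℕ) : ℝ) + (2 * d + 9) := by exact_mod_cast h1
  have h2' : 2 * ((ν / 2 - d + a : ℕ) : ℝ) ≤ ν + (2 * d + 9) := by exact_mod_cast h2
  rw [abs_le]
  constructor <;> linarith

/-- The Littlewood-Paley pieces of high frequency decay geometrically relative to the shear
anisotropic quasi-norm. -/
theorem exists_lintegral_dyadic_le (hd : 2 ≤ d) (D : DyadicPair d) (S : ShearletSystem d)
    (α₁ α₂ : ℝ) {p : ℝ} (hp : 0 < p) {q : ℝ≥0∞} (hq : 0 < q)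
    (hα : 2 * α₁ + d + (d - 1) * max 0 (1 - (1 / q).toReal) ≤ (d + 1) * α₂ + 1) :
    ∃ δ > 0, ∃ C : ℝ≥0, ∀ ν : ℕ, 8 * d ≤ ν → ∀ f : 𝓢'(Eucl d, ℂ),
      ∫⁻ x, (2 ^ ((ν : ℝ) * α₁) * ‖conv f (dyadicDilate ν D.bandPass) x‖ₑ) ^ p ≤
        2 ^ (-((ν : ℝ) * δ)) * (C * shearEnergy S α₂ p q f) := by
  set r := min 1 p / 2 with hr
  have hr0 : 0 < r := by positivity
  have hr1 : r ≤ 1 := by linarith [min_le_left 1 p]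
  set L : ℝ := (d + 10) / r with hL
  have hL0 : 0 ≤ L := by positivity
  have hLr : L * r = d + 10 := div_mul_cancel₀ _ hr0.ne'
  choose θ hθ using fun i => exists_sconv_eq_self
    (hasCompactSupport_fourier_invol (S.hasCompactSupport_cone i))
  choose C₁ hC₁ using fun i => exists_peetre_pullback_le hL0 hr0 hr1 (hθ i)
  obtain ⟨τ, hτ, C, hC⟩ := exists_uniform_single_scale_le hd hp hq hLr.ge C₁
  obtain ⟨B, hB⟩ := exists_dyadic_reconstruction D S hL0
  set m := max 0 (1 - (1 / q).toReal) with hm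
  -- The net factor at scale `j` is `2^(jβ)`: the loss `τ` less the shear weight. Since `2j = ν +
  -- O(1)`, it combines with `2^(να₁p)` to `2^(-νδ)` up to a constant. The strict bound on `τ` makes
  -- `δ` positive even if equality holds in the hypothesis.
  set β := τ - (d + 1) * α₂ * p with hβ
  set δ := -(α₁ * p + β / 2) with hδ
  have hδ0 : 0 < δ := by
    have h1 := mul_le_mul_of_nonneg_left hα hp.le
    have h2 : p * ((d - 1) * (1 + m)) = p * d - p + p * ((d - 1) * m) := by ring
    rw [hδ, hβ]
    nlinarith
  set N : ℝ≥0 := (Fintype.card (Fin d × Fin (d + 4)) : ℝ≥0) with hN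
  -- This pays for replacing `j` by `ν / 2`.
  set E : ℝ≥0 := 2 ^ ((2 * d + 9) * |β| / 2) with hE
  refine ⟨δ, hδ0, (B * B) ^ p * (N ^ p * (N * (C * E))), fun ν hν f => ?_⟩
  obtain ⟨κ, κ', hκ, hrec⟩ := hB ν hν
  set X := shearEnergy S α₂ p q f with hX
  set A : ShearIndex d → Eucl d → ℝ≥0∞ := fun t x =>
    peetre L (conv (pullback (indexGL t) f) (invol (S.cone t.1))) (matEquiv (indexGL t)⁻¹ x) with hA
  have hAm : ∀ t, Measurable (A t) := fun t =>
    (measurable_peetre (continuous_conv _ _) L).comp (matEquiv (indexGL t)⁻¹).continuous.measurable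
  set F : Fin d × Fin (d + 4) → Eucl d → ℝ≥0∞ := fun s x =>
    ∑ ℓ : ShearParam s.1 (ν / 2 - d + s.2), A ⟨s.1, ν / 2 - d + s.2, ℓ⟩ x with hF
  have hFm : ∀ s, Measurable fun x => F s x ^ p := fun s =>
    (Finset.measurable_fun_sum _ fun ℓ _ => hAm _).pow_const p
  -- In the coordinates of each index the two kernels cost at most `B` each and leave the Peetre
  -- function of the generator.
  have hpt : ∀ x, ‖conv f (dyadicDilate ν D.bandPass) x‖ₑ ≤ B * B * ∑ s, F s x := by
    intro x
    rw [hrec, conv_finset_sum, Fintype.sum_prod_type, Finset.mul_sum]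
    refine (enorm_sum_le _ _).trans (Finset.sum_le_sum fun i _ => ?_)
    rw [conv_finset_sum, Finset.mul_sum]
    refine (enorm_sum_le _ _).trans (Finset.sum_le_sum fun a _ => ?_)
    rw [conv_finset_sum, Finset.mul_sum]
    refine (enorm_sum_le _ _).trans (Finset.sum_le_sum fun ℓ _ => ?_)
    rw [conv_dilate, mul_assoc]
    refine (enorm_le_peetre_self L _ _).trans ((peetre_conv_sconv_le hL0 _ _ _ _).trans ?_)
    exact mul_le_mul' (hκ i a ℓ).2 ((peetre_conv_sconv_le hL0 _ _ _ _).trans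
      (mul_le_mul_left (hκ i a ℓ).1 _))
  have hFint : ∀ s, ∫⁻ x, F s x ^ p ≤
      C * 2 ^ (((ν / 2 - d + s.2 : ℕ) : ℝ) * β) * X := by
    rintro ⟨i, a⟩
    set j := ν / 2 - d + a with hj
    have h1 := hC i j (fun ℓ x => ‖conv f (invol (S.atom ⟨i, j, ℓ⟩)) x‖ₑ)
      (fun ℓ => A ⟨i, j, ℓ⟩) (fun ℓ => measurable_enorm_conv f _) (fun ℓ x => by
        have h := hC₁ i f (indexGL ⟨i, j, ℓ⟩) x
        rw [← invol_dilate] at h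
        exact h)
    refine h1.trans ((mul_le_mul_right (lintegral_lqNorm_scale_le S α₂ hp hq f i j) _).trans_eq ?_)
    rw [← mul_assoc, mul_assoc (C : ℝ≥0∞), ← ENNReal.rpow_add _ _ (by norm_num) (by norm_num)]
    congr 3
    rw [hβ]; ring
  have hexp : ∀ s : Fin d × Fin (d + 4), (2 : ℝ≥0∞) ^ ((ν : ℝ) * α₁ * p) *
      2 ^ (((ν / 2 - d + s.2 : ℕ) : ℝ) * β) ≤ 2 ^ (-((ν : ℝ) * δ)) * E := by
    intro s
    rw [hE, ENNReal.coe_rpow_of_ne_zero (by norm_num), ENNReal.coe_ofNat,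
      ← ENNReal.rpow_add _ _ (by norm_num) (by norm_num),
      ← ENNReal.rpow_add _ _ (by norm_num) (by norm_num)]
    refine ENNReal.rpow_le_rpow_of_exponent_le (by norm_num) ?_
    have h1 := abs_two_mul_scale_sub_le hν s.2
    set j : ℝ := ((ν / 2 - d + s.2 : ℕ) : ℝ) with hj
    have h2 : (2 * j - ν) * β ≤ (2 * d + 9) * |β| := by
      refine (le_abs_self _).trans ?_
      rw [abs_mul]
      exact mul_le_mul_of_nonneg_right h1 (abs_nonneg β)
    rw [hδ]
    linarith
  have hcon : (((2 : ℝ≥0∞) ^ ((ν : ℝ) * α₁)) ^ p * ((B : ℝ≥0∞) * B) ^ p * (N : ℝ≥0∞) ^ p) ≠ ⊤ := by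
    refine ENNReal.mul_ne_top (ENNReal.mul_ne_top ?_ ?_) ?_
    · exact ENNReal.rpow_ne_top_of_nonneg hp.le
        (ENNReal.rpow_ne_top_of_ne_zero (by norm_num) (by norm_num))
    · exact ENNReal.rpow_ne_top_of_nonneg hp.le (by finiteness)
    · exact ENNReal.rpow_ne_top_of_nonneg hp.le (by finiteness)
  have hNcard : (N : ℝ≥0∞) = ((Finset.univ : Finset (Fin d × Fin (d + 4))).card : ℝ≥0∞) := by
    rw [hN, ENNReal.coe_natCast, Finset.card_univ]
  calc ∫⁻ x, (2 ^ ((ν : ℝ) * α₁) * ‖conv f (dyadicDilate ν D.bandPass) x‖ₑ) ^ p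
      ≤ ∫⁻ x, ((2 : ℝ≥0∞) ^ ((ν : ℝ) * α₁)) ^ p * ((B : ℝ≥0∞) * B) ^ p * (N : ℝ≥0∞) ^ p *
          ∑ s, F s x ^ p := by
        refine lintegral_mono fun x => ?_
        rw [ENNReal.mul_rpow_of_nonneg _ _ hp.le, mul_assoc, mul_assoc]
        refine mul_le_mul_right ?_ _
        refine (ENNReal.rpow_le_rpow (hpt x) hp.le).trans ?_
        rw [ENNReal.mul_rpow_of_nonneg _ _ hp.le, hNcard]
        exact mul_le_mul_right (sum_rpow_le_card_rpow_mul Finset.univ _ hp) _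
    _ = ((2 : ℝ≥0∞) ^ ((ν : ℝ) * α₁)) ^ p * ((B : ℝ≥0∞) * B) ^ p * (N : ℝ≥0∞) ^ p *
          ∑ s, ∫⁻ x, F s x ^ p := by
        rw [lintegral_const_mul' _ _ hcon, lintegral_finsetSum _ fun s _ => hFm s]
    _ ≤ ((2 : ℝ≥0∞) ^ ((ν : ℝ) * α₁)) ^ p * ((B : ℝ≥0∞) * B) ^ p * (N : ℝ≥0∞) ^ p *
          ∑ s : Fin d × Fin (d + 4), C * 2 ^ (((ν / 2 - d + s.2 : ℕ) : ℝ) * β) * X :=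
        mul_le_mul_right (Finset.sum_le_sum fun s _ => hFint s) _
    _ = ((B : ℝ≥0∞) * B) ^ p * (N : ℝ≥0∞) ^ p * ∑ s : Fin d × Fin (d + 4), C * (2 ^ ((ν : ℝ) * α₁ * p) *
          2 ^ (((ν / 2 - d + s.2 : ℕ) : ℝ) * β)) * X := by
        rw [ENNReal.rpow_mul 2 ((ν : ℝ) * α₁) p]
        simp only [Finset.mul_sum]
        refine Finset.sum_congr rfl fun s _ => ?_
        ring
    _ ≤ ((B : ℝ≥0∞) * B) ^ p * (N : ℝ≥0∞) ^ p *
          ∑ s : Fin d × Fin (d + 4), C * (2 ^ (-((ν : ℝ) * δ)) * E) * X :=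
        mul_le_mul_right (Finset.sum_le_sum fun s _ =>
          mul_le_mul_left (mul_le_mul_right (hexp s) _) _) _
    _ = _ := by
        rw [Finset.sum_const, nsmul_eq_mul, ← hNcard]
        push_cast
        rw [ENNReal.coe_rpow_of_nonneg _ hp.le, ENNReal.coe_rpow_of_nonneg _ hp.le]
        push_cast
        ring

/-- The Littlewood-Paley pieces decay geometrically relative to the shear anisotropic quasi-norm. -/
theorem exists_lintegral_bandPass_le (hd : 2 ≤ d) (D : DyadicPair d) (S : ShearletSystem d)
    (α₁ α₂ : ℝ) {p : ℝ} (hp : 0 < p) {q : ℝ≥0∞} (hq : 0 < q)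
    (hα : 2 * α₁ + d + (d - 1) * max 0 (1 - (1 / q).toReal) ≤ (d + 1) * α₂ + 1) :
    ∃ δ > 0, ∃ C : ℝ≥0, ∀ (ν : ℕ) (f : 𝓢'(Eucl d, ℂ)),
      ∫⁻ x, (2 ^ ((ν : ℝ) * α₁) * ‖conv f (dyadicDilate ν D.bandPass) x‖ₑ) ^ p ≤
        2 ^ (-((ν : ℝ) * δ)) *
          (C * (shearEnergy S α₂ p q f + ∫⁻ x, ‖conv f S.low x‖ₑ ^ p)) := by
  obtain ⟨δ, hδ, C, hC⟩ := exists_lintegral_dyadic_le hd D S α₁ α₂ hp hq hα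
  choose K hK using fun ν => exists_lintegral_conv_le S α₂ hp hq
    (hasCompactSupport_fourier_dyadicDilate D ν)
  -- The finitely many pieces with `ν < 8d` come from the finite reconstruction; the factor `2^(νδ)`
  -- only brings them to the common form.
  set W : ℕ → ℝ≥0 := fun ν => 2 ^ ((ν : ℝ) * δ) * (2 ^ ((ν : ℝ) * α₁)) ^ p * K ν with hW
  refine ⟨δ, hδ, C + ∑ ν ∈ Finset.range (8 * d), W ν, fun ν f => ?_⟩
  by_cases hν : 8 * d ≤ ν
  · refine (hC ν hν f).trans (mul_le_mul_right (mul_le_mul' ?_ le_self_add) _)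
    exact_mod_cast le_self_add
  have h2 : ((2 : ℝ≥0∞) ^ ((ν : ℝ) * α₁)) ^ p ≠ ⊤ := ENNReal.rpow_ne_top_of_nonneg hp.le
    (ENNReal.rpow_ne_top_of_ne_zero (by norm_num) (by norm_num))
  have hWν : W ν ≤ C + ∑ ν ∈ Finset.range (8 * d), W ν :=
    (Finset.single_le_sum (f := W) (fun _ _ => zero_le)
      (Finset.mem_range.2 (not_le.1 hν))).trans le_add_self
  have hWc : (2 : ℝ≥0∞) ^ (-((ν : ℝ) * δ)) * W ν = (2 ^ ((ν : ℝ) * α₁)) ^ p * K ν := by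
    rw [hW]
    push_cast
    rw [ENNReal.coe_rpow_of_nonneg _ hp.le, ENNReal.coe_rpow_of_ne_zero (by norm_num),
      ENNReal.coe_rpow_of_ne_zero (by norm_num), ENNReal.coe_ofNat, ← mul_assoc, ← mul_assoc,
      ← ENNReal.rpow_add _ _ (by norm_num) (by norm_num), neg_add_cancel, ENNReal.rpow_zero, one_mul]
  simp only [ENNReal.mul_rpow_of_nonneg _ _ hp.le]
  rw [lintegral_const_mul' _ _ h2]
  refine (mul_le_mul_right (hK ν f) _).trans ?_
  rw [← mul_assoc, ← hWc, mul_assoc]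
  exact mul_le_mul_right (mul_le_mul_left (by exact_mod_cast hWν) _) _

end HighFrequencies

/-! ### The embedding inequality. -/

section Embedding

variable {d : ℕ}

/-- Stated for all tempered distributions, with `∞` allowed on both sides, it yields the inclusion
of the spaces and the norm estimate at once. -/
theorem exists_dyadicNorm_le (hd : 2 ≤ d) (D : DyadicPair d) (S : ShearletSystem d)
    (α₁ α₂ : ℝ) {p q : ℝ≥0∞} (hp₀ : 0 < p) (hp : p < ⊤) (hq : 0 < q)
    (hα : 2 * α₁ + d + (d - 1) * max 0 (1 - (1 / q).toReal) ≤ (d + 1) * α₂ + 1) :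
    ∃ C : ℝ≥0, ∀ f : 𝓢'(Eucl d, ℂ), dyadicNorm D α₁ p q f ≤ C * shearNorm S α₂ p q f := by
  set s := p.toReal with hs
  have hs0 : 0 < s := ENNReal.toReal_pos hp₀.ne' hp.ne
  have hs1 : 0 ≤ 1 / s := by positivity
  obtain ⟨δ, hδ, C, hC⟩ := exists_lintegral_bandPass_le hd D S α₁ α₂ hs0 hq hα
  obtain ⟨C', hC'⟩ := exists_lintegral_lqNorm_le (volume : Measure (Eucl d)) hs0 hδ hq
  obtain ⟨C₀, hC₀⟩ := exists_lintegral_conv_le S α₂ hs0 hq (hasCompactSupport_fourier_lowPass D)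
  refine ⟨(C₀ * 2) ^ (1 / s) + (C' * C * 2) ^ (1 / s), fun f => ?_⟩
  have hnorm : ∀ {ε : Type} [TopologicalSpace ε] [ContinuousENorm ε] (u : Eucl d → ε),
      eLpNorm u p volume = (∫⁻ x, ‖u x‖ₑ ^ s) ^ (1 / s) := fun u =>
    eLpNorm_eq_lintegral_rpow_enorm_toReal hp₀.ne' hp.ne
  set X := shearEnergy S α₂ s q f with hX
  set Y := ∫⁻ x, ‖conv f S.low x‖ₑ ^ s with hY
  have hshear : shearNorm S α₂ p q f = Y ^ (1 / s) + X ^ (1 / s) := by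
    rw [shearNorm, hnorm, hnorm]
    rfl
  have hXY : X + Y ≤ 2 * shearNorm S α₂ p q f ^ s := by
    have h1 : ∀ Z : ℝ≥0∞, Z ^ (1 / s) ≤ shearNorm S α₂ p q f → Z ≤ shearNorm S α₂ p q f ^ s :=
      fun Z hZ => by
        rw [one_div] at hZ
        exact (ENNReal.rpow_inv_le_iff hs0).1 hZ
    rw [two_mul]
    exact add_le_add (h1 X (hshear ▸ le_add_self)) (h1 Y (hshear ▸ le_self_add))
  have hroot : ∀ (K : ℝ≥0) (Z : ℝ≥0∞), Z ≤ K * (X + Y) →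
      Z ^ (1 / s) ≤ ((K * 2) ^ (1 / s) : ℝ≥0) * shearNorm S α₂ p q f := by
    intro K Z hZ
    refine (ENNReal.rpow_le_rpow (hZ.trans (mul_le_mul_right hXY _)) hs1).trans_eq ?_
    rw [← mul_assoc, ENNReal.mul_rpow_of_nonneg _ _ hs1, ← ENNReal.rpow_mul,
      mul_one_div_cancel hs0.ne', ENNReal.rpow_one, ENNReal.coe_rpow_of_nonneg _ hs1]
    push_cast
    rfl
  rw [dyadicNorm, hnorm, hnorm, ENNReal.coe_add, add_mul]
  refine add_le_add (hroot _ _ (hC₀ f)) (hroot _ _ ?_)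
  have hpow : ∀ ν : ℕ, ENNReal.ofReal ((2 : ℝ) ^ ((ν : ℝ) * α₁)) = 2 ^ ((ν : ℝ) * α₁) := fun ν => by
    rw [← ENNReal.ofReal_rpow_of_pos (by norm_num)]
    simp
  simp only [hpow, enorm_eq_self]
  rw [ENNReal.coe_mul, mul_assoc]
  exact hC' (fun ν x => 2 ^ ((ν : ℝ) * α₁) * ‖conv f (dyadicDilate ν D.bandPass) x‖ₑ) _
    (fun ν => measurable_const.mul (measurable_enorm_conv f _)) fun ν => hC ν f

end Embedding

end ShearletTL

end

theorem mainTheorem8 (d : ℕ) (hd : 2 ≤ d)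
    (D : ShearletTL.DyadicPair d) (S : ShearletTL.ShearletSystem d)
    (α₁ α₂ : ℝ) (p q : ℝ≥0∞) (hp₀ : 0 < p) (hp : p < ⊤) (hq : 0 < q)
    (hα : 2 * α₁ + d + (d - 1) * max 0 (1 - (1 / q).toReal) ≤ (d + 1) * α₂ + 1) :
    ShearletTL.shearSpace S α₂ p q ⊆ ShearletTL.dyadicSpace D α₁ p q ∧
      ∃ C : ℝ≥0, ∀ f ∈ ShearletTL.shearSpace S α₂ p q,
        ShearletTL.dyadicNorm D α₁ p q f ≤ C * ShearletTL.shearNorm S α₂ p q f := by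
  obtain ⟨C, hC⟩ := ShearletTL.exists_dyadicNorm_le hd D S α₁ α₂ hp₀ hp hq hα
  exact ⟨fun f hf => (hC f).trans_lt (ENNReal.mul_lt_top ENNReal.coe_lt_top hf),
    C, fun f _ => hC f⟩
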